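/- **Setting.** Write $\bar X=-X^\dagger$ for $X\in\mathfrak{sl}_3(\mathbb C)$ and $\bar g=(g^\dagger)^{-1}$ for $g\in SL_3(\mathbb C)$. Let $\tau(g)=S(g^t)^{-1}S^{-1}$ and, on the Lie algebra, $\tau(X)=-SX^tS^{-1}$, where $S=\begin{pmatrix}J&0\\0&1\end{pmatrix}$ and $J=\begin{pmatrix}0&1\\-1&0\end{pmatrix}$. Put $D=\mathrm{diag}(1,1,-2)$. Elements of $G=PU(3)$ and of $G^{\mathbb C}$ are represented by matrices in $SU(3)$ and $SL_3(\mathbb C)$. Let $G_0\cong SU(2)$ and $G_0^{\mathbb C}\cong SL_2(\mathbb C)$ be the fixed point groups of $\tau$ in $SU(3)$ and $SL_3(\mathbb C)$, and let $B\subset G_0^{\mathbb C}$ be the subgroup of upper triangular matrices with positive real diagonal entries. For $\Delta\subset\mathbb C\cup\{\infty\}$ invariant under $\zeta\mapsto\bar\zeta^{-1}$ and $\zeta\mapsto i\zeta$, let $\Lambda^\tau(\Delta,G)$ be the group of analytic maps $g:\Delta\to SL_3(\mathbb C)$ with $\overline{g_\zeta}=g_{\bar\zeta^{-1}}$ and $\tau(g_\zeta)=g_{i\zeta}$.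 For $0<\epsilon<1$ let $C_\epsilon=\{|\zeta|=\epsilon\text{ or }\epsilon^{-1}\}$, $E_\epsilon=\{\epsilon\le|\zeta|\le\epsilon^{-1}\}$, $I_\epsilon=\{|\zeta|\le\epsilon\}\cup\{|\zeta|\ge\epsilon^{-1}\}\cup\{\infty\}$, and $\Lambda^\tau_B(I_\epsilon,G)=\{g\in\Lambda^\tau(I_\epsilon,G):g_0\in B\}$. If $a=a_Ea_I$ on $C_\epsilon$ with $a_E\in\Lambda^\tau(E_\epsilon,G)$ and $a_I\in\Lambda^\tau_B(I_\epsilon,G)$ (such a factorisation is unique), then $a_E$ is called the $E$-factor of $a$. Let $\mu\neq0$ be a constant real $1$-form on $\mathbb C$. An *extended form* with Maslov form $\mu$ is a smooth $1$-form on $\mathbb C$ of the shape $\alpha_\zeta=\zeta^{-2}\alpha_{-2}+\zeta^{-1}\alpha_{-1}+\alpha_0+\zeta\alpha_1+\zeta^2\alpha_2$ with values in $\mathfrak{sl}_3(\mathbb C)$ such that $\overline{\alpha_\zeta}=\alpha_{\bar\zeta^{-1}}$, $\tau(\alpha_\zeta)=\alpha_{i\zeta}$, $\alpha_{-2}''=\alpha_{-1}''=0$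 and $\alpha_{-2}+\alpha_2=-i\pi\mu D$. Let $\hat{\mathcal E}(\mu)$ be the set of smooth maps $F:\mathbb C\to\Lambda^\tau(\mathbb C^\times,G)$ for which $F_\zeta^{-1}dF_\zeta$ is an extended form with Maslov form $\mu$. The class $[F]$ of $F\in\hat{\mathcal E}(\mu)$ is its orbit under right multiplication by $\mathcal G_0=C^\infty(\mathbb C,G_0)$. The vacuum solution is $F^\mu_\zeta(z)=\exp(z\zeta^{-2}A+\bar z\zeta^2\bar A)$, where $A\,dz=-i\pi\mu'D$. For $g\in\Lambda^\tau(I_\epsilon,G)$ put $(g\sharp F)(z)=(gF(z))_E$ and $g\sharp[F]=[g\sharp F]$. For $\eta:C_\epsilon\to\mathfrak{sl}_3(\mathbb C)$ with $\overline{\eta_\zeta}=\eta_{\bar\zeta^{-1}}$, and $f$ a scalar function of $\zeta$, let $f\eta$ be the loop which equals $f(\zeta)\eta_\zeta$ on $|\zeta|=\epsilon$ and $\overline{f(\bar\zeta^{-1})}\,\eta_\zeta$ on $|\zeta|=\epsilon^{-1}$. The Symes map is $\Phi(\eta)(z)=\exp(z\eta)_E$, where $z\eta$ is understood in this sense. **Proposition.**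 Let $\alpha_\zeta$ be an extended form with Maslov form $\mu\ne0$ that satisfies $d\alpha_\zeta+\frac12[\alpha_\zeta\wedge\alpha_\zeta]=0$ for all $\zeta\in\mathbb C^\times$. Let $\xi_\zeta$ be an adapted polynomial Killing field of degree $4d+2$, $d\ge0$, for $\alpha_\zeta$. That is, $\xi_\zeta$ depends smoothly on $z\in\mathbb C$, is a Laurent polynomial $\xi_\zeta=\sum_{|n|\le 4d+2}\zeta^n\xi_n$ with values in $\mathfrak{sl}_3(\mathbb C)$, $\overline{\xi_\zeta}=\xi_{\bar\zeta^{-1}}$, $\tau(\xi_\zeta)=\xi_{i\zeta}$, $d\xi_\zeta=[\xi_\zeta,\alpha_\zeta]$, $\xi_{-4d-2}=\alpha_{-2}(\partial/\partial z)$ and $\xi_{-4d-1}=\alpha_{-1}(\partial/\partial z)$. Set $\eta=\zeta^{4d}\xi_\zeta(0)$. Then there are $0<\epsilon<1$ and $g\in\Lambda^\tau_B(I_\epsilon,G)$ such that $g\sharp F^\mu$ and $\Phi(\eta)$ exist, that is, the factorisations that define them exist for every $z\in\mathbb C$, both belong to $\hat{\mathcal E}(\mu)$, and $$g\sharp[F^\mu]=[\Phi(\eta)].$$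 Moreover, $\alpha_\zeta$ has an extended frame $F\in\hat{\mathcal E}(\mu)$ with $F_\zeta^{-1}dF_\zeta=\alpha_\zeta$ and $F_\zeta(0)=I$, and it satisfies $[F]=[\Phi(\eta)]=g\sharp[F^\mu]$. Every frame $F'$ of $\alpha_\zeta$ for which $F'_\zeta(0)$ is a constant element of $G_0$ lies in the dressing orbit of the vacuum: $[F']=g'\sharp[F^\mu]$ for some $g'\in\Lambda^\tau_B(I_\epsilon,G)$. -/

import Mathlib

open scoped Matrix ComplexConjugate ContDiff Matrix.Norms.L2Operator

noncomputable section

namespace HSL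

/-- Complex `3 × 3` matrices (with the `ℓ²` operator norm; all norms on this
finite dimensional space are equivalent). Elements of `G = PU(3)` and of its complexification are
represented by matrices in `SU(3)` and `SL(3, ℂ)`. -/
abbrev Mat3 : Type := Matrix (Fin 3) (Fin 3) ℂ

/-- Matrix-valued smooth `1`-forms on the real surface `ℂ` (smoothness is imposed separately). -/
abbrev OneForm : Type := ℂ → ℂ →L[ℝ] Mat3

/-! ### The automorphism `τ` and the real form -/

/-- The matrix `S = diag(J, 1)`, `J = (0 1; -1 0)`. -/
def matS : Mat3 := !![0, 1, 0; -1, 0, 0; 0, 0, 1]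

/-- The matrix `diag(1, 1, -2)`. -/
def matD : Mat3 := !![1, 0, 0; 0, 1, 0; 0, 0, -2]

/-- The order four outer automorphism `τ(g) = S (gᵗ)⁻¹ S⁻¹` of `SL(3, ℂ)`. -/
def tauGrp (g : Mat3) : Mat3 := matS * (gᵀ)⁻¹ * matS⁻¹

/-- The automorphism of the Lie algebra `sl(3, ℂ)` induced by `τ`. -/
def tauAlg (X : Mat3) : Mat3 := -(matS * Xᵀ * matS⁻¹)

/-- Conjugation of `SL(3, ℂ)` with respect to the real form `SU(3)`. -/
def barGrp (g : Mat3) : Mat3 := (gᴴ)⁻¹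

/-- Conjugation of `sl(3, ℂ)` with respect to the real form `su(3)`. -/
def barAlg (X : Mat3) : Mat3 := -Xᴴ

/-- `G₀ᶜ ≅ SL(2, ℂ)`: the fixed points of `τ` in `SL(3, ℂ)`. -/
def G0C : Set Mat3 := {g | g.det = 1 ∧ tauGrp g = g}

/-- `G₀ ≅ SU(2)`: the fixed points of `τ` in `SU(3)`. -/
def G0 : Set Mat3 := {g | g ∈ G0C ∧ barGrp g = g}

/-- The subgroup `B ⊂ G₀ᶜ` of the upper triangular matrices with positive real diagonal entries. -/
def groupB : Set Mat3 :=
  {g | g ∈ G0C ∧ (∀ i j, j < i → g i j = 0) ∧ ∀ i, ∃ r : ℝ, 0 < r ∧ g i i = (r : ℂ)}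

/-! ### Loop groups -/

/-- Matrix-valued functions of the spectral parameter `ζ` in the Riemann sphere `ℂ ∪ {∞}`. Only the
values on a specified subset of the sphere matter. -/
abbrev Loop : Type := OnePoint ℂ → Mat3

/-- Extend a function on the plane by the (irrelevant) value `1` at infinity. -/
def ofPlane (f : ℂ → Mat3) : Loop := fun p => p.elim 1 f

/-- The map `ζ ↦ ζ⁻¹` of the Riemann sphere. -/
def sphereInv (p : OnePoint ℂ) : OnePoint ℂ :=
  p.elim ((0 : ℂ) : OnePoint ℂ)
    (fun ζ => if ζ = 0 then OnePoint.infty else ((ζ⁻¹ : ℂ) : OnePoint ℂ))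

/-- The map `ζ ↦ ζ̄` of the Riemann sphere. -/
def sphereConj (p : OnePoint ℂ) : OnePoint ℂ := OnePoint.map (fun ζ : ℂ => conj ζ) p

/-- The map `ζ ↦ i ζ` of the Riemann sphere. -/
def sphereRot (p : OnePoint ℂ) : OnePoint ℂ := OnePoint.map (fun ζ : ℂ => Complex.I * ζ) p

/-- Analyticity of a function near a point of the Riemann sphere (in the coordinate `ζ` at finite
points and in the coordinate `w = ζ⁻¹` at infinity). -/
def SphereAnalyticAt (g : Loop) (p : OnePoint ℂ) : Prop :=
  p.elim (AnalyticAt ℂ (fun w : ℂ => g (sphereInv (w : OnePoint ℂ))) 0)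
    (fun ζ => AnalyticAt ℂ (fun w : ℂ => g (w : OnePoint ℂ)) ζ)

/-- Membership in `Λ^τ(Δ, G)`, for a subset `Δ` of the Riemann sphere which is invariant under
`ζ ↦ ζ̄⁻¹` and `ζ ↦ i ζ`. -/
structure MemLoopGroup (Δ : Set (OnePoint ℂ)) (g : Loop) : Prop where
  analytic : ∀ p ∈ Δ, SphereAnalyticAt g p
  det_eq_one : ∀ p ∈ Δ, (g p).det = 1
  real : ∀ p ∈ Δ, barGrp (g p) = g (sphereInv (sphereConj p))
  equivariant : ∀ p ∈ Δ, tauGrp (g p) = g (sphereRot p)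

/-- The punctured plane `ℂ^×`. -/
def setCstar : Set (OnePoint ℂ) := {p | ∃ ζ : ℂ, p = (ζ : OnePoint ℂ) ∧ ζ ≠ 0}

/-- `C_ε`: the union of the circles of radius `ε` and `ε⁻¹`. -/
def setC (ε : ℝ) : Set (OnePoint ℂ) :=
  {p | ∃ ζ : ℂ, p = (ζ : OnePoint ℂ) ∧ (‖ζ‖ = ε ∨ ‖ζ‖ = ε⁻¹)}

/-- `E_ε`: the closed annulus bounded by `C_ε`. -/
def setE (ε : ℝ) : Set (OnePoint ℂ) :=
  {p | ∃ ζ : ℂ, p = (ζ : OnePoint ℂ) ∧ ε ≤ ‖ζ‖ ∧ ‖ζ‖ ≤ ε⁻¹}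

/-- `I_ε`: the union of the two closed discs of the sphere (around `0` and `∞`) bounded by `C_ε`. -/
def setI (ε : ℝ) : Set (OnePoint ℂ) :=
  {p | p = OnePoint.infty ∨ ∃ ζ : ℂ, p = (ζ : OnePoint ℂ) ∧ (‖ζ‖ ≤ ε ∨ ε⁻¹ ≤ ‖ζ‖)}

/-- Membership in `Λ^τ_B(I_ε, G)`. -/
def MemLoopGroupB (ε : ℝ) (g : Loop) : Prop :=
  MemLoopGroup (setI ε) g ∧ g ((0 : ℂ) : OnePoint ℂ) ∈ groupB

/-- `e` is the factor `a_E` in the factorisation `a = a_E a_I` on `C_ε` with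
`a_E ∈ Λ^τ(E_ε, G)` and `a_I ∈ Λ^τ_B(I_ε, G)` (such a factorisation is unique). -/
def IsEFactor (ε : ℝ) (a e : Loop) : Prop :=
  MemLoopGroup (setE ε) e ∧ ∃ b : Loop, MemLoopGroupB ε b ∧ ∀ p ∈ setC ε, a p = e p * b p

/-! ### Extended Maurer–Cartan forms and extended frames -/

/-- The coefficient `θ(∂/∂z)` of `dz` in a `1`-form `θ`. -/
def ddz (θ : OneForm) (z : ℂ) : Mat3 := (1 / 2 : ℂ) • (θ z 1 - Complex.I • θ z Complex.I)

/-- `θ'' = 0`, i.e. `θ` is of type `(1,0)`. -/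
def IsTypeOneZero (θ : OneForm) : Prop :=
  ∀ z v : ℂ, θ z (Complex.I * v) = Complex.I • θ z v

/-- The form `α_ζ = ζ⁻² α₋₂ + ζ⁻¹ α₋₁ + α₀ + ζ α₁ + ζ² α₂`. (Only the `α_j` with `|j| ≤ 2` enter.) -/
def extForm (α : ℤ → OneForm) (ζ : ℂ) : OneForm :=
  fun z => ∑ j ∈ Finset.Icc (-2 : ℤ) 2, (ζ ^ j) • α j z

/-- `α_ζ` is a smooth `1`-form on `ℂ` with values in the twisted loop algebra `Λ^τ 𝔤`, of the shape
`ζ⁻² α₋₂ + ζ⁻¹ α₋₁ + α₀ + ζ α₁ + ζ² α₂` with `α₋₂'' = 0` and `α₋₁'' = 0`. -/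
structure IsExtendedForm (α : ℤ → OneForm) : Prop where
  smooth : ∀ j ∈ Finset.Icc (-2 : ℤ) 2, ContDiff ℝ ∞ (α j)
  trace_eq_zero : ∀ ζ : ℂ, ζ ≠ 0 → ∀ z v : ℂ, (extForm α ζ z v).trace = 0
  real : ∀ ζ : ℂ, ζ ≠ 0 → ∀ z v : ℂ, barAlg (extForm α ζ z v) = extForm α (conj ζ)⁻¹ z v
  equivariant : ∀ ζ : ℂ, ζ ≠ 0 → ∀ z v : ℂ,
    tauAlg (extForm α ζ z v) = extForm α (Complex.I * ζ) z v
  type_neg_two : IsTypeOneZero (α (-2))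
  type_neg_one : IsTypeOneZero (α (-1))

/-- An extended Maurer–Cartan form: the Maurer–Cartan equations
`dα_ζ + ½ [α_ζ ∧ α_ζ] = 0` hold for all `ζ ∈ ℂ^×`. -/
structure IsExtendedMaurerCartanForm (α : ℤ → OneForm) : Prop extends IsExtendedForm α where
  flat : ∀ ζ : ℂ, ζ ≠ 0 → ∀ z u v : ℂ,
    fderiv ℝ (extForm α ζ) z u v - fderiv ℝ (extForm α ζ) z v u
      + ⁅extForm α ζ z u, extForm α ζ z v⁆ = 0

/-- The Maslov form normalisation `α₋₂ + α₂ = -iπ μ diag(1, 1, -2)`, where `μ` is a constant real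
`1`-form on `ℂ`. -/
def HasMaslovForm (α : ℤ → OneForm) (μ : ℂ →L[ℝ] ℝ) : Prop :=
  ∀ z v : ℂ, α (-2) z v + α 2 z v = (-(Complex.I * Real.pi * (μ v : ℂ))) • matD

/-- `F_ζ` is a smooth `Λ^τ(ℂ^×, G)`-valued function on `ℂ` with `F_ζ⁻¹ dF_ζ = α_ζ`. -/
structure IsFrameOf (α : ℤ → OneForm) (F : ℂ → Loop) : Prop where
  mem : ∀ z : ℂ, MemLoopGroup setCstar (F z)
  smooth : ∀ ζ : ℂ, ζ ≠ 0 → ContDiff ℝ ∞ (fun z => F z (ζ : OnePoint ℂ))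
  deriv_eq : ∀ ζ : ℂ, ζ ≠ 0 → ∀ z v : ℂ,
    fderiv ℝ (fun w => F w (ζ : OnePoint ℂ)) z v = F z (ζ : OnePoint ℂ) * extForm α ζ z v

/-- Membership in the enlarged space `Ê(μ)` of extended frames with Maslov form `μ`. -/
def IsEnlargedFrame (μ : ℂ →L[ℝ] ℝ) (F : ℂ → Loop) : Prop :=
  ∃ β : ℤ → OneForm, IsExtendedForm β ∧ HasMaslovForm β μ ∧ IsFrameOf β F

/-- `F` is based: `F_ζ(0)` is a constant element of `G₀`. -/
def IsBased (F : ℂ → Loop) : Prop :=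
  ∃ c ∈ G0, ∀ ζ : ℂ, ζ ≠ 0 → F 0 (ζ : OnePoint ℂ) = c

/-- `F 𝒢₀ = H 𝒢₀`, i.e. `[F] = [H]`, where `𝒢₀ = C^∞(ℂ, G₀)` acts by right multiplication. -/
def GaugeEquivalent (F H : ℂ → Loop) : Prop :=
  ∃ k : ℂ → Mat3, ContDiff ℝ ∞ k ∧ (∀ z, k z ∈ G0) ∧
    ∀ z ζ : ℂ, ζ ≠ 0 → H z (ζ : OnePoint ℂ) = F z (ζ : OnePoint ℂ) * k z

/-! ### The vacuum solution, the dressing action and the Symes map -/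

/-- The matrix `A` with `A dz = -iπ μ' diag(1, 1, -2)`. -/
def vacuumA (μ : ℂ →L[ℝ] ℝ) : Mat3 :=
  (-(Complex.I * Real.pi * ((1 / 2 : ℂ) * ((μ 1 : ℂ) - Complex.I * (μ Complex.I : ℂ))))) • matD

/-- The vacuum solution `F^μ_ζ(z) = exp(z ζ⁻² A + z̄ ζ² Ā)`. -/
def vacuumFrame (μ : ℂ →L[ℝ] ℝ) (z : ℂ) : Loop :=
  ofPlane fun ζ =>
    NormedSpace.exp ((z * ζ ^ (-2 : ℤ)) • vacuumA μ + (conj z * ζ ^ (2 : ℤ)) • barAlg (vacuumA μ))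

/-- `H = g ♯ F`, i.e. `H(z) = (g F(z))_E` for all `z`. -/
def IsDressing (ε : ℝ) (g : Loop) (F H : ℂ → Loop) : Prop :=
  ∀ z : ℂ, IsEFactor ε (fun p => g p * F z p) (H z)

/-- An element `η` of `Λ^τ(C_ε, 𝔤)` is determined through the reality condition by its restriction
to the circle of radius `ε`. This is the element obtained by multiplying the loop on the circle of
radius `ε` by the scalar function `f` (and the loop on the circle of radius `ε⁻¹` accordingly). -/
def innerMul (f : ℂ → ℂ) (η : ℂ → Mat3) (ζ : ℂ) : Mat3 :=
  if ‖ζ‖ < 1 then f ζ • η ζ else conj (f (conj ζ)⁻¹) • η ζ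

/-- `H = Φ(η)`, where `Φ(η)(z) = exp(z η)_E` is the Symes map. -/
def IsSymes (ε : ℝ) (η : ℂ → Mat3) (H : ℂ → Loop) : Prop :=
  ∀ z : ℂ, IsEFactor ε (ofPlane fun ζ => NormedSpace.exp (innerMul (fun _ => z) η ζ)) (H z)

/-! ### Polynomial Killing fields -/

/-- `ξ` is an adapted polynomial Killing field of degree `4d + 2` for `α_ζ`: a smooth map
from `ℂ` to `Λ^τ 𝔤` with `dξ_ζ = [ξ_ζ, α_ζ]` and
`ξ_ζ = ζ^{-4d-2} α₋₂(∂/∂z) + ζ^{-4d-1} α₋₁(∂/∂z) + …` (by reality this expansion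
ends with the term in `ζ^{4d+2}`). -/
structure IsAdaptedPolynomialKillingField (α : ℤ → OneForm) (d : ℕ) (ξ : ℂ → ℂ → Mat3) :
    Prop where
  expansion : ∃ c : ℤ → ℂ → Mat3, (∀ n, ContDiff ℝ ∞ (c n)) ∧
    (∀ z ζ : ℂ, ζ ≠ 0 →
      ξ z ζ = ∑ n ∈ Finset.Icc (-(4 * (d : ℤ) + 2)) (4 * (d : ℤ) + 2), (ζ ^ n) • c n z) ∧
    (∀ z, c (-(4 * (d : ℤ) + 2)) z = ddz (α (-2)) z) ∧
    (∀ z, c (-(4 * (d : ℤ) + 1)) z = ddz (α (-1)) z)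
  trace_eq_zero : ∀ z ζ : ℂ, ζ ≠ 0 → (ξ z ζ).trace = 0
  real : ∀ z ζ : ℂ, ζ ≠ 0 → barAlg (ξ z ζ) = ξ z (conj ζ)⁻¹
  equivariant : ∀ z ζ : ℂ, ζ ≠ 0 → tauAlg (ξ z ζ) = ξ z (Complex.I * ζ)
  lax : ∀ ζ : ℂ, ζ ≠ 0 → ∀ z v : ℂ,
    fderiv ℝ (fun w => ξ w ζ) z v = ⁅ξ z ζ, extForm α ζ z v⁆

end HSL

end

/-! Both sides of $g\sharp[F^\mu]=[\Phi(\eta)]$ are compared with the extended frame $F$ of $\alpha$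
normalised by $F(0)=1$. On the punctured inner disc each of the loops $\exp(z\eta)$ and $gF^\mu(z)$
turns out to be $F(z)$ times a loop holomorphic at $\zeta=0$. The value of that loop at $0$ lies in
$G_0^{\mathbb C}$, and the Iwasawa decomposition $G_0^{\mathbb C}=G_0B$ moves its unitary part into
$F$. So both $E$-factors exist for every $z$ and are gauge transforms of $F$
(`exists_gauge_isEFactor`); no general factorisation theorem is needed.

The Symes side (`exists_holomorphic_factor`). Put $X_\zeta=\zeta^{4d}\xi_\zeta$. The two lowest
coefficients of $X_\zeta$ are those of $\alpha_\zeta$, and $\alpha_{-2}$, $\alpha_{-1}$ are of type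
$(1,0)$, so $\alpha_\zeta-X_\zeta\,dz$ has no pole at $\zeta=0$. The Lax equation makes this form
flat, with frame $\exp(-zX_\zeta(0))F_\zeta$. Flat forms depending holomorphically on $\zeta$ have
frames holomorphic in $\zeta$ (`exists_holomorphic_frame`), hence $\exp(-z\eta)F$ extends over
$\zeta=0$.

The vacuum side (`exists_vacuum_dressing`). The polynomial $N_\zeta=\zeta^{4d+2}\xi_\zeta(0)$ has
$N_0=A=aD$, with $a\ne0$ because $\mu\ne0$. The eigenvalues of $D$ on the $2+1$ blocks differ, so
near $\zeta=0$ a twisted holomorphic $g$ with $g_0=1$ conjugates $N$ to block diagonal form. The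
twisting makes the conjugated matrix even in $\zeta$, so it equals $A+\zeta^2m_\zeta$, where $m$ is
holomorphic and commutes with $A$. Therefore $g^{-1}\eta g=\zeta^{-2}A+m$, and
$gF^\mu=\exp(z\eta)\,g\exp(-zm)\exp(\bar z\zeta^2\bar A)$ differs from $\exp(z\eta)$ by a factor
holomorphic at $0$.

A frame with initial value $c\in G_0$ is $cF$. As $c$ commutes with $D$, hence with the vacuum, it
arises in the same way from $cgc^{-1}$. -/

open scoped Matrix ComplexConjugate ContDiff Matrix.Norms.L2Operator

noncomputable section

namespace HSL

/-! ### Linear differential equations in Banach algebras -/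

section LinearODE

variable {𝔅 : Type*} [NormedRing 𝔅] [NormedAlgebra ℝ 𝔅]

/-- The terms of the Dyson series of `φ' = φ a`, `φ(0) = 1`. -/
def dysonTerm (a : ℝ → 𝔅) : ℕ → ℝ → 𝔅
  | 0 => fun _ => 1
  | n + 1 => fun t => ∫ s in (0 : ℝ)..t, dysonTerm a n s * a s

theorem dysonTerm_continuous {a : ℝ → 𝔅} (ha : Continuous a) (n : ℕ) :
    Continuous (dysonTerm a n) := by
  induction n with
  | zero => exact continuous_const
  | succ n ih =>
    exact intervalIntegral.continuous_primitive
      (fun _ _ => (ih.mul ha).intervalIntegrable _ _) 0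

/-- Each further integration gains a factor $|t|/(n+1)$, whence the factorial. The factor `‖1‖`
stays because the norm is not assumed to satisfy `‖1‖ = 1`. -/
theorem dysonTerm_norm_le {a : ℝ → 𝔅} (ha : Continuous a) {T M : ℝ}
    (hM : ∀ t ∈ Set.Ioo (-T) T, ‖a t‖ ≤ M) (n : ℕ) {t : ℝ} (ht : t ∈ Set.Ioo (-T) T) :
    ‖dysonTerm a n t‖ ≤ ‖(1 : 𝔅)‖ * (M ^ n * |t| ^ n / n.factorial) := by
  induction n generalizing t with
  | zero => simp [dysonTerm]
  | succ n ih =>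
    have hT : 0 < T := by linarith [ht.1, ht.2]
    have hM0 : 0 ≤ M := (norm_nonneg _).trans (hM t ht)
    have hsub : ∀ s ∈ Set.uIoc 0 t, s ∈ Set.Ioo (-T) T := by
      intro s hs
      rcases Set.mem_uIoc.1 hs with h | h
      · exact ⟨by linarith [h.1], by linarith [h.2, ht.2]⟩
      · exact ⟨by linarith [h.1, ht.1], by linarith [h.2]⟩
    calc ‖dysonTerm a (n + 1) t‖
        ≤ ∫ s in Set.uIoc 0 t, ‖dysonTerm a n s * a s‖ :=
          intervalIntegral.norm_integral_le_integral_norm_uIoc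
      _ ≤ ∫ s in Set.uIoc 0 t, ‖(1 : 𝔅)‖ * M ^ (n + 1) / n.factorial * |s - 0| ^ n := by
          refine MeasureTheory.setIntegral_mono_on ?_ ?_ measurableSet_uIoc fun s hs => ?_
          · exact (intervalIntegrable_iff.1
              (((dysonTerm_continuous ha n).mul ha).norm.intervalIntegrable _ _))
          · exact (intervalIntegrable_iff.1
              ((by fun_prop : Continuous fun s : ℝ => ‖(1 : 𝔅)‖ * M ^ (n + 1) / n.factorial *
                |s - 0| ^ n).intervalIntegrable _ _))
          · calc ‖dysonTerm a n s * a s‖ ≤ ‖dysonTerm a n s‖ * ‖a s‖ := norm_mul_le _ _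
              _ ≤ ‖(1 : 𝔅)‖ * (M ^ n * |s| ^ n / n.factorial) * M := by
                  gcongr
                  · exact ih (hsub s hs)
                  · exact hM s (hsub s hs)
              _ = _ := by rw [sub_zero]; ring
      _ = ‖(1 : 𝔅)‖ * (M ^ (n + 1) * |t| ^ (n + 1) / (n + 1).factorial) := by
          rw [MeasureTheory.integral_const_mul, integral_pow_abs_sub_uIoc, Nat.factorial_succ]
          push_cast
          rw [sub_zero]
          field_simp

variable [CompleteSpace 𝔅]

theorem dysonTerm_hasDerivAt {a : ℝ → 𝔅} (ha : Continuous a) (n : ℕ) (t : ℝ) :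
    HasDerivAt (dysonTerm a (n + 1)) (dysonTerm a n t * a t) t :=
  intervalIntegral.integral_hasDerivAt_right
    (((dysonTerm_continuous ha n).mul ha).intervalIntegrable _ _)
    ((dysonTerm_continuous ha n).mul ha).aestronglyMeasurable.stronglyMeasurableAtFilter
    ((dysonTerm_continuous ha n).mul ha).continuousAt

/-- Global solvability of a linear differential equation in a Banach algebra. -/
theorem exists_linearODE {a : ℝ → 𝔅} (ha : Continuous a) :
    ∃ φ : ℝ → 𝔅, φ 0 = 1 ∧ ∀ t, HasDerivAt φ (φ t * a t) t := by
  -- The majorant is uniform on bounded intervals only, so the series is differentiated on each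
  -- $(-T,T)$ separately; its sum does not depend on $T$.
  have key : ∀ T : ℝ, 0 < T → ∀ t ∈ Set.Ioo (-T) T,
      Summable (fun n => dysonTerm a n t) ∧
      HasDerivAt (fun t => ∑' n, dysonTerm a n t) ((∑' n, dysonTerm a n t) * a t) t := by
    intro T hT
    obtain ⟨M, hM⟩ := (isCompact_Icc (a := -T) (b := T)).exists_bound_of_continuousOn
      ha.continuousOn
    have hM' : ∀ t ∈ Set.Ioo (-T) T, ‖a t‖ ≤ M := fun t ht => hM t ⟨ht.1.le, ht.2.le⟩
    have hM0 : 0 ≤ M := (norm_nonneg _).trans (hM' 0 ⟨by linarith, hT⟩)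
    have hsum : Summable fun n : ℕ => ‖(1 : 𝔅)‖ * ((M * T) ^ n / n.factorial) :=
      (Real.summable_pow_div_factorial (M * T)).mul_left _
    have hb : ∀ n : ℕ, ∀ t ∈ Set.Ioo (-T) T,
        ‖dysonTerm a n t‖ ≤ ‖(1 : 𝔅)‖ * ((M * T) ^ n / n.factorial) := by
      intro n t ht
      refine (dysonTerm_norm_le ha hM' n ht).trans ?_
      rw [mul_pow]
      have : |t| ≤ T := abs_le.2 ⟨ht.1.le, ht.2.le⟩
      gcongr
    have hs : ∀ t ∈ Set.Ioo (-T) T, Summable (fun n => dysonTerm a n t) := fun t ht =>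
      Summable.of_norm_bounded hsum fun n => hb n t ht
    intro t ht
    refine ⟨hs t ht, ?_⟩
    -- Termwise derivatives: term $0$ is constant, and term $n+1$ differentiates to term $n$ times
    -- $a$. This shift of the index is what reproduces the equation.
    let g' : ℕ → ℝ → 𝔅 := fun n => Nat.casesOn n (fun _ => 0) fun n t => dysonTerm a n t * a t
    let u : ℕ → ℝ := fun n => Nat.casesOn n 0 fun n =>
      ‖(1 : 𝔅)‖ * ((M * T) ^ n / n.factorial) * M
    have hu : Summable u := (summable_nat_add_iff 1).1 (hsum.mul_right M)
    have h := hasDerivAt_tsum_of_isPreconnected (g := dysonTerm a) (g' := g') hu isOpen_Ioo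
      isPreconnected_Ioo (t := Set.Ioo (-T) T) (y₀ := 0) (y := t) ?_ ?_ ⟨by linarith, hT⟩
      (hs 0 ⟨by linarith, hT⟩) ht
    · have hg : Summable fun n => g' n t :=
        (summable_nat_add_iff 1).1 ((hs t ht).mul_right (a t))
      have e : (∑' n, dysonTerm a n t) * a t = ∑' n, g' n t := by
        rw [hg.tsum_eq_zero_add, ← (hs t ht).tsum_mul_right (a t)]
        exact (zero_add _).symm
      rw [e]
      exact h
    · rintro (_ | n) y hy
      · exact hasDerivAt_const _ _
      · exact dysonTerm_hasDerivAt ha n y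
    · rintro (_ | n) y hy
      · simp [g', u]
      · refine (norm_mul_le _ _).trans ?_
        exact mul_le_mul (hb n y hy) (hM' y hy) (norm_nonneg _) ((norm_nonneg _).trans (hb n y hy))
  refine ⟨fun t => ∑' n, dysonTerm a n t, ?_, fun t => ?_⟩
  · have : ∀ n, n ≠ 0 → dysonTerm a n 0 = 0 := by
      rintro (_ | n) hn
      · exact absurd rfl hn
      · simp [dysonTerm]
    simpa [dysonTerm] using tsum_eq_single 0 this
  · exact (key (|t| + 1) (by positivity) t (abs_lt.1 (lt_add_one |t|))).2

end LinearODE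

section Flat

variable {𝔅 : Type*} [NormedRing 𝔅] [NormedAlgebra ℝ 𝔅]

/-- Uniqueness for linear differential equations in a normed algebra. -/
theorem linearODE_unique {a φ ψ : ℝ → 𝔅} (ha : Continuous a)
    (hφ : ∀ t, HasDerivAt φ (φ t * a t) t) (hψ : ∀ t, HasDerivAt ψ (ψ t * a t) t)
    (h0 : φ 0 = ψ 0) {t : ℝ} (ht : t ∈ Set.Icc (0 : ℝ) 1) : φ t = ψ t := by
  obtain ⟨M, hM⟩ := (isCompact_Icc (a := (0 : ℝ)) (b := 1)).exists_bound_of_continuousOn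
    ha.continuousOn
  have hd : ∀ t, HasDerivAt (fun t => φ t - ψ t) ((φ t - ψ t) * a t) t := fun t => by
    rw [sub_mul]; exact (hφ t).sub (hψ t)
  refine sub_eq_zero.1 (eq_zero_of_abs_deriv_le_mul_abs_self_of_eq_zero_right (K := M)
    (f := fun t => φ t - ψ t) (fun t _ => (hd t).continuousAt.continuousWithinAt)
    (fun t _ => (hd t).hasDerivWithinAt) (sub_eq_zero.2 h0) (fun t ht => ?_) t ht)
  refine (norm_mul_le _ _).trans ?_
  rw [mul_comm]
  exact mul_le_mul_of_nonneg_right (hM t ⟨ht.1, ht.2.le⟩) (norm_nonneg _)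

/-- Uniqueness of frames with given Maurer–Cartan form and initial value. -/
theorem frame_unique {θ : ℂ → ℂ →L[ℝ] 𝔅} (hθ : Continuous θ) {F H : ℂ → 𝔅}
    (hF : ∀ z, HasFDerivAt F (ContinuousLinearMap.mul ℝ 𝔅 (F z) ∘L θ z) z)
    (hH : ∀ z, HasFDerivAt H (ContinuousLinearMap.mul ℝ 𝔅 (H z) ∘L θ z) z)
    (h0 : F 0 = H 0) (z : ℂ) : F z = H z := by
  have hl : ∀ t : ℝ, HasDerivAt (fun t : ℝ => (t : ℂ) * z) z t := fun t => by
    simpa using (Complex.ofRealCLM.hasDerivAt (x := t)).mul_const z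
  -- Along the ray $t\mapsto tz$ both functions solve the same linear equation, with coefficient
  -- $\theta_{tz}(z)$.
  have := linearODE_unique (a := fun t : ℝ => θ (t * z) z) (by fun_prop)
    (φ := fun t : ℝ => F (t * z)) (ψ := fun t : ℝ => H (t * z))
    (fun t => (hF _).comp_hasDerivAt t (hl t)) (fun t => (hH _).comp_hasDerivAt t (hl t))
    (by simpa using h0) (t := 1) ⟨zero_le_one, le_rfl⟩
  simpa using this

/-- A frame of a smooth form is smooth. -/
theorem frame_contDiff {θ : ℂ → ℂ →L[ℝ] 𝔅} (hθ : ContDiff ℝ ∞ θ) {F : ℂ → 𝔅}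
    (hF : ∀ z, HasFDerivAt F (ContinuousLinearMap.mul ℝ 𝔅 (F z) ∘L θ z) z) :
    ContDiff ℝ ∞ F := by
  refine contDiff_infty.2 fun n => ?_
  induction n with
  | zero =>
    exact contDiff_zero.2 (continuous_iff_continuousAt.2 fun z => (hF z).continuousAt)
  | succ n ih =>
    -- Bootstrapping: $dF=F\theta$ is as smooth as $F$ already is, so $F$ gains one derivative.
    refine (contDiff_succ_iff_hasFDerivAt (n := n)).2
      ⟨fun z => ContinuousLinearMap.mul ℝ 𝔅 (F z) ∘L θ z, ?_, hF⟩
    exact ((ContinuousLinearMap.mul ℝ 𝔅).contDiff.comp ih).clm_comp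
      (hθ.of_le (by exact_mod_cast le_top))

/-- Second order Taylor estimate for a smooth function on a ball. -/
theorem exists_taylor_bound {E F : Type*} [NormedAddCommGroup E] [NormedSpace ℝ E] [ProperSpace E]
    [NormedAddCommGroup F] [NormedSpace ℝ F]
    {f : E → F} (hf : ContDiff ℝ ∞ f) (R : ℝ) :
    ∃ C : ℝ, 0 ≤ C ∧ (∀ x ∈ Metric.closedBall (0 : E) R, ‖f x‖ ≤ C) ∧
      (∀ x ∈ Metric.closedBall (0 : E) R, ∀ y ∈ Metric.closedBall (0 : E) R,
        ‖f y - f x‖ ≤ C * ‖y - x‖) ∧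
      ∀ x ∈ Metric.closedBall (0 : E) R, ∀ y ∈ Metric.closedBall (0 : E) R,
        ‖f y - f x - fderiv ℝ f x (y - x)‖ ≤ C * ‖y - x‖ ^ 2 := by
  have hf1 : ContDiff ℝ ∞ (fderiv ℝ f) := hf.fderiv_right (by simp)
  have hf2 : ContDiff ℝ ∞ (fderiv ℝ (fderiv ℝ f)) := hf1.fderiv_right (by simp)
  have hK := isCompact_closedBall (0 : E) R
  obtain ⟨C0, h0⟩ := hK.exists_bound_of_continuousOn hf.continuous.continuousOn
  obtain ⟨C1, h1⟩ := hK.exists_bound_of_continuousOn hf1.continuous.continuousOn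
  have hc2 : Continuous (fun x => ‖fderiv ℝ (fderiv ℝ f) x‖) :=
    (continuous_norm (E := E →L[ℝ] E →L[ℝ] F)).comp hf2.continuous
  obtain ⟨C2, h2⟩ := hK.exists_bound_of_continuousOn hc2.continuousOn
  replace h2 : ∀ x ∈ Metric.closedBall (0 : E) R, ‖fderiv ℝ (fderiv ℝ f) x‖ ≤ C2 :=
    fun x hx => (le_abs_self _).trans (h2 x hx)
  have hd : Differentiable ℝ f := hf.differentiable (by simp)
  have hd1 : Differentiable ℝ (fderiv ℝ f) := hf1.differentiable (by simp)
  refine ⟨max 0 (max C0 (max C1 C2)), le_max_left _ _, fun x hx => ?_, fun x hx y hy => ?_,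
    fun x hx y hy => ?_⟩
  · exact (h0 x hx).trans (by simp)
  · refine ((convex_closedBall (0 : E) R).norm_image_sub_le_of_norm_fderiv_le
      (fun x _ => hd x) h1 hx hy).trans ?_
    gcongr
    simp
  · have hseg : segment ℝ x y ⊆ Metric.closedBall (0 : E) R :=
      (convex_closedBall (0 : E) R).segment_subset hx hy
    have hb : ∀ u ∈ segment ℝ x y, ‖fderiv ℝ f u - fderiv ℝ f x‖ ≤
        max 0 (max C0 (max C1 C2)) * ‖y - x‖ := by
      intro u hu
      refine ((convex_closedBall (0 : E) R).norm_image_sub_le_of_norm_fderiv_le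
        (fun x _ => hd1 x) h2 hx (hseg hu)).trans ?_
      have : ‖u - x‖ ≤ ‖y - x‖ := by
        obtain ⟨s, hs, rfl⟩ := (segment_eq_image' ℝ x y).subset hu
        rw [add_sub_cancel_left, norm_smul, Real.norm_of_nonneg hs.1]
        exact mul_le_of_le_one_left (norm_nonneg _) hs.2
      have h0 := (ContinuousLinearMap.opNorm_nonneg _).trans (h2 x hx)
      gcongr
      simp
    have := (convex_segment x y).norm_image_sub_le_of_norm_fderiv_le'
      (fun x _ => hd x) hb (left_mem_segment ℝ x y) (right_mem_segment ℝ x y)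
    rwa [mul_assoc, ← sq] at this

variable [CompleteSpace 𝔅]

/-- A flat `𝔅`-valued `1`-form on the plane is the Maurer–Cartan form of a frame. -/
theorem exists_frame_of_flat {θ : ℂ → ℂ →L[ℝ] 𝔅} (hθ : ContDiff ℝ ∞ θ)
    (hflat : ∀ z u v, fderiv ℝ θ z u v - fderiv ℝ θ z v u + ⁅θ z u, θ z v⁆ = 0) :
    ∃ F : ℂ → 𝔅, F 0 = 1 ∧
      ∀ z, HasFDerivAt F (ContinuousLinearMap.mul ℝ 𝔅 (F z) ∘L θ z) z := by
  have hθc : Continuous θ := hθ.continuous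
  have hex : ∀ z : ℂ, ∃ φ : ℝ → 𝔅, φ 0 = 1 ∧ ∀ t, HasDerivAt φ (φ t * θ (t * z) z) t :=
    fun z => exists_linearODE (by fun_prop)
  choose φ hφ0 hφ using hex
  -- The frame at $z$ is obtained by integrating along the segment from $0$ to $z$. What remains is
  -- its derivative at $z$ in every direction.
  refine ⟨fun z => φ z 1, ?_, fun z => ?_⟩
  · rw [← hφ0 0]
    refine linearODE_unique (a := fun t => θ (t * 0) 0) (by fun_prop) (hφ 0)
      (ψ := fun _ => φ 0 0) (fun t => ?_) rfl ⟨zero_le_one, le_rfl⟩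
    simpa using hasDerivAt_const t (φ 0 0)
  obtain ⟨C, hC0, hC, hCl, hCq⟩ := exists_taylor_bound hθ (‖z‖ + 1)
  obtain ⟨P, hP⟩ := (isCompact_Icc (a := (0 : ℝ)) (b := 1)).exists_bound_of_continuousOn
    (f := φ z) (fun t _ => (hφ z t).continuousAt.continuousWithinAt)
  have hP0 : 0 ≤ P := (norm_nonneg _).trans (hP 0 (by simp))
  set R := ‖z‖ + 1 with hR
  have hR1 : 1 ≤ R := by simp [hR]
  have hzR : ‖z‖ ≤ R := by simp [hR]
  -- the derivative of the approximate solution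
  let K : ℝ := C * R + 1
  have hK : 0 < K := by positivity
  -- The four summands come from the four error terms in the defect computed below. The `+ 1` in `K`
  -- only keeps the Grönwall constant nonzero.
  let Q : ℝ := P * (C * R + C + C ^ 2 + C ^ 2 * R)
  have est : ∀ w : ℂ, ‖w‖ ≤ 1 →
      ‖φ (z + w) 1 - φ z 1 - φ z 1 * θ z w‖ ≤ Q / K * (Real.exp K - 1) * ‖w‖ ^ 2 := by
    intro w hw
    have hzw : ‖z + w‖ ≤ R := (norm_add_le _ _).trans (by simpa [hR] using hw)
    -- First order guess for the solution along the ray to $z+w$. At $t=1$ it equals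
    -- $F(z)+F(z)\theta_z(w)$. Its defect is $O(\|w\|^2)$, so by Grönwall's inequality its error is
    -- as well.
    let χ : ℝ → 𝔅 := fun t => φ z t * (1 + t • θ (t * z) w)
    let χ' : ℝ → 𝔅 := fun t => φ z t * θ (t * z) z * (1 + t • θ (t * z) w) +
      φ z t * ((1 : ℝ) • θ (t * z) w + t • fderiv ℝ θ (t * z) z w)
    have hl : ∀ t : ℝ, HasDerivAt (fun t : ℝ => (t : ℂ) * z) z t := fun t => by
      simpa using (Complex.ofRealCLM.hasDerivAt (x := t)).mul_const z
    have hχ : ∀ t, HasDerivAt χ (χ' t) t := by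
      intro t
      refine (hφ z t).mul (HasDerivAt.const_add _ ?_)
      have h1 : HasDerivAt (fun t : ℝ => θ (t * z) w) (fderiv ℝ θ (t * z) z w) t :=
        ((((hθ.differentiable (by simp)) _).hasFDerivAt.comp_hasDerivAt t (hl t)).clm_apply
          (hasDerivAt_const t w)).congr_deriv (by simp)
      exact ((hasDerivAt_id t).smul h1).congr_deriv (by simp [add_comm])
    have hmem : ∀ t ∈ Set.Icc (0 : ℝ) 1, ∀ x : ℂ, ‖x‖ ≤ R →
        (t : ℂ) * x ∈ Metric.closedBall (0 : ℂ) R := by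
      intro t ht x hx
      rw [mem_closedBall_zero_iff, norm_mul, Complex.norm_real, Real.norm_of_nonneg ht.1]
      exact (mul_le_of_le_one_left (norm_nonneg _) ht.2).trans hx
    have hρ : ∀ t ∈ Set.Ico (0 : ℝ) 1,
        ‖χ' t - χ t * θ (t * (z + w)) (z + w)‖ ≤ Q * ‖w‖ ^ 2 := by
      intro t ht
      have ht' : t ∈ Set.Icc (0 : ℝ) 1 := ⟨ht.1, ht.2.le⟩
      have htz := hmem t ht' z hzR
      have htzw := hmem t ht' (z + w) hzw
      have hdiff : (t : ℂ) * (z + w) - t * z = t • w := by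
        rw [Complex.real_smul]; ring
      set Δ : ℂ →L[ℝ] 𝔅 := θ (t * (z + w)) - θ (t * z) with hΔ
      set E : ℂ →L[ℝ] 𝔅 := Δ - t • fderiv ℝ θ (t * z) w with hE
      have htw : ‖t • w‖ ≤ ‖w‖ := by
        rw [norm_smul, Real.norm_of_nonneg ht.1]
        exact mul_le_of_le_one_left (norm_nonneg _) ht.2.le
      have hΔn : ‖Δ‖ ≤ C * ‖w‖ := by
        have := hCl _ htz _ htzw
        rw [hdiff] at this
        exact this.trans (by gcongr)
      have hEn : ‖E‖ ≤ C * ‖w‖ ^ 2 := by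
        have := hCq _ htz _ htzw
        rw [hdiff, map_smul] at this
        exact this.trans (by gcongr)
      have hθn := hC _ htz
      have hid : χ' t - χ t * θ (t * (z + w)) (z + w) =
          φ z t * (-(E z) - Δ w - t • (θ (t * z) w * θ (t * z) w)
            - t • (θ (t * z) w * Δ (z + w))) := by
        have h1 : θ (t * (z + w)) = θ (t * z) + Δ := by rw [hΔ]; abel
        -- Flatness enters only here. It exchanges the two arguments of $d\theta$, and the
        -- commutator that appears cancels the terms of first order in $w$.
        have h2 : fderiv ℝ θ (t * z) z w = fderiv ℝ θ (t * z) w z -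
            (θ (t * z) z * θ (t * z) w - θ (t * z) w * θ (t * z) z) := by
          have := hflat (t * z) z w
          rw [Ring.lie_def] at this
          rw [← sub_eq_zero, ← this]; abel
        have h3 : E z = Δ z - t • fderiv ℝ θ (t * z) w z := by simp [hE]
        simp only [χ', χ]
        rw [h1]
        simp only [h2, h3, add_apply, map_add, one_smul, mul_add,
          mul_sub, add_mul, mul_one, smul_sub, mul_smul_comm, smul_mul_assoc, mul_neg, mul_assoc,
          smul_add]
        abel
      rw [hid]
      have ht1 : ‖t‖ ≤ 1 := by rw [Real.norm_of_nonneg ht.1]; exact ht.2.le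
      have hθ1 : ‖θ (t * z) w‖ ≤ C * ‖w‖ := (ContinuousLinearMap.le_of_opNorm_le _ hθn w)
      have b1 : ‖E z‖ ≤ C * ‖w‖ ^ 2 * R :=
        (ContinuousLinearMap.le_of_opNorm_le _ hEn z).trans (by gcongr)
      have b2 : ‖Δ w‖ ≤ C * ‖w‖ * ‖w‖ := ContinuousLinearMap.le_of_opNorm_le _ hΔn w
      have b3 : ‖t • (θ (t * z) w * θ (t * z) w)‖ ≤ 1 * ((C * ‖w‖) * (C * ‖w‖)) := by
        rw [norm_smul]
        exact mul_le_mul ht1 ((norm_mul_le _ _).trans (mul_le_mul hθ1 hθ1 (norm_nonneg _)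
          (by positivity))) (norm_nonneg _) zero_le_one
      have b4 : ‖t • (θ (t * z) w * Δ (z + w))‖ ≤ 1 * ((C * ‖w‖) * (C * ‖w‖ * R)) := by
        rw [norm_smul]
        refine mul_le_mul ht1 ((norm_mul_le _ _).trans (mul_le_mul hθ1
          ((ContinuousLinearMap.le_of_opNorm_le _ hΔn _).trans ?_) (norm_nonneg _)
          (by positivity))) (norm_nonneg _) zero_le_one
        gcongr
      calc _ ≤ ‖φ z t‖ * ‖-(E z) - Δ w - t • (θ (t * z) w * θ (t * z) w)
            - t • (θ (t * z) w * Δ (z + w))‖ := norm_mul_le _ _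
        _ ≤ P * (C * ‖w‖ ^ 2 * R + C * ‖w‖ * ‖w‖ + 1 * ((C * ‖w‖) * (C * ‖w‖)) +
            1 * ((C * ‖w‖) * (C * ‖w‖ * R))) := by
          refine mul_le_mul (hP t ht') ?_ (norm_nonneg _) hP0
          refine (norm_sub_le _ _).trans (add_le_add ((norm_sub_le _ _).trans
            (add_le_add ((norm_sub_le _ _).trans (add_le_add ?_ b2)) b3)) b4)
          rwa [norm_neg]
        _ = Q * ‖w‖ ^ 2 := by simp only [Q]; ring
    have hd : ∀ t, HasDerivAt (fun t => φ (z + w) t - χ t)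
        (φ (z + w) t * θ (t * (z + w)) (z + w) - χ' t) t := fun t => (hφ (z + w) t).sub (hχ t)
    have hg := norm_le_gronwallBound_of_norm_deriv_right_le (δ := 0) (K := K) (ε := Q * ‖w‖ ^ 2)
      (a := 0) (b := 1) (f := fun t => φ (z + w) t - χ t)
      (f' := fun t => φ (z + w) t * θ (t * (z + w)) (z + w) - χ' t)
      (fun t _ => (hd t).continuousAt.continuousWithinAt)
      (fun t _ => (hd t).hasDerivWithinAt) (by simp [χ, hφ0]) (fun t ht => ?_) 1 (by simp)
    · rw [gronwallBound_of_K_ne_0 hK.ne'] at hg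
      have e1 : φ (z + w) 1 - φ z 1 - φ z 1 * θ z w = φ (z + w) 1 - χ 1 := by
        simp only [χ, Complex.ofReal_one, one_mul, one_smul, mul_add, mul_one]; abel
      rw [e1]
      refine hg.trans (le_of_eq ?_)
      simp only [zero_mul, sub_zero, mul_one, zero_add]
      ring
    · have ht' : t ∈ Set.Icc (0 : ℝ) 1 := ⟨ht.1, ht.2.le⟩
      have e2 : φ (z + w) t * θ (t * (z + w)) (z + w) - χ' t =
          (φ (z + w) t - χ t) * θ (t * (z + w)) (z + w) -
            (χ' t - χ t * θ (t * (z + w)) (z + w)) := by rw [sub_mul]; abel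
      rw [e2]
      refine (norm_sub_le _ _).trans (add_le_add ((norm_mul_le _ _).trans ?_) (hρ t ht))
      rw [mul_comm]
      refine mul_le_mul_of_nonneg_right ?_ (norm_nonneg _)
      calc ‖θ (t * (z + w)) (z + w)‖ ≤ C * ‖z + w‖ :=
            ContinuousLinearMap.le_of_opNorm_le _ (hC _ (hmem t ht' _ hzw)) _
        _ ≤ C * R := by gcongr
        _ ≤ K := by simp [K]
  refine HasFDerivAt.of_isLittleO ?_
  refine Asymptotics.IsBigO.trans_isLittleO (g := fun x : ℂ => ‖x - z‖ ^ 2) ?_ ?_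
  · refine Asymptotics.IsBigO.of_bound (Q / K * (Real.exp K - 1)) ?_
    filter_upwards [Metric.closedBall_mem_nhds z one_pos] with x hx
    have := est (x - z) (by rwa [mem_closedBall_iff_norm] at hx)
    simpa using this
  · have := (Asymptotics.isLittleO_pow_id (𝕜 := ℝ) (n := 2) (by norm_num)).comp_tendsto
      (tendsto_norm_sub_self z)
    exact Asymptotics.IsLittleO.of_norm_right (by simpa [Function.comp_def] using this)

end Flat

/-! ### Holomorphic dependence on the spectral parameter -/

section Holomorphic

/-- Matrix valued continuous functions on a closed disc which are holomorphic inside. -/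
def discAlgebra (c : ℂ) (r : ℝ) : Subalgebra ℝ C(Metric.closedBall c r, Mat3) where
  carrier := {f | ∃ g : ℂ → Mat3, DifferentiableOn ℂ g (Metric.ball c r) ∧
    ∀ x : Metric.closedBall c r, (x : ℂ) ∈ Metric.ball c r → f x = g x}
  mul_mem' := by
    rintro a b ⟨g, hg, hga⟩ ⟨k, hk, hkb⟩
    exact ⟨fun x => g x * k x, hg.mul hk, fun x hx => by simp [hga x hx, hkb x hx]⟩
  add_mem' := by
    rintro a b ⟨g, hg, hga⟩ ⟨k, hk, hkb⟩
    exact ⟨fun x => g x + k x, hg.add hk, fun x hx => by simp [hga x hx, hkb x hx]⟩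
  algebraMap_mem' a := ⟨fun _ => algebraMap ℝ Mat3 a, differentiableOn_const _, fun _ _ => rfl⟩

/-- Locally uniform limits of holomorphic functions are holomorphic. This yields completeness, and
so solvability of linear differential equations in the algebra. -/
theorem isClosed_discAlgebra (c : ℂ) (r : ℝ) :
    IsClosed (discAlgebra c r : Set C(Metric.closedBall c r, Mat3)) := by
  classical
  refine isClosed_of_closure_subset fun f hf => ?_
  obtain ⟨u, hu, hlim⟩ := mem_closure_iff_seq_limit.1 hf
  choose g hg hgu using hu
  refine ⟨fun ζ => if h : ζ ∈ Metric.closedBall c r then f ⟨ζ, h⟩ else 0, ?_, fun x _ => ?_⟩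
  · have hU := ContinuousMap.tendsto_iff_tendstoUniformly.1 hlim
    refine TendstoLocallyUniformlyOn.differentiableOn (φ := Filter.atTop) (F := g) ?_
      (Filter.Eventually.of_forall hg) Metric.isOpen_ball
    refine TendstoUniformlyOn.tendstoLocallyUniformlyOn ?_
    rw [Metric.tendstoUniformlyOn_iff]
    intro δ hδ
    filter_upwards [Metric.tendstoUniformly_iff.1 hU δ hδ] with n hn x hx
    have hx' := Metric.ball_subset_closedBall hx
    simpa [hx', ← hgu n ⟨x, hx'⟩ hx] using hn ⟨x, hx'⟩
  · have := x.2
    simp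

/-- The Banach algebra of continuous functions on a closed disc which are holomorphic inside. -/
def DiscAlgebra (c : ℂ) (r : ℝ) : Type := discAlgebra c r

instance (c : ℂ) (r : ℝ) : NormedRing (DiscAlgebra c r) :=
  SubringClass.toNormedRing (discAlgebra c r)

instance (c : ℂ) (r : ℝ) : NormedAlgebra ℝ (DiscAlgebra c r) :=
  SubalgebraClass.toNormedAlgebra (discAlgebra c r)

instance (c : ℂ) (r : ℝ) : CompleteSpace (DiscAlgebra c r) :=
  (isClosed_discAlgebra c r).completeSpace_coe

/-- Evaluation at a point of the disc. -/
def discEval {c : ℂ} {r : ℝ} (x : Metric.closedBall c r) : DiscAlgebra c r →L[ℝ] Mat3 where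
  toFun f := f.1 x
  map_add' _ _ := rfl
  map_smul' _ _ := rfl
  cont := (continuous_eval_const x).comp continuous_subtype_val

theorem discEval_mul {c : ℂ} {r : ℝ} (x : Metric.closedBall c r) (f g : DiscAlgebra c r) :
    discEval x (f * g) = discEval x f * discEval x g := rfl

theorem discEval_one {c : ℂ} {r : ℝ} (x : Metric.closedBall c r) :
    discEval x (1 : DiscAlgebra c r) = 1 := rfl

theorem discAlgebra_ext {c : ℂ} {r : ℝ} {f g : DiscAlgebra c r}
    (h : ∀ x, discEval x f = discEval x g) : f = g :=
  Subtype.ext (ContinuousMap.ext h)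

/-- Multiplication of constant matrices by a scalar holomorphic function. -/
def discSmul {c : ℂ} {r : ℝ} (f : ℂ → ℂ) (hf : DifferentiableOn ℂ f (Metric.ball c r))
    (hc : ContinuousOn f (Metric.closedBall c r)) : Mat3 →L[ℝ] DiscAlgebra c r :=
  LinearMap.toContinuousLinearMap (𝕜 := ℝ) (E := Mat3) (F' := DiscAlgebra c r)
    { toFun := fun M => (⟨⟨fun x => f x • M, by
        have : Continuous fun x : Metric.closedBall c r => f x := hc.domRestrict
        exact this.smul continuous_const⟩, fun ζ => f ζ • M, hf.smul_const M, fun _ _ => rfl⟩ : discAlgebra c r)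
      map_add' := fun M N => discAlgebra_ext fun x => smul_add (f x) M N
      map_smul' := fun t M => discAlgebra_ext fun x => smul_comm (f x) t M }

theorem discEval_discSmul {c : ℂ} {r : ℝ} {f : ℂ → ℂ}
    (hf : DifferentiableOn ℂ f (Metric.ball c r)) (hc : ContinuousOn f (Metric.closedBall c r))
    (x : Metric.closedBall c r) (M : Mat3) :
    discEval x (discSmul f hf hc M) = f x • M := rfl

variable {ι : Type*} [Fintype ι]

/-- The form `∑ f_i(ζ) θ_i`. -/
def pencil (f : ι → ℂ → ℂ) (θ : ι → OneForm) (ζ : ℂ) : OneForm :=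
  fun z => ∑ i, f i ζ • θ i z

theorem pencil_contDiff (f : ι → ℂ → ℂ) {θ : ι → OneForm} (hθ : ∀ i, ContDiff ℝ ∞ (θ i)) (ζ : ℂ) :
    ContDiff ℝ ∞ (pencil f θ ζ) :=
  ContDiff.sum fun i _ => (hθ i).const_smul _

/-- Solving a pencil of linear systems simultaneously in a Banach algebra with point evaluations. -/
theorem exists_frame_in_algebra {𝔅 X : Type*} [NormedRing 𝔅] [NormedAlgebra ℝ 𝔅] [CompleteSpace 𝔅]
    (ev : X → 𝔅 →L[ℝ] Mat3) (hmul : ∀ x a b, ev x (a * b) = ev x a * ev x b)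
    (hone : ∀ x, ev x 1 = 1) (hext : ∀ a b : 𝔅, (∀ x, ev x a = ev x b) → a = b)
    (p : X → ℂ) {f : ι → ℂ → ℂ} (T : ι → Mat3 →L[ℝ] 𝔅)
    (hT : ∀ x i M, ev x (T i M) = f i (p x) • M)
    {θ : ι → OneForm} (hθ : ∀ i, ContDiff ℝ ∞ (θ i))
    (hflat : ∀ x, ∀ z u v, fderiv ℝ (pencil f θ (p x)) z u v - fderiv ℝ (pencil f θ (p x)) z v u +
      ⁅pencil f θ (p x) z u, pencil f θ (p x) z v⁆ = 0)
    {F : X → ℂ → Mat3} (hF0 : ∀ x, F x 0 = 1)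
    (hF : ∀ x z, HasFDerivAt (F x)
      (ContinuousLinearMap.mul ℝ Mat3 (F x z) ∘L pencil f θ (p x) z) z) (z : ℂ) :
    ∃ h : 𝔅, ∀ x, F x z = ev x h := by
  -- One form with values in `𝔅` that evaluates at $x$ to the member of the pencil at $p(x)$. It is
  -- flat because evaluations separate points, and the evaluations of its frame are the given frames
  -- by uniqueness.
  let Θ : ℂ → ℂ →L[ℝ] 𝔅 := fun z => ∑ i, (T i).comp (θ i z)
  have hΘ : ContDiff ℝ ∞ Θ := ContDiff.sum fun i _ => contDiff_const.clm_comp (hθ i)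
  have hev : ∀ (x : X) (z : ℂ), (ev x).comp (Θ z) = pencil f θ (p x) z := by
    intro x z
    ext1 v
    simp only [Θ, pencil, ContinuousLinearMap.comp_apply, sum_apply, map_sum, hT]
    rfl
  have hder : ∀ (x : X) (z u v : ℂ),
      ev x (fderiv ℝ Θ z u v) = fderiv ℝ (pencil f θ (p x)) z u v := by
    intro x z u v
    have h1 : HasFDerivAt (fun z => (ev x).comp (Θ z))
        ((ContinuousLinearMap.compL ℝ ℂ 𝔅 Mat3 (ev x)).comp (fderiv ℝ Θ z)) z :=
      (ContinuousLinearMap.compL ℝ ℂ 𝔅 Mat3 (ev x)).hasFDerivAt.comp z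
        ((hΘ.differentiable (by simp)) z).hasFDerivAt
    rw [funext (hev x)] at h1
    rw [h1.fderiv]
    rfl
  have hΘflat : ∀ z u v, fderiv ℝ Θ z u v - fderiv ℝ Θ z v u + ⁅Θ z u, Θ z v⁆ = 0 := by
    intro z u v
    refine hext _ _ fun x => ?_
    have h := hflat x z u v
    rw [← hder, ← hder, ← hev, Ring.lie_def] at h
    rw [Ring.lie_def, map_add, map_sub, map_sub, hmul, hmul, map_zero]
    exact h
  obtain ⟨H, H0, HH⟩ := exists_frame_of_flat hΘ hΘflat
  refine ⟨H z, fun x => ?_⟩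
  refine frame_unique (pencil_contDiff f hθ (p x)).continuous (hF x) (H := fun z => ev x (H z))
    (fun w => ?_) ?_ z
  · refine ((ev x).hasFDerivAt.comp w (HH w)).congr_fderiv ?_
    rw [← hev]
    ext1 v
    exact hmul x _ _
  · rw [hF0, H0, hone]

/-- A holomorphic family of flat connections has a holomorphic family of frames. -/
theorem exists_holomorphic_frame {U : Set ℂ} (hU : IsOpen U) {f : ι → ℂ → ℂ}
    (hf : ∀ i, DifferentiableOn ℂ (f i) U) {θ : ι → OneForm} (hθ : ∀ i, ContDiff ℝ ∞ (θ i))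
    (hflat : ∀ ζ ∈ U, ∀ z u v, fderiv ℝ (pencil f θ ζ) z u v - fderiv ℝ (pencil f θ ζ) z v u +
      ⁅pencil f θ ζ z u, pencil f θ ζ z v⁆ = 0) :
    ∃ F : ℂ → ℂ → Mat3, (∀ ζ ∈ U, F 0 ζ = 1) ∧
      (∀ ζ ∈ U, ∀ z, HasFDerivAt (fun w => F w ζ)
        (ContinuousLinearMap.mul ℝ Mat3 (F z ζ) ∘L pencil f θ ζ z) z) ∧
      ∀ z, ∀ ζ ∈ U, AnalyticAt ℂ (F z) ζ := by
  classical
  -- Frames are first chosen for each $\zeta$ independently, with a dummy value off $U$. Uniqueness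
  -- makes the choice harmless and later yields analyticity.
  have hex : ∀ ζ : ℂ, ∃ F : ℂ → Mat3, ζ ∈ U → F 0 = 1 ∧
      ∀ z, HasFDerivAt F (ContinuousLinearMap.mul ℝ Mat3 (F z) ∘L pencil f θ ζ z) z := by
    intro ζ
    by_cases h : ζ ∈ U
    · obtain ⟨F, hF⟩ := exists_frame_of_flat (pencil_contDiff f hθ ζ) (hflat ζ h)
      exact ⟨F, fun _ => hF⟩
    · exact ⟨fun _ => 1, fun h' => absurd h' h⟩
  choose F hF using hex
  refine ⟨fun z ζ => F ζ z, fun ζ hζ => (hF ζ hζ).1, fun ζ hζ => (hF ζ hζ).2, fun z c hc => ?_⟩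
  obtain ⟨r, hr, hrU⟩ := Metric.nhds_basis_closedBall.mem_iff.1 (hU.mem_nhds hc)
  have hd : ∀ i, DifferentiableOn ℂ (f i) (Metric.ball c r) := fun i =>
    (hf i).mono (Metric.ball_subset_closedBall.trans hrU)
  have hcont : ∀ i, ContinuousOn (f i) (Metric.closedBall c r) := fun i =>
    (hf i).continuousOn.mono hrU
  -- On a small closed disc the pointwise frames at $z$ are the values of a single element of the
  -- disc algebra, hence holomorphic inside.
  obtain ⟨h, hh⟩ := exists_frame_in_algebra (𝔅 := DiscAlgebra c r) discEval discEval_mul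
    discEval_one (fun _ _ => discAlgebra_ext) (fun x => (x : ℂ))
    (fun i => discSmul (f i) (hd i) (hcont i))
    (fun x i M => discEval_discSmul (hd i) (hcont i) x M) hθ (fun x => hflat x (hrU x.2))
    (F := fun x => F x) (fun x => (hF x (hrU x.2)).1) (fun x => (hF x (hrU x.2)).2) z
  obtain ⟨g, hg, hgH⟩ := h.2
  have hga : AnalyticAt ℂ g c := hg.analyticAt (Metric.ball_mem_nhds c hr)
  refine hga.congr ?_
  filter_upwards [Metric.ball_mem_nhds c hr] with ζ hζ
  have := hh ⟨ζ, Metric.ball_subset_closedBall hζ⟩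
  rw [← hgH ⟨ζ, Metric.ball_subset_closedBall hζ⟩ hζ]
  exact this.symm

end Holomorphic

/-! ### The antiautomorphism underlying `τ` -/

theorem matS_inv : matS⁻¹ = matSᵀ := by
  refine Matrix.inv_eq_right_inv ?_
  ext i j; fin_cases i <;> fin_cases j <;> simp [matS, Matrix.mul_apply, Fin.sum_univ_three]

theorem matS_mul_transpose : matS * matSᵀ = 1 := by
  ext i j; fin_cases i <;> fin_cases j <;> simp [matS, Matrix.mul_apply, Fin.sum_univ_three]

theorem matS_transpose_mul : matSᵀ * matS = 1 := by
  ext i j; fin_cases i <;> fin_cases j <;> simp [matS, Matrix.mul_apply, Fin.sum_univ_three]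

/-- The linear antiautomorphism `X ↦ S Xᵗ S⁻¹`. -/
def antiTau : Mat3 →L[ℂ] Mat3 :=
  LinearMap.toContinuousLinearMap
    { toFun := fun X => matS * Xᵀ * matS⁻¹
      map_add' := fun X Y => by rw [Matrix.transpose_add, mul_add, add_mul]
      map_smul' := fun c X => by simp }

theorem antiTau_apply (X : Mat3) : antiTau X = matS * Xᵀ * matS⁻¹ := rfl

theorem antiTau_apply' (X : Mat3) : antiTau X = matS * Xᵀ * matSᵀ := by
  rw [antiTau_apply, matS_inv]

theorem tauAlg_eq (X : Mat3) : tauAlg X = -antiTau X := rfl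

theorem antiTau_one : antiTau 1 = 1 := by
  rw [antiTau_apply', Matrix.transpose_one, mul_one, matS_mul_transpose]

theorem antiTau_mul (X Y : Mat3) : antiTau (X * Y) = antiTau Y * antiTau X := by
  simp only [antiTau_apply', Matrix.transpose_mul]
  calc matS * (Yᵀ * Xᵀ) * matSᵀ = matS * Yᵀ * 1 * Xᵀ * matSᵀ := by simp only [mul_one, mul_assoc]
    _ = _ := by rw [← matS_transpose_mul]; simp only [mul_assoc]

theorem det_antiTau (X : Mat3) : (antiTau X).det = X.det := by
  have h : matS.det * matSᵀ.det = 1 := by rw [← Matrix.det_mul, matS_mul_transpose, Matrix.det_one]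
  rw [antiTau_apply', Matrix.det_mul, Matrix.det_mul, Matrix.det_transpose X]
  linear_combination X.det * h

theorem trace_antiTau (X : Mat3) : (antiTau X).trace = X.trace := by
  rw [antiTau_apply', Matrix.trace_mul_comm, ← mul_assoc, matS_transpose_mul, one_mul,
    Matrix.trace_transpose]

theorem antiTau_entries (X : Mat3) : antiTau X =
    !![X 1 1, -(X 0 1), X 2 1; -(X 1 0), X 0 0, -(X 2 0); X 1 2, -(X 0 2), X 2 2] := by
  rw [antiTau_apply']
  ext i j
  simp only [Matrix.mul_apply, Fin.sum_univ_three, Matrix.transpose_apply]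
  fin_cases i <;> fin_cases j <;> simp [matS]

theorem antiTau_conjTranspose (X : Mat3) : antiTau Xᴴ = (antiTau X)ᴴ := by
  rw [antiTau_entries, antiTau_entries]
  ext i j
  fin_cases i <;> fin_cases j <;> simp

theorem antiTau_exp (X : Mat3) : antiTau (NormedSpace.exp X) = NormedSpace.exp (antiTau X) := by
  rw [antiTau_apply, antiTau_apply, Matrix.exp_conj, Matrix.exp_transpose]
  exact IsUnit.of_mul_eq_one _ matS_mul_transpose

theorem tauGrp_eq_inv (g : Mat3) : tauGrp g = (antiTau g)⁻¹ := by
  have h : (matS⁻¹)⁻¹ = matS := by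
    rw [matS_inv]; exact Matrix.inv_eq_right_inv matS_transpose_mul
  rw [tauGrp, antiTau_apply, Matrix.mul_inv_rev, Matrix.mul_inv_rev, h, mul_assoc]

theorem tauGrp_mul (g h : Mat3) : tauGrp (g * h) = tauGrp g * tauGrp h := by
  rw [tauGrp_eq_inv, tauGrp_eq_inv, tauGrp_eq_inv, antiTau_mul, Matrix.mul_inv_rev]

theorem barGrp_mul (g h : Mat3) : barGrp (g * h) = barGrp g * barGrp h := by
  rw [barGrp, barGrp, barGrp, Matrix.conjTranspose_mul, Matrix.mul_inv_rev]

theorem tauGrp_barGrp (g : Mat3) : tauGrp (barGrp g) = barGrp (tauGrp g) := by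
  have h : antiTau (gᴴ)⁻¹ = (antiTau gᴴ)⁻¹ := by
    have h2 : (matS⁻¹)⁻¹ = matS := by
      rw [matS_inv]; exact Matrix.inv_eq_right_inv matS_transpose_mul
    rw [antiTau_apply, antiTau_apply, Matrix.mul_inv_rev, Matrix.mul_inv_rev, h2,
      Matrix.transpose_nonsing_inv, mul_assoc]
  rw [tauGrp_eq_inv, tauGrp_eq_inv, barGrp, barGrp, h, antiTau_conjTranspose,
    Matrix.conjTranspose_nonsing_inv]

/-- Replaces a condition with inverses by one that is polynomial in the entries; in this form it
differentiates well and passes to limits $\zeta\to0$. -/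
theorem tauGrp_eq_iff {g h : Mat3} (hg : g.det = 1) : tauGrp g = h ↔ antiTau g * h = 1 := by
  rw [tauGrp_eq_inv]
  constructor
  · rintro rfl
    exact Matrix.mul_nonsing_inv _ (by simp [det_antiTau, hg])
  · exact Matrix.inv_eq_right_inv

theorem barGrp_eq_iff {g h : Mat3} (hg : g.det = 1) : barGrp g = h ↔ gᴴ * h = 1 := by
  rw [barGrp]
  constructor
  · rintro rfl
    exact Matrix.mul_nonsing_inv _ (by simp [Matrix.det_conjTranspose, hg])
  · exact Matrix.inv_eq_right_inv

theorem barGrp_eq_adjugate {g : Mat3} (hg : g.det = 1) : barGrp g = (gᴴ).adjugate := by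
  rw [barGrp_eq_iff hg, Matrix.mul_adjugate, Matrix.det_conjTranspose, hg]
  simp

theorem barGrp_barGrp (g : Mat3) (hg : g.det = 1) : barGrp (barGrp g) = g := by
  rw [barGrp, barGrp, Matrix.conjTranspose_nonsing_inv, Matrix.conjTranspose_conjTranspose,
    Matrix.nonsing_inv_nonsing_inv _ (by simp [hg])]

theorem det_barGrp {g : Mat3} (hg : g.det = 1) : (barGrp g).det = 1 := by
  rw [barGrp, Matrix.det_nonsing_inv, Matrix.det_conjTranspose, hg]; simp

/-! ### The adjugate as a polynomial -/

/-- The trace as a continuous linear form. -/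
def traceL : Mat3 →L[ℂ] ℂ := LinearMap.toContinuousLinearMap (Matrix.traceLinearMap (Fin 3) ℂ ℂ)

theorem traceL_apply (X : Mat3) : traceL X = X.trace := rfl

/-- A matrix entry as a continuous linear form. -/
def entryL (i j : Fin 3) : Mat3 →L[ℂ] ℂ :=
  LinearMap.toContinuousLinearMap (Matrix.entryLinearMap ℂ ℂ i j)

theorem entryL_apply (i j : Fin 3) (X : Mat3) : entryL i j X = X i j := rfl

/-- The Cayley–Hamilton expression. For determinant one the adjugate is the inverse, so inversion
becomes a polynomial map, and analyticity or smoothness of inverses needs no division. -/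
theorem adjugate_eq_polynomial (X : Mat3) : X.adjugate =
    X * X - traceL X • X + ((1 / 2 : ℂ) * (traceL X * traceL X - traceL (X * X))) • (1 : Mat3) := by
  rw [Matrix.adjugate_fin_three]
  ext i j
  fin_cases i <;> fin_cases j <;>
    simp [traceL_apply, Matrix.trace, Matrix.mul_apply, Fin.sum_univ_three] <;> ring

theorem det_eq_entry (X : Mat3) : X.det = entryL 0 0 (X * X.adjugate) := by
  rw [Matrix.mul_adjugate, entryL_apply]; simp

theorem analyticAt_adjugate {f : ℂ → Mat3} {c : ℂ} (hf : AnalyticAt ℂ f c) :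
    AnalyticAt ℂ (fun ζ => (f ζ).adjugate) c := by
  simp only [adjugate_eq_polynomial]
  have h1 : AnalyticAt ℂ (fun ζ => traceL (f ζ)) c := (traceL.analyticAt _).comp hf
  have h2 : AnalyticAt ℂ (fun ζ => traceL (f ζ * f ζ)) c := (traceL.analyticAt _).comp (hf.mul hf)
  exact ((hf.mul hf).sub (h1.smul hf)).add
    ((analyticAt_const.mul ((h1.mul h1).sub h2)).smul analyticAt_const)

theorem analyticAt_det {f : ℂ → Mat3} {c : ℂ} (hf : AnalyticAt ℂ f c) :
    AnalyticAt ℂ (fun ζ => (f ζ).det) c := by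
  simp only [det_eq_entry]
  exact ((entryL 0 0).analyticAt _).comp (hf.mul (analyticAt_adjugate hf))

theorem contDiff_adjugate {f : ℂ → Mat3} (hf : ContDiff ℝ ∞ f) :
    ContDiff ℝ ∞ (fun z => (f z).adjugate) := by
  simp only [adjugate_eq_polynomial]
  have h1 : ContDiff ℝ ∞ (fun z => traceL (f z)) := (traceL.restrictScalars ℝ).contDiff.comp hf
  have h2 : ContDiff ℝ ∞ (fun z => traceL (f z * f z)) :=
    (traceL.restrictScalars ℝ).contDiff.comp (hf.mul hf)
  exact ((hf.mul hf).sub (h1.smul hf)).add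
    ((contDiff_const.mul ((h1.mul h1).sub h2)).smul contDiff_const)

/-- Reflection of a holomorphic function in the real axis. -/
theorem analyticAt_conjTranspose {f : ℂ → Mat3} {c : ℂ} (hf : AnalyticAt ℂ f (conj c)) :
    AnalyticAt ℂ (fun ζ => (f (conj ζ))ᴴ) c := by
  rw [Complex.analyticAt_iff_eventually_differentiableAt] at hf ⊢
  have ht : Filter.Tendsto (fun z : ℂ => conj z) (nhds c) (nhds (conj c)) :=
    Complex.continuous_conj.tendsto c
  filter_upwards [ht.eventually hf] with w hw
  have := hw.star_conj
  simpa [Function.comp_def, Matrix.star_eq_conjTranspose] using this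

/-! ### Loops determined by their restriction to the inner disc -/

theorem sphereInv_infty : sphereInv OnePoint.infty = ((0 : ℂ) : OnePoint ℂ) := rfl

theorem sphereInv_zero : sphereInv ((0 : ℂ) : OnePoint ℂ) = OnePoint.infty := if_pos rfl

theorem sphereInv_coe {ζ : ℂ} (h : ζ ≠ 0) :
    sphereInv (ζ : OnePoint ℂ) = ((ζ⁻¹ : ℂ) : OnePoint ℂ) := if_neg h

theorem sphereConj_infty : sphereConj OnePoint.infty = OnePoint.infty := rfl

theorem sphereConj_coe (ζ : ℂ) : sphereConj (ζ : OnePoint ℂ) = ((conj ζ : ℂ) : OnePoint ℂ) := rfl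

theorem sphereRot_infty : sphereRot OnePoint.infty = OnePoint.infty := rfl

theorem sphereRot_coe (ζ : ℂ) :
    sphereRot (ζ : OnePoint ℂ) = ((Complex.I * ζ : ℂ) : OnePoint ℂ) := rfl

/-- The loop on `I_ε` which is given by `b` near `0` and by reality near `∞`. -/
def innerExtend (b : ℂ → Mat3) : Loop := fun p =>
  p.elim ((b 0)ᴴ.adjugate)
    (fun ζ => if ‖ζ‖ < 1 then b ζ else ((b (conj ζ)⁻¹)ᴴ).adjugate)

theorem innerExtend_infty (b : ℂ → Mat3) :
    innerExtend b OnePoint.infty = ((b 0)ᴴ).adjugate := rfl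

theorem innerExtend_inner (b : ℂ → Mat3) {ζ : ℂ} (h : ‖ζ‖ < 1) :
    innerExtend b (ζ : OnePoint ℂ) = b ζ := if_pos h

theorem innerExtend_outer (b : ℂ → Mat3) {ζ : ℂ} (h : ¬ ‖ζ‖ < 1) :
    innerExtend b (ζ : OnePoint ℂ) = ((b (conj ζ)⁻¹)ᴴ).adjugate := if_neg h

/-- Holomorphic twisted `SL(3, ℂ)`-valued functions on the closed disc of radius `ε`. -/
structure IsInnerLoop (ε : ℝ) (b : ℂ → Mat3) : Prop where
  analytic : ∀ ζ : ℂ, ‖ζ‖ ≤ ε → AnalyticAt ℂ b ζ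
  det_eq_one : ∀ ζ : ℂ, ‖ζ‖ ≤ ε → (b ζ).det = 1
  equivariant : ∀ ζ : ℂ, ‖ζ‖ ≤ ε → antiTau (b ζ) * b (Complex.I * ζ) = 1

/-- Reality determines a loop on $I_\epsilon$ by its restriction to the inner disc. The two formulas
meet on $|\zeta|=1$, which is disjoint from $I_\epsilon$ as $\epsilon<1<\epsilon^{-1}$; near each
point of $I_\epsilon$ only one of them is in force. -/
theorem IsInnerLoop.memLoopGroup {ε : ℝ} (hε0 : 0 < ε) (hε1 : ε < 1) {b : ℂ → Mat3}
    (hb : IsInnerLoop ε b) : MemLoopGroup (setI ε) (innerExtend b) := by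
  have hinv : 1 < ε⁻¹ := (one_lt_inv₀ hε0).2 hε1
  have houter : ∀ ζ : ℂ, ε⁻¹ ≤ ‖ζ‖ → ζ ≠ 0 ∧ ¬ ‖ζ‖ < 1 ∧ ‖(conj ζ)⁻¹‖ ≤ ε ∧
      innerExtend b (ζ : OnePoint ℂ) = barGrp (b (conj ζ)⁻¹) := by
    intro ζ h
    have h1 : 0 < ‖ζ‖ := by linarith
    have h2 : ‖(conj ζ)⁻¹‖ ≤ ε := by
      rw [norm_inv, RCLike.norm_conj]
      exact inv_le_of_inv_le₀ hε0 h
    have h3 : ¬ ‖ζ‖ < 1 := by linarith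
    exact ⟨norm_pos_iff.1 h1, h3, h2, by
      rw [innerExtend_outer b h3, barGrp_eq_adjugate (hb.det_eq_one _ h2)]⟩
  have hinfty : innerExtend b OnePoint.infty = barGrp (b 0) := by
    rw [innerExtend_infty, barGrp_eq_adjugate (hb.det_eq_one _ (by simpa using hε0.le))]
  have h00 : ‖(0 : ℂ)‖ ≤ ε := by simpa using hε0.le
  have hG : ∀ w : ℂ, ‖w‖ ≤ ε → AnalyticAt ℂ (fun w => ((b (conj w))ᴴ).adjugate) w := fun w hw =>
    analyticAt_adjugate (analyticAt_conjTranspose (hb.analytic _ (by rwa [RCLike.norm_conj])))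
  refine ⟨?_, ?_, ?_, ?_⟩
  · rintro p (rfl | ⟨ζ, rfl, h | h⟩)
    · change AnalyticAt ℂ (fun w : ℂ => innerExtend b (sphereInv (w : OnePoint ℂ))) 0
      refine (hG 0 h00).congr ?_
      filter_upwards [Metric.ball_mem_nhds (0 : ℂ) one_pos] with w hw
      rcases eq_or_ne w 0 with rfl | hw0
      · rw [sphereInv_zero, innerExtend_infty, map_zero]
      · rw [sphereInv_coe hw0, innerExtend_outer]
        · simp
        · rw [norm_inv, not_lt]
          exact (one_le_inv₀ (norm_pos_iff.2 hw0)).2 (by simpa using (mem_ball_zero_iff.1 hw).le)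
    · change AnalyticAt ℂ (fun w : ℂ => innerExtend b (w : OnePoint ℂ)) ζ
      refine (hb.analytic ζ h).congr ?_
      have : {w : ℂ | ‖w‖ < 1} ∈ nhds ζ :=
        (isOpen_lt continuous_norm continuous_const).mem_nhds (lt_of_le_of_lt h hε1)
      filter_upwards [this] with w hw
      rw [innerExtend_inner b hw]
    · change AnalyticAt ℂ (fun w : ℂ => innerExtend b (w : OnePoint ℂ)) ζ
      obtain ⟨h0, h1, h2, -⟩ := houter ζ h
      have hz : ‖ζ⁻¹‖ ≤ ε := by rw [norm_inv]; exact inv_le_of_inv_le₀ hε0 h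
      have := (hG ζ⁻¹ hz).comp (f := fun w : ℂ => w⁻¹) (analyticAt_inv h0)
      refine this.congr ?_
      have : {w : ℂ | 1 < ‖w‖} ∈ nhds ζ :=
        (isOpen_lt continuous_const continuous_norm).mem_nhds (lt_of_lt_of_le hinv h)
      filter_upwards [this] with w hw
      rw [innerExtend_outer b (not_lt.2 (le_of_lt hw))]
      simp
  · rintro p (rfl | ⟨ζ, rfl, h | h⟩)
    · rw [hinfty, det_barGrp (hb.det_eq_one 0 h00)]
    · rw [innerExtend_inner b (lt_of_le_of_lt h hε1), hb.det_eq_one ζ h]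
    · obtain ⟨h0, h1, h2, h3⟩ := houter ζ h
      rw [h3, det_barGrp (hb.det_eq_one _ h2)]
  · rintro p (rfl | ⟨ζ, rfl, h | h⟩)
    · rw [hinfty, sphereConj_infty, sphereInv_infty, innerExtend_inner b (by simp),
        barGrp_barGrp _ (hb.det_eq_one 0 h00)]
    · rw [innerExtend_inner b (lt_of_le_of_lt h hε1), sphereConj_coe]
      rcases eq_or_ne ζ 0 with rfl | hζ
      · rw [map_zero, sphereInv_zero, hinfty]
      · have hc : conj ζ ≠ 0 := by simpa using hζ
        have : ε⁻¹ ≤ ‖(conj ζ)⁻¹‖ := by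
          rw [norm_inv, RCLike.norm_conj]
          exact inv_anti₀ (norm_pos_iff.2 hζ) h
        rw [sphereInv_coe hc, (houter _ this).2.2.2]
        simp
    · obtain ⟨h0, h1, h2, h3⟩ := houter ζ h
      have hc : conj ζ ≠ 0 := by simpa using h0
      rw [h3, sphereConj_coe, sphereInv_coe hc, innerExtend_inner b (lt_of_le_of_lt h2 hε1),
        barGrp_barGrp _ (hb.det_eq_one _ h2)]
  · have hI : ∀ ζ : ℂ, ‖Complex.I * ζ‖ = ‖ζ‖ := fun ζ => by simp
    have ht : ∀ ζ : ℂ, ‖ζ‖ ≤ ε → tauGrp (b ζ) = b (Complex.I * ζ) := fun ζ h =>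
      (tauGrp_eq_iff (hb.det_eq_one ζ h)).2 (hb.equivariant ζ h)
    rintro p (rfl | ⟨ζ, rfl, h | h⟩)
    · rw [hinfty, sphereRot_infty, hinfty, tauGrp_barGrp, ht 0 h00, mul_zero]
    · rw [sphereRot_coe, innerExtend_inner b (lt_of_le_of_lt h hε1), innerExtend_inner b
        (by rw [hI]; exact lt_of_le_of_lt h hε1), ht ζ h]
    · obtain ⟨h0, h1, h2, h3⟩ := houter ζ h
      rw [h3, sphereRot_coe, (houter (Complex.I * ζ) (by rwa [hI])).2.2.2, tauGrp_barGrp, ht _ h2]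
      congr 2
      simp [mul_comm]

theorem IsInnerLoop.memLoopGroupB {ε : ℝ} (hε0 : 0 < ε) (hε1 : ε < 1) {b : ℂ → Mat3}
    (hb : IsInnerLoop ε b) (h0 : b 0 ∈ groupB) : MemLoopGroupB ε (innerExtend b) :=
  ⟨hb.memLoopGroup hε0 hε1, by rwa [innerExtend_inner b (by simp)]⟩

/-- Twisted determinant one relations extend over the puncture at `0`. -/
theorem isInnerLoop_of_punctured {ε : ℝ} (hε0 : 0 < ε) {b : ℂ → Mat3}
    (han : ∀ ζ : ℂ, ‖ζ‖ ≤ ε → AnalyticAt ℂ b ζ)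
    (hdet : ∀ ζ : ℂ, ζ ≠ 0 → ‖ζ‖ ≤ ε → (b ζ).det = 1)
    (hτ : ∀ ζ : ℂ, ζ ≠ 0 → ‖ζ‖ ≤ ε → antiTau (b ζ) * b (Complex.I * ζ) = 1) :
    IsInnerLoop ε b := by
  have h00 : ‖(0 : ℂ)‖ ≤ ε := by simpa using hε0.le
  have key : ∀ {E : Type} [TopologicalSpace E] [T2Space E] (f : ℂ → E) (c : E), ContinuousAt f 0 →
      (∀ ζ : ℂ, ζ ≠ 0 → ‖ζ‖ ≤ ε → f ζ = c) → f 0 = c := by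
    intro E _ _ f c hf h
    have h1 : Filter.Tendsto f (nhdsWithin 0 {0}ᶜ) (nhds (f 0)) := hf.mono_left nhdsWithin_le_nhds
    have h2 : Filter.Tendsto f (nhdsWithin 0 {0}ᶜ) (nhds c) := by
      refine Filter.Tendsto.congr' ?_ tendsto_const_nhds
      filter_upwards [self_mem_nhdsWithin,
        nhdsWithin_le_nhds (Metric.closedBall_mem_nhds (0 : ℂ) hε0)] with ζ h0 h1
      exact (h ζ h0 (by simpa using h1)).symm
    exact tendsto_nhds_unique h1 h2
  have hb0 := han 0 h00
  refine ⟨han, fun ζ h => ?_, fun ζ h => ?_⟩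
  · rcases eq_or_ne ζ 0 with rfl | h0
    · exact key (fun ζ => (b ζ).det) 1 (analyticAt_det hb0).continuousAt hdet
    · exact hdet ζ h0 h
  · rcases eq_or_ne ζ 0 with rfl | h0
    · refine key (fun ζ => antiTau (b ζ) * b (Complex.I * ζ)) 1 ?_ hτ
      refine ContinuousAt.mul (antiTau.continuous.continuousAt.comp hb0.continuousAt) ?_
      refine ContinuousAt.comp (g := b) (f := fun ζ => Complex.I * ζ) ?_ (by fun_prop)
      simpa using hb0.continuousAt
    · exact hτ ζ h0 h

/-- A factorisation on the inner circle determines the factorisation of a real loop. -/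
theorem isEFactor_of_inner {ε : ℝ} (hε0 : 0 < ε) (hε1 : ε < 1) {a e : Loop} {b : ℂ → Mat3}
    (he : MemLoopGroup (setE ε) e) (hb : IsInnerLoop ε b) (hb0 : b 0 ∈ groupB)
    (ha : ∀ ζ : ℂ, ‖ζ‖ = ε → a (ζ : OnePoint ℂ) = e (ζ : OnePoint ℂ) * b ζ)
    (har : ∀ ζ : ℂ, ‖ζ‖ = ε →
      a (((conj ζ)⁻¹ : ℂ) : OnePoint ℂ) = barGrp (a (ζ : OnePoint ℂ))) :
    IsEFactor ε a e := by
  refine ⟨he, innerExtend b, hb.memLoopGroupB hε0 hε1 hb0, ?_⟩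
  have hinv : 1 < ε⁻¹ := (one_lt_inv₀ hε0).2 hε1
  rintro p ⟨ζ, rfl, h | h⟩
  · rw [ha ζ h, innerExtend_inner b (by rw [h]; exact hε1)]
  · have h1 : ‖(conj ζ)⁻¹‖ = ε := by rw [norm_inv, RCLike.norm_conj, h, inv_inv]
    have h2 : (conj ((conj ζ)⁻¹))⁻¹ = ζ := by simp
    have hne : (conj ζ)⁻¹ ≠ 0 := norm_pos_iff.1 (by rw [h1]; exact hε0)
    have h3 := har _ h1
    rw [h2] at h3
    have h4 := he.real (((conj ζ)⁻¹ : ℂ) : OnePoint ℂ) ⟨_, rfl, h1.ge, by rw [h1]; linarith⟩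
    rw [sphereConj_coe, sphereInv_coe (by simpa using hne), h2] at h4
    rw [h3, ha _ h1, barGrp_mul, h4, innerExtend_outer b (by rw [h]; linarith),
      barGrp_eq_adjugate (hb.det_eq_one _ h1.le)]

/-! ### The groups `G₀`, `G₀ᶜ` and `B` -/

theorem mem_G0C_iff {g : Mat3} : g ∈ G0C ↔ g.det = 1 ∧ antiTau g * g = 1 :=
  and_congr_right fun h => tauGrp_eq_iff h

/-- Two off-diagonal entries of $g\cdot Sg^tS^{-1}=1$ are $-g_{02}^2=0$ and $g_{12}^2=0$. The upper
block then has determinant one, which forces $g_{20}=g_{21}=0$. The determinant of $g$ gives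
$g_{22}=1$, ruling out the sign $-1$. -/
theorem G0C_entries {g : Mat3} (hg : g ∈ G0C) :
    g 0 2 = 0 ∧ g 1 2 = 0 ∧ g 2 0 = 0 ∧ g 2 1 = 0 ∧ g 2 2 = 1 ∧
      g 0 0 * g 1 1 - g 0 1 * g 1 0 = 1 := by
  obtain ⟨hdet, h⟩ := mem_G0C_iff.1 hg
  have h' : g * antiTau g = 1 := mul_eq_one_comm.1 h
  rw [antiTau_entries] at h'
  have e := fun i j => congrFun (congrFun h' i) j
  simp only [Matrix.mul_apply, Fin.sum_univ_three] at e
  have e02 := e 0 1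
  have e12 := e 1 0
  have e01 := e 0 0
  have e20 := e 2 0
  have e21 := e 2 1
  simp at e02 e12 e01 e20 e21
  have h02 : g 0 2 = 0 := pow_eq_zero_iff (n := 2) (by norm_num) |>.1 (by
    linear_combination -e02)
  have h12 : g 1 2 = 0 := pow_eq_zero_iff (n := 2) (by norm_num) |>.1 (by
    linear_combination e12)
  have hm : g 0 0 * g 1 1 - g 0 1 * g 1 0 = 1 := by linear_combination e01 - g 0 2 * h12
  have h20 : g 2 0 = 0 := by
    linear_combination (-g 2 0) * hm + g 0 0 * e20 + g 1 0 * e21 - g 0 0 * g 2 2 * h12 +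
      g 1 0 * g 2 2 * h02
  have h21 : g 2 1 = 0 := by
    linear_combination (-g 2 1) * hm + g 0 1 * e20 + g 1 1 * e21 - g 0 1 * g 2 2 * h12 +
      g 1 1 * g 2 2 * h02
  refine ⟨h02, h12, h20, h21, ?_, hm⟩
  rw [Matrix.det_fin_three, h20, h21, h02, h12] at hdet
  linear_combination hdet - g 2 2 * hm

/-- $D$ is scalar on each of the two blocks. Hence gauging by $G_0$ preserves the Maslov form, and
constants of $G_0$ commute with the vacuum. -/
theorem G0C_commute_matD {g : Mat3} (hg : g ∈ G0C) : g * matD = matD * g := by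
  obtain ⟨h02, h12, h20, h21, -, -⟩ := G0C_entries hg
  ext i j
  fin_cases i <;> fin_cases j <;>
    simp [matD, Matrix.mul_apply, Fin.sum_univ_three, h02, h12, h20, h21, mul_comm]

theorem mem_G0_iff {k : Mat3} : k ∈ G0 ↔ k.det = 1 ∧ antiTau k = kᴴ ∧ kᴴ * k = 1 := by
  constructor
  · rintro ⟨hk, hr⟩
    obtain ⟨hd, ht⟩ := mem_G0C_iff.1 hk
    have h1 := (barGrp_eq_iff hd).1 hr
    refine ⟨hd, ?_, h1⟩
    calc antiTau k = antiTau k * (k * kᴴ) := by rw [mul_eq_one_comm.1 h1, mul_one]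
      _ = kᴴ := by rw [← mul_assoc, ht, one_mul]
  · rintro ⟨hd, ht, h1⟩
    exact ⟨mem_G0C_iff.2 ⟨hd, by rw [ht, h1]⟩, (barGrp_eq_iff hd).2 h1⟩

theorem G0_det {k : Mat3} (hk : k ∈ G0) : k.det = 1 := (mem_G0_iff.1 hk).1

theorem G0_antiTau {k : Mat3} (hk : k ∈ G0) : antiTau k = kᴴ := (mem_G0_iff.1 hk).2.1

theorem G0_star_mul {k : Mat3} (hk : k ∈ G0) : kᴴ * k = 1 := (mem_G0_iff.1 hk).2.2

theorem G0_mul_star {k : Mat3} (hk : k ∈ G0) : k * kᴴ = 1 := mul_eq_one_comm.1 (G0_star_mul hk)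

theorem G0_antiTau_star {k : Mat3} (hk : k ∈ G0) : antiTau kᴴ = k := by
  rw [antiTau_conjTranspose, G0_antiTau hk, Matrix.conjTranspose_conjTranspose]

theorem G0_conjTranspose {k : Mat3} (hk : k ∈ G0) : kᴴ ∈ G0 := by
  refine mem_G0_iff.2 ⟨by rw [Matrix.det_conjTranspose, G0_det hk, star_one], ?_, ?_⟩
  · rw [G0_antiTau_star hk, Matrix.conjTranspose_conjTranspose]
  · rw [Matrix.conjTranspose_conjTranspose, G0_mul_star hk]

theorem G0_mul {k l : Mat3} (hk : k ∈ G0) (hl : l ∈ G0) : k * l ∈ G0 := by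
  refine mem_G0_iff.2 ⟨by rw [Matrix.det_mul, G0_det hk, G0_det hl, one_mul], ?_, ?_⟩
  · rw [antiTau_mul, G0_antiTau hk, G0_antiTau hl, Matrix.conjTranspose_mul]
  · rw [Matrix.conjTranspose_mul, mul_assoc, ← mul_assoc kᴴ, G0_star_mul hk, one_mul,
      G0_star_mul hl]

theorem one_mem_G0 : (1 : Mat3) ∈ G0 :=
  mem_G0_iff.2 ⟨Matrix.det_one, by rw [antiTau_one, Matrix.conjTranspose_one],
    by rw [Matrix.conjTranspose_one, one_mul]⟩

theorem one_mem_groupB : (1 : Mat3) ∈ groupB := by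
  refine ⟨one_mem_G0.1, fun i j h => Matrix.one_apply_ne h.ne', fun i => ⟨1, one_pos, by simp⟩⟩

/-- The norm of the first column of an element of `G₀ᶜ`. -/
def columnNorm (g : Mat3) : ℝ := √((g 0 0).re ^ 2 + (g 0 0).im ^ 2 +
  ((g 1 0).re ^ 2 + (g 1 0).im ^ 2))

/-- The unitary factor in the Iwasawa decomposition `G₀ᶜ = G₀ B`. -/
def iwasawaK (g : Mat3) : Mat3 :=
  !![g 0 0 / columnNorm g, -(conj (g 1 0) / columnNorm g), 0;
     g 1 0 / columnNorm g, conj (g 0 0) / columnNorm g, 0; 0, 0, 1]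

theorem column_pos {g : Mat3} (hg : g ∈ G0C) :
    0 < (g 0 0).re ^ 2 + (g 0 0).im ^ 2 + ((g 1 0).re ^ 2 + (g 1 0).im ^ 2) := by
  obtain ⟨-, -, -, -, -, h⟩ := G0C_entries hg
  have hs : ∀ w : ℂ, w.re ^ 2 + w.im ^ 2 = Complex.normSq w := fun w => by
    rw [Complex.normSq_apply]; ring
  rw [hs, hs]
  rcases eq_or_ne (g 0 0) 0 with h0 | h0
  · have h1 : g 1 0 ≠ 0 := by
      intro h1
      simp [h0, h1] at h
    exact add_pos_of_nonneg_of_pos (Complex.normSq_nonneg _) (Complex.normSq_pos.2 h1)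
  · exact add_pos_of_pos_of_nonneg (Complex.normSq_pos.2 h0) (Complex.normSq_nonneg _)

theorem columnNorm_pos {g : Mat3} (hg : g ∈ G0C) : 0 < columnNorm g :=
  Real.sqrt_pos.2 (column_pos hg)

theorem columnNorm_sq {g : Mat3} (hg : g ∈ G0C) :
    (columnNorm g : ℂ) * columnNorm g = g 0 0 * conj (g 0 0) + g 1 0 * conj (g 1 0) := by
  rw [← Complex.ofReal_mul, columnNorm, Real.mul_self_sqrt (column_pos hg).le, Complex.mul_conj,
    Complex.mul_conj, Complex.normSq_apply, Complex.normSq_apply]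
  push_cast
  ring

theorem iwasawaK_mem_G0 {g : Mat3} (hg : g ∈ G0C) : iwasawaK g ∈ G0 := by
  have hn : (columnNorm g : ℂ) ≠ 0 := by exact_mod_cast (columnNorm_pos hg).ne'
  have hs := columnNorm_sq hg
  refine mem_G0_iff.2 ⟨?_, ?_, ?_⟩
  · rw [Matrix.det_fin_three]
    simp [iwasawaK]
    field_simp
    linear_combination -hs
  · rw [antiTau_entries]
    ext i j
    fin_cases i <;> fin_cases j <;> simp [iwasawaK]
  · ext i j
    simp only [Matrix.mul_apply, Fin.sum_univ_three, Matrix.conjTranspose_apply]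
    fin_cases i <;> fin_cases j <;> simp [iwasawaK] <;> field_simp <;>
      first | linear_combination -hs | ring

/-- Gram–Schmidt on the first column: it becomes $(\nu,0,0)^t$, where $\nu>0$ is its norm, and
determinant one makes the next diagonal entry $\nu^{-1}$. -/
theorem iwasawaK_star_mul_mem {g : Mat3} (hg : g ∈ G0C) : (iwasawaK g)ᴴ * g ∈ groupB := by
  have hn0 := columnNorm_pos hg
  have hn : (columnNorm g : ℂ) ≠ 0 := by exact_mod_cast hn0.ne'
  have hs := columnNorm_sq hg
  have hk := iwasawaK_mem_G0 hg
  obtain ⟨hd, ht⟩ := mem_G0C_iff.1 hg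
  obtain ⟨h02, h12, h20, h21, h22, hm⟩ := G0C_entries hg
  refine ⟨mem_G0C_iff.2 ⟨?_, ?_⟩, ?_, ?_⟩
  · rw [Matrix.det_mul, Matrix.det_conjTranspose, G0_det hk, hd]; simp
  · rw [antiTau_mul, G0_antiTau_star hk, mul_assoc, ← mul_assoc (iwasawaK g), G0_mul_star hk,
      one_mul, ht]
  · intro i j hij
    simp only [Matrix.mul_apply, Fin.sum_univ_three, Matrix.conjTranspose_apply]
    fin_cases i <;> fin_cases j <;> first | exact absurd hij (by decide) | skip
    · simp [iwasawaK, h20]; ring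
    · simp [iwasawaK, h20]
    · simp [iwasawaK, h21]
  · intro i
    simp only [Matrix.mul_apply, Fin.sum_univ_three, Matrix.conjTranspose_apply]
    fin_cases i
    · refine ⟨columnNorm g, hn0, ?_⟩
      simp [iwasawaK, h20]
      field_simp
      linear_combination -hs
    · refine ⟨(columnNorm g)⁻¹, inv_pos.2 hn0, ?_⟩
      simp [iwasawaK, h21]
      field_simp
      linear_combination hm
    · exact ⟨1, one_pos, by simp [iwasawaK, h22]⟩

/-- Assembling a matrix from its entries, as a continuous linear map. -/
def ofEntriesL : (Fin 3 → Fin 3 → ℂ) →L[ℝ] Mat3 :=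
  LinearMap.toContinuousLinearMap
    { toFun := fun f => Matrix.of f
      map_add' := fun _ _ => rfl
      map_smul' := fun _ _ => rfl }

theorem contDiff_matrix {f : ℂ → Mat3} (hf : ∀ i j, ContDiff ℝ ∞ fun z => f z i j) :
    ContDiff ℝ ∞ f :=
  ofEntriesL.contDiff.comp (f := fun z i j => f z i j)
    (contDiff_pi.2 fun i => contDiff_pi.2 fun j => hf i j)

theorem contDiff_entry {f : ℂ → Mat3} (hf : ContDiff ℝ ∞ f) (i j : Fin 3) :
    ContDiff ℝ ∞ fun z => f z i j :=
  ((entryL i j).restrictScalars ℝ).contDiff.comp hf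

/-- The radicand in the explicit formula never vanishes on $G_0^{\mathbb C}$. Smoothness is needed
for the unitary factor to be an element of $\mathcal G_0$. -/
theorem iwasawaK_contDiff {f : ℂ → Mat3} (hf : ContDiff ℝ ∞ f) (hG : ∀ z, f z ∈ G0C) :
    ContDiff ℝ ∞ fun z => iwasawaK (f z) := by
  have h00 := contDiff_entry hf 0 0
  have h10 := contDiff_entry hf 1 0
  have hre : ∀ {g : ℂ → ℂ}, ContDiff ℝ ∞ g → ContDiff ℝ ∞ fun z => (g z).re := fun h =>
    Complex.reCLM.contDiff.comp h
  have him : ∀ {g : ℂ → ℂ}, ContDiff ℝ ∞ g → ContDiff ℝ ∞ fun z => (g z).im := fun h =>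
    Complex.imCLM.contDiff.comp h
  have hc : ∀ {g : ℂ → ℂ}, ContDiff ℝ ∞ g → ContDiff ℝ ∞ fun z => conj (g z) := fun h =>
    Complex.conjCLE.contDiff.comp h
  have hn : ContDiff ℝ ∞ fun z => columnNorm (f z) :=
    ContDiff.sqrt ((((hre h00).pow 2).add ((him h00).pow 2)).add
      (((hre h10).pow 2).add ((him h10).pow 2))) fun z => (column_pos (hG z)).ne'
  have hnc : ContDiff ℝ ∞ fun z => (columnNorm (f z) : ℂ) := Complex.ofRealCLM.contDiff.comp hn
  have hne : ∀ z, (columnNorm (f z) : ℂ) ≠ 0 := fun z => by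
    exact_mod_cast (columnNorm_pos (hG z)).ne'
  have hinv : ContDiff ℝ ∞ fun z => (columnNorm (f z) : ℂ)⁻¹ := hnc.inv hne
  refine contDiff_matrix fun i j => ?_
  fin_cases i <;> fin_cases j <;> simp only [iwasawaK, div_eq_mul_inv]
  · exact h00.mul hinv
  · exact ((hc h10).mul hinv).neg
  · exact contDiff_const
  · exact h10.mul hinv
  · exact (hc h00).mul hinv
  all_goals exact contDiff_const

/-! ### Gauge transformations of extended forms -/

/-- The conjugate transpose as a real linear map. -/
def conjTransposeL : Mat3 →L[ℝ] Mat3 :=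
  LinearMap.toContinuousLinearMap
    { toFun := fun X => Xᴴ
      map_add' := fun X Y => Matrix.conjTranspose_add X Y
      map_smul' := fun t X => by simp }

theorem extForm_apply (α : ℤ → OneForm) (ζ z v : ℂ) :
    extForm α ζ z v = ∑ j ∈ Finset.Icc (-2 : ℤ) 2, ζ ^ j • α j z v := by
  simp [extForm, sum_apply]

/-- The gauge transform `k⁻¹ α_ζ k + k⁻¹ dk`. -/
def gaugeForm (k : ℂ → Mat3) (α : ℤ → OneForm) (j : ℤ) : OneForm := fun z =>
  ContinuousLinearMap.mulLeftRight ℝ Mat3 (k z)ᴴ (k z) ∘L α j z +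
    if j = 0 then ContinuousLinearMap.mul ℝ Mat3 (k z)ᴴ ∘L fderiv ℝ k z else 0

theorem gaugeForm_apply (k : ℂ → Mat3) (α : ℤ → OneForm) (j : ℤ) (z v : ℂ) :
    gaugeForm k α j z v =
      (k z)ᴴ * α j z v * k z + if j = 0 then (k z)ᴴ * fderiv ℝ k z v else 0 := by
  rw [gaugeForm]
  split_ifs <;> simp [ContinuousLinearMap.mulLeftRight_apply]

theorem extForm_gaugeForm (k : ℂ → Mat3) (α : ℤ → OneForm) (ζ z v : ℂ) :
    extForm (gaugeForm k α) ζ z v =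
      (k z)ᴴ * extForm α ζ z v * k z + (k z)ᴴ * fderiv ℝ k z v := by
  rw [extForm_apply, extForm_apply]
  simp only [gaugeForm_apply, smul_add, Finset.sum_add_distrib, Finset.mul_sum, Finset.sum_mul,
    Matrix.mul_smul, Matrix.smul_mul]
  congr 1
  simp

theorem contDiff_gaugeForm {k : ℂ → Mat3} (hk : ContDiff ℝ ∞ k) {α : ℤ → OneForm} {j : ℤ}
    (hα : ContDiff ℝ ∞ (α j)) : ContDiff ℝ ∞ (gaugeForm k α j) := by
  have hks : ContDiff ℝ ∞ fun z => (k z)ᴴ := conjTransposeL.contDiff.comp hk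
  have hd : ContDiff ℝ ∞ (fderiv ℝ k) := hk.fderiv_right (by simp)
  refine ContDiff.add ?_ ?_
  · refine ContDiff.clm_comp ?_ hα
    exact (((ContinuousLinearMap.mulLeftRight ℝ Mat3).contDiff.comp hks).clm_apply hk)
  · by_cases h : j = 0
    · simp only [h, if_true]
      exact ((ContinuousLinearMap.mul ℝ Mat3).contDiff.comp hks).clm_comp hd
    · simp only [h, if_false]
      exact contDiff_const

/-- The Maurer–Cartan form of a `G₀`-valued function takes values in `𝔤₀`. -/
theorem gauge_maurerCartan {k : ℂ → Mat3} (hk : ContDiff ℝ ∞ k) (hG : ∀ z, k z ∈ G0) (z v : ℂ) :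
    barAlg ((k z)ᴴ * fderiv ℝ k z v) = (k z)ᴴ * fderiv ℝ k z v ∧
    tauAlg ((k z)ᴴ * fderiv ℝ k z v) = (k z)ᴴ * fderiv ℝ k z v := by
  have hd : HasFDerivAt k (fderiv ℝ k z) z := ((hk.differentiable (by simp)) z).hasFDerivAt
  have hs : HasFDerivAt (fun z => (k z)ᴴ) (conjTransposeL.comp (fderiv ℝ k z)) z :=
    conjTransposeL.hasFDerivAt.comp z hd
  have h1 : -((fderiv ℝ k z v)ᴴ * k z) = (k z)ᴴ * fderiv ℝ k z v := by
    have h := hs.fun_mul' hd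
    rw [funext fun z => G0_star_mul (hG z)] at h
    have h2 := DFunLike.congr_fun (h.unique (hasFDerivAt_const (1 : Mat3) z)) v
    have h3 : (k z)ᴴ * fderiv ℝ k z v + (fderiv ℝ k z v)ᴴ * k z = 0 := h2
    exact (eq_neg_of_add_eq_zero_left h3).symm
  have h2 : antiTau (fderiv ℝ k z v) = (fderiv ℝ k z v)ᴴ := by
    have h := (antiTau.restrictScalars ℝ).hasFDerivAt.comp z hd
    have he : (antiTau.restrictScalars ℝ : Mat3 → Mat3) ∘ k = fun z => (k z)ᴴ :=
      funext fun z => G0_antiTau (hG z)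
    rw [he] at h
    exact DFunLike.congr_fun (h.unique hs) v
  refine ⟨?_, ?_⟩
  · rw [barAlg, Matrix.conjTranspose_mul, Matrix.conjTranspose_conjTranspose, h1]
  · rw [tauAlg_eq, antiTau_mul, G0_antiTau_star (hG z), h2, h1]

theorem tauAlg_add (X Y : Mat3) : tauAlg (X + Y) = tauAlg X + tauAlg Y := by
  simp only [tauAlg_eq, map_add, neg_add]

theorem barAlg_add (X Y : Mat3) : barAlg (X + Y) = barAlg X + barAlg Y := by
  simp only [barAlg, Matrix.conjTranspose_add, neg_add]

theorem trace_tauAlg (X : Mat3) : (tauAlg X).trace = -X.trace := by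
  rw [tauAlg_eq, Matrix.trace_neg, trace_antiTau]

/-- The gauge is independent of $\zeta$, so $k^{-1}dk$ enters in degree zero only, where it lies in
$\mathfrak g_0$; conjugation by $k$ is complex linear and respects both symmetries. -/
theorem IsExtendedForm.gauge {α : ℤ → OneForm} (hα : IsExtendedForm α) {k : ℂ → Mat3}
    (hk : ContDiff ℝ ∞ k) (hG : ∀ z, k z ∈ G0) : IsExtendedForm (gaugeForm k α) where
  smooth j hj := contDiff_gaugeForm hk (hα.smooth j hj)
  trace_eq_zero ζ hζ z v := by
    -- $\tau$ reverses the sign of the trace, so the $\tau$-fixed form $k^{-1}dk$ is traceless.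
    have h := congrArg Matrix.trace (gauge_maurerCartan hk hG z v).2
    rw [trace_tauAlg, neg_eq_self] at h
    rw [extForm_gaugeForm, Matrix.trace_add, h, add_zero, Matrix.trace_mul_comm, ← mul_assoc,
      G0_mul_star (hG z), one_mul, hα.trace_eq_zero ζ hζ]
  real ζ hζ z v := by
    rw [extForm_gaugeForm, extForm_gaugeForm, barAlg_add, (gauge_maurerCartan hk hG z v).1,
      ← hα.real ζ hζ]
    simp [barAlg, Matrix.conjTranspose_mul, mul_assoc]
  equivariant ζ hζ z v := by
    rw [extForm_gaugeForm, extForm_gaugeForm, tauAlg_add, (gauge_maurerCartan hk hG z v).2,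
      ← hα.equivariant ζ hζ]
    simp [tauAlg_eq, antiTau_mul, G0_antiTau_star (hG z), G0_antiTau (hG z), mul_assoc]
  type_neg_two z v := by
    simp [gaugeForm_apply, hα.type_neg_two z v]
  type_neg_one z v := by
    simp [gaugeForm_apply, hα.type_neg_one z v]

theorem HasMaslovForm.gauge {μ : ℂ →L[ℝ] ℝ} {α : ℤ → OneForm} (hα : HasMaslovForm α μ)
    {k : ℂ → Mat3} (hG : ∀ z, k z ∈ G0) : HasMaslovForm (gaugeForm k α) μ := by
  intro z v
  have : gaugeForm k α (-2) z v + gaugeForm k α 2 z v =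
      (k z)ᴴ * (α (-2) z v + α 2 z v) * k z := by
    simp [gaugeForm_apply, mul_add, add_mul]
  rw [this, hα z v, Matrix.mul_smul, Matrix.smul_mul, mul_assoc (k z)ᴴ, ← G0C_commute_matD (hG z).1,
    ← mul_assoc, G0_star_mul (hG z), one_mul]

theorem MemLoopGroup.mul {Δ : Set (OnePoint ℂ)} {g h : Loop} (hg : MemLoopGroup Δ g)
    (hh : MemLoopGroup Δ h) : MemLoopGroup Δ (fun p => g p * h p) where
  analytic p hp := by
    induction p using OnePoint.rec with
    | infty => exact AnalyticAt.mul (hg.analytic _ hp) (hh.analytic _ hp)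
    | coe ζ => exact AnalyticAt.mul (hg.analytic _ hp) (hh.analytic _ hp)
  det_eq_one p hp := by rw [Matrix.det_mul, hg.det_eq_one p hp, hh.det_eq_one p hp, one_mul]
  real p hp := by rw [barGrp_mul, hg.real p hp, hh.real p hp]
  equivariant p hp := by rw [tauGrp_mul, hg.equivariant p hp, hh.equivariant p hp]

theorem memLoopGroup_const (Δ : Set (OnePoint ℂ)) {c : Mat3} (hc : c ∈ G0) :
    MemLoopGroup Δ (fun _ => c) where
  analytic p hp := by
    induction p using OnePoint.rec with
    | infty => exact analyticAt_const
    | coe ζ => exact analyticAt_const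
  det_eq_one _ _ := G0_det hc
  real _ _ := hc.2
  equivariant _ _ := hc.1.2

theorem MemLoopGroup.mono {Δ Δ' : Set (OnePoint ℂ)} {g : Loop} (hg : MemLoopGroup Δ g)
    (h : Δ' ⊆ Δ) : MemLoopGroup Δ' g :=
  ⟨fun p hp => hg.analytic p (h hp), fun p hp => hg.det_eq_one p (h hp),
    fun p hp => hg.real p (h hp), fun p hp => hg.equivariant p (h hp)⟩

theorem setE_subset_setCstar {ε : ℝ} (hε : 0 < ε) : setE ε ⊆ setCstar := by
  rintro p ⟨ζ, rfl, h, -⟩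
  exact ⟨ζ, rfl, norm_pos_iff.1 (hε.trans_le h)⟩

theorem IsFrameOf.hasFDerivAt {α : ℤ → OneForm} {F : ℂ → Loop} (hF : IsFrameOf α F) {ζ : ℂ}
    (hζ : ζ ≠ 0) (z : ℂ) : HasFDerivAt (fun w => F w (ζ : OnePoint ℂ))
      (ContinuousLinearMap.mul ℝ Mat3 (F z (ζ : OnePoint ℂ)) ∘L extForm α ζ z) z := by
  refine (((hF.smooth ζ hζ).differentiable (by simp)) z).hasFDerivAt.congr_fderiv ?_
  ext1 v
  exact hF.deriv_eq ζ hζ z v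

theorem IsFrameOf.gauge {α : ℤ → OneForm} {F : ℂ → Loop} (hF : IsFrameOf α F) {k : ℂ → Mat3}
    (hk : ContDiff ℝ ∞ k) (hG : ∀ z, k z ∈ G0) :
    IsFrameOf (gaugeForm k α) (fun z p => F z p * k z) where
  mem z := (hF.mem z).mul (memLoopGroup_const _ (hG z))
  smooth ζ hζ := (hF.smooth ζ hζ).mul hk
  deriv_eq ζ hζ z v := by
    have hd : HasFDerivAt k (fderiv ℝ k z) z := ((hk.differentiable (by simp)) z).hasFDerivAt
    have h := (hF.hasFDerivAt hζ z).fun_mul' hd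
    rw [h.fderiv, extForm_gaugeForm]
    have e : F z (ζ : OnePoint ℂ) * k z *
        ((k z)ᴴ * extForm α ζ z v * k z + (k z)ᴴ * fderiv ℝ k z v) =
        F z (ζ : OnePoint ℂ) * (k z * (k z)ᴴ) * extForm α ζ z v * k z +
        F z (ζ : OnePoint ℂ) * (k z * (k z)ᴴ) * fderiv ℝ k z v := by
      simp only [mul_add, mul_assoc]
    rw [e, G0_mul_star (hG z), mul_one, add_comm]
    rfl

theorem MemLoopGroup.antiTau_mul {Δ : Set (OnePoint ℂ)} {g : Loop} (hg : MemLoopGroup Δ g) {ζ : ℂ}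
    (hζ : (ζ : OnePoint ℂ) ∈ Δ) :
    antiTau (g (ζ : OnePoint ℂ)) * g ((Complex.I * ζ : ℂ) : OnePoint ℂ) = 1 :=
  (tauGrp_eq_iff (hg.det_eq_one _ hζ)).1 (hg.equivariant _ hζ)

theorem mem_setCstar {ζ : ℂ} (h : ζ ≠ 0) : (ζ : OnePoint ℂ) ∈ setCstar := ⟨ζ, rfl, h⟩

/-- If `a = F B` on the inner circle, with `F` a frame and `B` holomorphic in the inner disc, then
`a` has an `E`-factor, which is gauge equivalent to `F`. -/
theorem exists_gauge_isEFactor {μ : ℂ →L[ℝ] ℝ} {α : ℤ → OneForm} (hα : IsExtendedForm α)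
    (hμ : HasMaslovForm α μ) {F : ℂ → Loop} (hF : IsFrameOf α F) {ε : ℝ} (hε0 : 0 < ε)
    (hε1 : ε < 1) {a : ℂ → Loop} {a₀ B : ℂ → ℂ → Mat3}
    (hB : ∀ z ζ : ℂ, ‖ζ‖ ≤ ε → AnalyticAt ℂ (B z) ζ) (hB0 : ContDiff ℝ ∞ fun z => B z 0)
    (hFB : ∀ z ζ : ℂ, ζ ≠ 0 → ‖ζ‖ ≤ ε → a₀ z ζ = F z (ζ : OnePoint ℂ) * B z ζ)
    (hdet : ∀ z ζ : ℂ, ζ ≠ 0 → ‖ζ‖ ≤ ε → (a₀ z ζ).det = 1)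
    (hτ : ∀ z ζ : ℂ, ζ ≠ 0 → ‖ζ‖ ≤ ε → antiTau (a₀ z ζ) * a₀ z (Complex.I * ζ) = 1)
    (ha : ∀ z ζ : ℂ, ‖ζ‖ = ε → a z (ζ : OnePoint ℂ) = a₀ z ζ)
    (har : ∀ z ζ : ℂ, ‖ζ‖ = ε →
      a z (((conj ζ)⁻¹ : ℂ) : OnePoint ℂ) = barGrp (a z (ζ : OnePoint ℂ))) :
    ∃ k : ℂ → Mat3, ContDiff ℝ ∞ k ∧ (∀ z, k z ∈ G0) ∧
      IsEnlargedFrame μ (fun z p => F z p * k z) ∧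
      ∀ z, IsEFactor ε (a z) (fun p => F z p * k z) := by
  -- Away from $0$ the factor $B=F^{-1}a_0$ inherits determinant and twisting from $a_0$ and $F$;
  -- both relations extend over the puncture.
  have hI : ∀ z, IsInnerLoop ε (B z) := by
    intro z
    refine isInnerLoop_of_punctured hε0 (hB z) (fun ζ h0 h => ?_) fun ζ h0 h => ?_
    · have := hdet z ζ h0 h
      rwa [hFB z ζ h0 h, Matrix.det_mul, (hF.mem z).det_eq_one _ (mem_setCstar h0), one_mul] at this
    · have := hτ z ζ h0 h
      rw [hFB z ζ h0 h, hFB z _ (mul_ne_zero Complex.I_ne_zero h0) (by simpa using h),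
        antiTau_mul, mul_assoc, ← mul_assoc (antiTau (F z _)),
        (hF.mem z).antiTau_mul (mem_setCstar h0), one_mul] at this
      exact this
  have h00 : ‖(0 : ℂ)‖ ≤ ε := by simpa using hε0.le
  have hG : ∀ z, B z 0 ∈ G0C := fun z =>
    mem_G0C_iff.2 ⟨(hI z).det_eq_one 0 h00, by simpa using (hI z).equivariant 0 h00⟩
  have hk := iwasawaK_contDiff hB0 hG
  have hkG : ∀ z, iwasawaK (B z 0) ∈ G0 := fun z => iwasawaK_mem_G0 (hG z)
  -- The regrouping $FB=(Fk)(k^{-1}B)$, where $k$ is the unitary Iwasawa factor of $B(0)$, puts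
  -- $k^{-1}B(0)$ into the group $B$ as the normalisation demands.
  refine ⟨fun z => iwasawaK (B z 0), hk, hkG, ⟨_, hα.gauge hk hkG, hμ.gauge hkG, hF.gauge hk hkG⟩,
    fun z => ?_⟩
  refine isEFactor_of_inner hε0 hε1 (b := fun ζ => (iwasawaK (B z 0))ᴴ * B z ζ)
    (((hF.gauge hk hkG).mem z).mono (setE_subset_setCstar hε0)) ⟨?_, ?_, ?_⟩
    (iwasawaK_star_mul_mem (hG z)) (fun ζ h => ?_) (har z)
  · exact fun ζ h => analyticAt_const.mul ((hI z).analytic ζ h)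
  · intro ζ h
    rw [Matrix.det_mul, G0_det (G0_conjTranspose (hkG z)), (hI z).det_eq_one ζ h, one_mul]
  · intro ζ h
    rw [antiTau_mul, G0_antiTau_star (hkG z), mul_assoc, ← mul_assoc (iwasawaK _),
      G0_mul_star (hkG z), one_mul, (hI z).equivariant ζ h]
  · have h0 : ζ ≠ 0 := norm_pos_iff.1 (by rw [h]; exact hε0)
    rw [ha z ζ h, hFB z ζ h0 h.le, mul_assoc, ← mul_assoc (iwasawaK _), G0_mul_star (hkG z),
      one_mul]

/-! ### The extended frame of an extended Maurer–Cartan form -/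

/-- Liouville's formula for traceless coefficients. -/
theorem det_eq_of_hasDerivAt {φ a : ℝ → Mat3} (hφ : ∀ t, HasDerivAt φ (φ t * a t) t)
    (ha : ∀ t, (a t).trace = 0) (t : ℝ) : (φ t).det = (φ 0).det := by
  have he : ∀ i j t, HasDerivAt (fun t => φ t i j) ((φ t * a t) i j) t := fun i j t =>
    ((entryL i j).restrictScalars ℝ).hasFDerivAt.comp_hasDerivAt t (hφ t)
  have hd : ∀ t, HasDerivAt (fun t => (φ t).det) 0 t := by
    intro t
    simp only [Matrix.det_fin_three]
    refine ((((((((he 0 0 t).mul (he 1 1 t)).mul (he 2 2 t)).sub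
      (((he 0 0 t).mul (he 1 2 t)).mul (he 2 1 t))).sub
      (((he 0 1 t).mul (he 1 0 t)).mul (he 2 2 t))).add
      (((he 0 1 t).mul (he 1 2 t)).mul (he 2 0 t))).add
      (((he 0 2 t).mul (he 1 0 t)).mul (he 2 1 t))).sub
      (((he 0 2 t).mul (he 1 1 t)).mul (he 2 0 t))).congr_deriv ?_
    have h := ha t
    rw [Matrix.trace_fin_three] at h
    simp only [Matrix.mul_apply, Fin.sum_univ_three, Pi.mul_apply]
    have hdet := Matrix.det_fin_three (φ t)
    linear_combination (φ t).det * h - (a t 0 0 + a t 1 1 + a t 2 2) * hdet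
  exact is_const_of_deriv_eq_zero (fun t => (hd t).differentiableAt) (fun t => (hd t).deriv) t 0

theorem frame_det {θ : OneForm} {F : ℂ → Mat3}
    (hF : ∀ z, HasFDerivAt F (ContinuousLinearMap.mul ℝ Mat3 (F z) ∘L θ z) z)
    (hθ : ∀ z v, (θ z v).trace = 0) (z : ℂ) : (F z).det = (F 0).det := by
  have hl : ∀ t : ℝ, HasDerivAt (fun t : ℝ => (t : ℂ) * z) z t := fun t => by
    simpa using (Complex.ofRealCLM.hasDerivAt (x := t)).mul_const z
  have := det_eq_of_hasDerivAt (φ := fun t : ℝ => F (t * z)) (a := fun t : ℝ => θ (t * z) z)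
    (fun t => (hF _).comp_hasDerivAt t (hl t)) (fun t => hθ _ _) 1
  simpa using this

theorem det_exp_of_trace_eq_zero {X : Mat3} (hX : X.trace = 0) :
    (NormedSpace.exp X).det = 1 := by
  have := det_eq_of_hasDerivAt (φ := fun t : ℝ => NormedSpace.exp (t • X)) (a := fun _ => X)
    (fun t => hasDerivAt_exp_smul_const X t) (fun _ => hX) 1
  simpa using this

theorem eq_of_hasFDerivAt_zero {f : ℂ → Mat3} (hf : ∀ z, HasFDerivAt f (0 : ℂ →L[ℝ] Mat3) z)
    (z : ℂ) : f z = f 0 :=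
  is_const_of_fderiv_eq_zero (𝕜 := ℝ) (fun z => (hf z).differentiableAt) (fun z => (hf z).fderiv)
    z 0

/-- The derivative of $F'F^\dagger$ is $F'(\theta'+\theta^\dagger)F^\dagger=0$. So the reality of
the forms passes to the frames once it holds at $z=0$. -/
theorem frame_star_mul {θ θ' : OneForm} {F F' : ℂ → Mat3}
    (hF : ∀ z, HasFDerivAt F (ContinuousLinearMap.mul ℝ Mat3 (F z) ∘L θ z) z)
    (hF' : ∀ z, HasFDerivAt F' (ContinuousLinearMap.mul ℝ Mat3 (F' z) ∘L θ' z) z)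
    (h : ∀ z v, θ' z v = barAlg (θ z v)) (z : ℂ) : F' z * (F z)ᴴ = F' 0 * (F 0)ᴴ := by
  refine eq_of_hasFDerivAt_zero (f := fun z => F' z * (F z)ᴴ) (fun z => ?_) z
  have hs : HasFDerivAt (fun z => (F z)ᴴ)
      (conjTransposeL.comp (ContinuousLinearMap.mul ℝ Mat3 (F z) ∘L θ z)) z :=
    conjTransposeL.hasFDerivAt.comp z (hF z)
  refine ((hF' z).fun_mul' hs).congr_fderiv ?_
  ext1 v
  change F' z * (F z * θ z v)ᴴ + F' z * θ' z v * (F z)ᴴ = 0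
  rw [h, barAlg, Matrix.conjTranspose_mul]
  simp [mul_assoc]

/-- The same argument with $X\mapsto SX^tS^{-1}$ in place of the adjoint transfers the twisting. -/
theorem frame_mul_antiTau {θ θ' : OneForm} {F F' : ℂ → Mat3}
    (hF : ∀ z, HasFDerivAt F (ContinuousLinearMap.mul ℝ Mat3 (F z) ∘L θ z) z)
    (hF' : ∀ z, HasFDerivAt F' (ContinuousLinearMap.mul ℝ Mat3 (F' z) ∘L θ' z) z)
    (h : ∀ z v, θ' z v = tauAlg (θ z v)) (z : ℂ) :
    F' z * antiTau (F z) = F' 0 * antiTau (F 0) := by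
  refine eq_of_hasFDerivAt_zero (f := fun z => F' z * antiTau (F z)) (fun z => ?_) z
  have hs : HasFDerivAt (fun z => antiTau (F z))
      ((antiTau.restrictScalars ℝ).comp (ContinuousLinearMap.mul ℝ Mat3 (F z) ∘L θ z)) z :=
    (antiTau.restrictScalars ℝ).hasFDerivAt.comp z (hF z)
  refine ((hF' z).fun_mul' hs).congr_fderiv ?_
  ext1 v
  change F' z * antiTau (F z * θ z v) + F' z * θ' z v * antiTau (F z) = 0
  rw [h, tauAlg_eq, antiTau_mul]
  simp [mul_assoc]

theorem extForm_contDiff {α : ℤ → OneForm} (hα : IsExtendedForm α) (ζ : ℂ) :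
    ContDiff ℝ ∞ (extForm α ζ) :=
  ContDiff.sum fun j hj => (hα.smooth j hj).const_smul _

/-- The coefficients $\zeta^j$ are holomorphic on $\mathbb C^\times$, so the frames with value $1$
at the origin are too. Determinant and symmetries hold at $z=0$ and propagate. -/
theorem exists_extended_frame {α : ℤ → OneForm} (hα : IsExtendedMaurerCartanForm α) :
    ∃ F : ℂ → Loop, IsFrameOf α F ∧ ∀ ζ : ℂ, ζ ≠ 0 → F 0 (ζ : OnePoint ℂ) = 1 := by
  have hp : pencil (fun (j : Finset.Icc (-2 : ℤ) 2) ζ => ζ ^ (j : ℤ)) (fun j => α j) =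
      extForm α := by
    funext ζ z
    exact Finset.sum_coe_sort (Finset.Icc (-2 : ℤ) 2) fun j => ζ ^ j • α j z
  obtain ⟨Φ, h0, hΦ, han⟩ := exists_holomorphic_frame (U := {0}ᶜ) isOpen_compl_singleton
    (f := fun (j : Finset.Icc (-2 : ℤ) 2) ζ => ζ ^ (j : ℤ)) (θ := fun j => α j)
    (fun j ζ hζ => (differentiableAt_zpow.2 (Or.inl hζ)).differentiableWithinAt)
    (fun j => hα.smooth j j.2) (by rw [hp]; exact fun ζ hζ => hα.flat ζ hζ)
  rw [hp] at hΦ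
  refine ⟨fun z => ofPlane (Φ z), ⟨fun z => ⟨?_, ?_, ?_, ?_⟩, fun ζ hζ => ?_, fun ζ hζ z v => ?_⟩,
    h0⟩
  · rintro p ⟨ζ, rfl, hζ⟩
    exact han z ζ hζ
  · rintro p ⟨ζ, rfl, hζ⟩
    change (Φ z ζ).det = 1
    rw [frame_det (hΦ ζ hζ) (hα.trace_eq_zero ζ hζ) z, h0 ζ hζ, Matrix.det_one]
  · rintro p ⟨ζ, rfl, hζ⟩
    have hc : conj ζ ≠ 0 := by simpa using hζ
    rw [sphereConj_coe, sphereInv_coe hc]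
    change ((Φ z ζ)ᴴ)⁻¹ = Φ z (conj ζ)⁻¹
    have := frame_star_mul (hΦ ζ hζ) (hΦ _ (inv_ne_zero hc))
      (fun z v => (hα.real ζ hζ z v).symm) z
    rw [h0 ζ hζ, h0 _ (inv_ne_zero hc), Matrix.conjTranspose_one, one_mul] at this
    exact Matrix.inv_eq_left_inv this
  · rintro p ⟨ζ, rfl, hζ⟩
    have hI : Complex.I * ζ ≠ 0 := mul_ne_zero Complex.I_ne_zero hζ
    rw [sphereRot_coe, tauGrp_eq_inv]
    change (antiTau (Φ z ζ))⁻¹ = Φ z (Complex.I * ζ)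
    have := frame_mul_antiTau (hΦ ζ hζ) (hΦ _ hI)
      (fun z v => (hα.equivariant ζ hζ z v).symm) z
    rw [h0 ζ hζ, h0 _ hI, antiTau_one, one_mul] at this
    exact Matrix.inv_eq_left_inv this
  · exact frame_contDiff (extForm_contDiff hα.toIsExtendedForm ζ) (hΦ ζ hζ)
  · exact DFunLike.congr_fun (hΦ ζ hζ z).fderiv v

/-- Two frames of the same form differ by left multiplication with their ratio at `0`. -/
theorem IsFrameOf.eq_const_mul {α : ℤ → OneForm} (hα : IsExtendedForm α) {F F' : ℂ → Loop}
    (hF : IsFrameOf α F) (hF' : IsFrameOf α F')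
    {ζ : ℂ} (hζ : ζ ≠ 0) (h0 : F 0 (ζ : OnePoint ℂ) = 1) (z : ℂ) :
    F' z (ζ : OnePoint ℂ) = F' 0 (ζ : OnePoint ℂ) * F z (ζ : OnePoint ℂ) := by
  refine frame_unique (extForm_contDiff hα ζ).continuous (hF'.hasFDerivAt hζ)
    (H := fun z => F' 0 (ζ : OnePoint ℂ) * F z (ζ : OnePoint ℂ)) (fun w => ?_) (by rw [h0, mul_one]) z
  refine ((ContinuousLinearMap.mul ℝ Mat3 (F' 0 (ζ : OnePoint ℂ))).hasFDerivAt.comp w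
    (hF.hasFDerivAt hζ w)).congr_fderiv ?_
  ext1 v
  exact (mul_assoc _ _ _).symm

/-! ### Lax equations and gauging by exponentials -/

/-- The form `X dz`. -/
def dzForm (X : ℂ → Mat3) : OneForm := fun z => (ContinuousLinearMap.lsmul ℝ ℂ).flip (X z)

theorem dzForm_contDiff {X : ℂ → Mat3} (hX : ContDiff ℝ ∞ X) : ContDiff ℝ ∞ (dzForm X) :=
  (ContinuousLinearMap.lsmul ℝ ℂ (E := Mat3)).flip.contDiff.comp hX

/-- The Lax equation says that $FXF^{-1}$ is constant. Without inverses: $FX-X(0)F$ solves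
$dY=Y\theta$ with $Y(0)=0$, so it vanishes. -/
theorem lax_conj {θ : OneForm} (hθ : Continuous θ) {F X : ℂ → Mat3}
    (hF : ∀ z, HasFDerivAt F (ContinuousLinearMap.mul ℝ Mat3 (F z) ∘L θ z) z) (hF0 : F 0 = 1)
    (hX : Differentiable ℝ X) (hlax : ∀ z v, fderiv ℝ X z v = ⁅X z, θ z v⁆) (z : ℂ) :
    F z * X z = X 0 * F z := by
  refine sub_eq_zero.1 (frame_unique hθ (F := fun z => F z * X z - X 0 * F z) (H := fun _ => 0)
    (fun w => ?_) (fun w => ?_) (by simp [hF0]) z)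
  · refine (((hF w).fun_mul' (hX w).hasFDerivAt).sub
      ((ContinuousLinearMap.mul ℝ Mat3 (X 0)).hasFDerivAt.comp w (hF w))).congr_fderiv ?_
    ext1 v
    change F w * fderiv ℝ X w v + F w * θ w v * X w - X 0 * (F w * θ w v) =
      (F w * X w - X 0 * F w) * θ w v
    rw [hlax, Ring.lie_def]
    noncomm_ring
  · refine (hasFDerivAt_const (0 : Mat3) w).congr_fderiv ?_
    ext1 v
    simp

/-- If `dX = [X, θ]` and `θ` is flat, so is `θ - X dz`. -/
theorem lax_flat {θ : OneForm} (hθ : Differentiable ℝ θ)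
    (hflat : ∀ z u v, fderiv ℝ θ z u v - fderiv ℝ θ z v u + ⁅θ z u, θ z v⁆ = 0) {X : ℂ → Mat3}
    (hX : Differentiable ℝ X) (hlax : ∀ z v, fderiv ℝ X z v = ⁅X z, θ z v⁆) (z u v : ℂ) :
    fderiv ℝ (fun z => θ z - dzForm X z) z u v - fderiv ℝ (fun z => θ z - dzForm X z) z v u +
      ⁅θ z u - dzForm X z u, θ z v - dzForm X z v⁆ = 0 := by
  have hd : HasFDerivAt (fun z => θ z - dzForm X z)
      (fderiv ℝ θ z - (ContinuousLinearMap.lsmul ℝ ℂ).flip.comp (fderiv ℝ X z)) z :=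
    (hθ z).hasFDerivAt.sub
      ((ContinuousLinearMap.lsmul ℝ ℂ (E := Mat3)).flip.hasFDerivAt.comp z (hX z).hasFDerivAt)
  rw [hd.fderiv]
  change (fderiv ℝ θ z u v - v • fderiv ℝ X z u) - (fderiv ℝ θ z v u - u • fderiv ℝ X z v) +
    ⁅θ z u - u • X z, θ z v - v • X z⁆ = 0
  -- With $dX=[X,\theta]$ the derivative terms cancel the cross terms of the bracket; the bracket of
  -- $X\,dz$ with itself vanishes.
  rw [hlax, hlax]
  have h := hflat z u v
  simp only [Ring.lie_def, mul_sub, sub_mul, Matrix.mul_smul, Matrix.smul_mul, smul_sub,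
    smul_smul] at h ⊢
  rw [mul_comm u v]
  rw [← h]
  abel

/-- If `dX = [X, θ]` and `F` is a frame of `θ`, then `exp(-z X(0)) F` is a frame of `θ - X dz`. -/
theorem lax_frame {θ : OneForm} (hθ : Continuous θ) {F X : ℂ → Mat3}
    (hF : ∀ z, HasFDerivAt F (ContinuousLinearMap.mul ℝ Mat3 (F z) ∘L θ z) z) (hF0 : F 0 = 1)
    (hX : Differentiable ℝ X) (hlax : ∀ z v, fderiv ℝ X z v = ⁅X z, θ z v⁆) (z : ℂ) :
    HasFDerivAt (fun z : ℂ => NormedSpace.exp (z • (-X 0)) * F z)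
      (ContinuousLinearMap.mul ℝ Mat3 (NormedSpace.exp (z • (-X 0)) * F z) ∘L
        (θ z - dzForm X z)) z := by
  have he := ((hasDerivAt_exp_smul_const (-X 0) z).hasFDerivAt.restrictScalars ℝ).fun_mul' (hF z)
  refine he.congr_fderiv ?_
  ext1 v
  change NormedSpace.exp (z • (-X 0)) * (F z * θ z v) +
    (v • (NormedSpace.exp (z • (-X 0)) * -X 0)) * F z =
    NormedSpace.exp (z • (-X 0)) * F z * (θ z v - v • X z)
  have h := lax_conj hθ hF hF0 hX hlax z
  rw [mul_sub, Matrix.mul_smul, mul_assoc _ (F z) (X z), h, Matrix.smul_mul]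
  simp [mul_assoc, sub_eq_add_neg]

/-! ### The leading coefficients -/

theorem IsTypeOneZero.apply_eq {θ : OneForm} (h : IsTypeOneZero θ) (z v : ℂ) :
    θ z v = v • ddz θ z := by
  have hI : θ z Complex.I = Complex.I • θ z 1 := by simpa using h z 1
  have hd : ddz θ z = θ z 1 := by
    rw [ddz, hI, smul_smul, Complex.I_mul_I, neg_one_smul, sub_neg_eq_add, ← two_smul ℂ, smul_smul]
    norm_num
  have hv : v = v.re • (1 : ℂ) + v.im • Complex.I := by
    apply Complex.ext <;> simp
  rw [hd]
  conv_lhs => rw [hv, map_add, map_smul, map_smul, hI]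
  have : v • θ z 1 = ((v.re : ℂ) + v.im * Complex.I) • θ z 1 := by rw [Complex.re_add_im]
  rw [this, add_smul, mul_smul]
  rfl

theorem sum_Icc_neg_two_two {M : Type*} [AddCommMonoid M] (f : ℤ → M) :
    ∑ j ∈ Finset.Icc (-2 : ℤ) 2, f j = f (-2) + (f (-1) + (f 0 + (f 1 + f 2))) := by
  have : Finset.Icc (-2 : ℤ) 2 = {-2, -1, 0, 1, 2} := by decide
  rw [this]
  simp

/-- Adding the values at $\pm1$, $\pm i$ and $\pm2$ removes the odd powers and leaves three
independent equations for the coefficients of $w^{-2}$, $1$ and $w^2$. -/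
theorem laurent_coeff_eq_zero {c : ℤ → ℂ}
    (h : ∀ w : ℂ, w ≠ 0 → ∑ j ∈ Finset.Icc (-2 : ℤ) 2, w ^ j * c j = 0) : c (-2) = 0 := by
  simp only [sum_Icc_neg_two_two] at h
  have h1 := h 1 one_ne_zero
  have h2 := h (-1) (by norm_num)
  have h3 := h Complex.I Complex.I_ne_zero
  have h4 := h (-Complex.I) (neg_ne_zero.2 Complex.I_ne_zero)
  have h5 := h 2 two_ne_zero
  have h6 := h (-2) (by norm_num)
  have hz : ∀ w : ℂ, w ^ (-2 : ℤ) = (w ^ 2)⁻¹ := fun w => by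
    rw [zpow_neg]; norm_cast
  have hz1 : ∀ w : ℂ, w ^ (-1 : ℤ) = w⁻¹ := fun w => by rw [zpow_neg_one]
  have hp : ∀ w : ℂ, w ^ (2 : ℤ) = w ^ 2 := fun w => by norm_cast
  simp only [hz, hz1, hp, zpow_zero, zpow_one, inv_neg, neg_sq, Complex.inv_I, Complex.I_sq]
    at h1 h2 h3 h4 h5 h6
  norm_num at h1 h2 h3 h4 h5 h6
  linear_combination (4 / 15 : ℂ) * ((5 / 4 : ℂ) * (h1 + h2) * 2 / 2 - (3 / 4 : ℂ) * (h3 + h4)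
    - (h5 + h6) / 2)

theorem IsExtendedForm.coeff_two {α : ℤ → OneForm} (hα : IsExtendedForm α) (z v : ℂ) :
    α 2 z v = barAlg (α (-2) z v) := by
  have h : ∀ i k : Fin 3, barAlg (α (-2) z v) i k - α 2 z v i k = 0 := by
    intro i k
    -- Reality is used at $\bar w$, so that both sides become Laurent polynomials in $w$ itself.
    refine laurent_coeff_eq_zero (c := fun j => barAlg (α j z v) i k - α (-j) z v i k)
      fun w hw => ?_
    have hw' : conj w ≠ 0 := by simpa using hw
    have e := congrFun (congrFun (hα.real (conj w) hw' z v) i) k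
    rw [extForm_apply, extForm_apply, Complex.conj_conj] at e
    simp only [sum_Icc_neg_two_two] at e ⊢
    simp [barAlg] at e ⊢
    linear_combination e
  ext i k
  exact (sub_eq_zero.1 (h i k)).symm

/-- By reality $\alpha_2$ is the conjugate of $\alpha_{-2}$, hence of type $(0,1)$. The Maslov
condition on $\alpha_{-2}+\alpha_2$ therefore fixes $\alpha_{-2}(\partial/\partial z)$ as the
constant $A$. -/
theorem ddz_neg_two_eq {μ : ℂ →L[ℝ] ℝ} {α : ℤ → OneForm} (hα : IsExtendedForm α)
    (hμ : HasMaslovForm α μ) (z : ℂ) : ddz (α (-2)) z = vacuumA μ := by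
  have hI : α 2 z Complex.I = -(Complex.I • α 2 z 1) := by
    have h : α (-2) z Complex.I = Complex.I • α (-2) z 1 := by simpa using hα.type_neg_two z 1
    rw [hα.coeff_two, hα.coeff_two, h]
    simp [barAlg]
  have h1 := hμ z 1
  have h2 := hμ z Complex.I
  rw [hI] at h2
  have e1 : α (-2) z 1 = (-(Complex.I * Real.pi * (μ 1 : ℂ))) • matD - α 2 z 1 :=
    eq_sub_of_add_eq h1
  have e2 : α (-2) z Complex.I = (-(Complex.I * Real.pi * (μ Complex.I : ℂ))) • matD +
      Complex.I • α 2 z 1 := by rw [← h2]; abel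
  rw [ddz, e1, e2, vacuumA]
  simp only [smul_add, smul_sub, smul_smul, Complex.I_mul_I]
  module

/-- The scalar with `A = vacuumScalar μ • D`. -/
def vacuumScalar (μ : ℂ →L[ℝ] ℝ) : ℂ :=
  -(Complex.I * Real.pi * ((1 / 2 : ℂ) * ((μ 1 : ℂ) - Complex.I * (μ Complex.I : ℂ))))

theorem vacuumA_eq (μ : ℂ →L[ℝ] ℝ) : vacuumA μ = vacuumScalar μ • matD := rfl

theorem vacuumScalar_ne_zero {μ : ℂ →L[ℝ] ℝ} (hμ : μ ≠ 0) : vacuumScalar μ ≠ 0 := by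
  intro h
  have hpi : (Real.pi : ℂ) ≠ 0 := by exact_mod_cast Real.pi_ne_zero
  simp only [vacuumScalar, neg_eq_zero, mul_eq_zero, Complex.I_ne_zero, hpi, false_or, one_div,
    inv_eq_zero, two_ne_zero] at h
  have h1 : μ 1 = 0 := by simpa using congrArg Complex.re h
  have h2 : μ Complex.I = 0 := by simpa using congrArg Complex.im h
  apply hμ
  ext v
  have hv : v = v.re • (1 : ℂ) + v.im • Complex.I := by apply Complex.ext <;> simp
  rw [hv, map_add, map_smul, map_smul, h1, h2]
  simp

/-! ### The holomorphic factor of `exp(z η)` -/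

/-- The identity `α_ζ - ζ^{4d} ξ_ζ dz = (terms of nonnegative degree)`. -/
theorem ext_sub_killing {d : ℕ} {α : ℤ → OneForm} (hα : IsExtendedForm α) {c : ℤ → ℂ → Mat3}
    (hc2 : ∀ z, c (-(4 * (d : ℤ) + 2)) z = ddz (α (-2)) z)
    (hc1 : ∀ z, c (-(4 * (d : ℤ) + 1)) z = ddz (α (-1)) z) {ζ : ℂ} (hζ : ζ ≠ 0) (z v : ℂ) :
    extForm α ζ z v - v • ζ ^ (4 * d) •
        ∑ n ∈ Finset.Icc (-(4 * (d : ℤ) + 2)) (4 * (d : ℤ) + 2), (ζ ^ n) • c n z =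
      ∑ j ∈ Finset.Icc (0 : ℤ) 2, ζ ^ j.toNat • α j z v -
        ∑ n ∈ Finset.Icc (-(4 * (d : ℤ))) (4 * (d : ℤ) + 2),
          ζ ^ (n + 4 * d).toNat • v • c n z := by
  have hs1 : ∀ a b : ℤ, a ≤ b → ∀ f : ℤ → Mat3, ∑ n ∈ Finset.Icc a b, f n =
      f a + ∑ n ∈ Finset.Icc (a + 1) b, f n := by
    intro a b h f
    rw [← Finset.insert_Icc_add_one_left_eq_Icc h, Finset.sum_insert (by simp)]
  have hz : ∀ m : ℤ, 0 ≤ m → ζ ^ m.toNat = ζ ^ m := fun m hm => by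
    rw [← zpow_natCast, Int.toNat_of_nonneg hm]
  rw [extForm_apply, hs1 (-2) 2 (by norm_num), hs1 (-2 + 1) 2 (by norm_num),
    hs1 (-(4 * (d : ℤ) + 2)) _ (by omega), hs1 (-(4 * (d : ℤ) + 2) + 1) _ (by omega)]
  have i1 : (-2 + 1 + 1 : ℤ) = 0 := by norm_num
  have i2 : (-(4 * (d : ℤ) + 2) + 1 + 1) = -(4 * (d : ℤ)) := by ring
  have i3 : (-(4 * (d : ℤ) + 2) + 1) = -(4 * (d : ℤ) + 1) := by ring
  have i4 : (-2 + 1 : ℤ) = -1 := by norm_num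
  rw [i1, i2, i3, i4, hc2, hc1, hα.type_neg_two.apply_eq, hα.type_neg_one.apply_eq]
  have e1 : ∑ j ∈ Finset.Icc (0 : ℤ) 2, ζ ^ j.toNat • α j z v =
      ∑ j ∈ Finset.Icc (0 : ℤ) 2, ζ ^ j • α j z v :=
    Finset.sum_congr rfl fun j hj => by rw [hz j (Finset.mem_Icc.1 hj).1]
  have e2 : ∑ n ∈ Finset.Icc (-(4 * (d : ℤ))) (4 * (d : ℤ) + 2),
      ζ ^ (n + 4 * d).toNat • v • c n z =
      v • ζ ^ (4 * d) • ∑ n ∈ Finset.Icc (-(4 * (d : ℤ))) (4 * (d : ℤ) + 2), ζ ^ n • c n z := by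
    rw [Finset.smul_sum, Finset.smul_sum]
    refine Finset.sum_congr rfl fun n hn => ?_
    rw [hz _ (by have := (Finset.mem_Icc.1 hn).1; omega), zpow_add₀ hζ, smul_smul, smul_smul,
      smul_smul]
    congr 1
    norm_cast
    ring
  have p2 : ζ ^ (4 * d) * ζ ^ (-(4 * (d : ℤ) + 2)) = ζ ^ (-2 : ℤ) := by
    rw [← zpow_natCast, ← zpow_add₀ hζ]; congr 1; push_cast; ring
  have p1 : ζ ^ (4 * d) * ζ ^ (-(4 * (d : ℤ) + 1)) = ζ ^ (-1 : ℤ) := by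
    rw [← zpow_natCast, ← zpow_add₀ hζ]; congr 1; push_cast; ring
  rw [e1, e2, smul_add, smul_add, smul_add, smul_add, smul_smul (ζ ^ (4 * d)), p2,
    smul_smul (ζ ^ (4 * d)), p1, smul_comm v, smul_comm v (ζ ^ (-1 : ℤ))]
  abel

/-- The form $\alpha_\zeta-\zeta^{4d}\xi_\zeta\,dz$ is polynomial in $\zeta$ and flat, so its frame
$C_\zeta$ is entire in $\zeta$. For $\zeta\ne0$ uniqueness gives $C=\exp(-z\eta)F$, and $b=C^{-1}$.
-/
theorem exists_holomorphic_factor {α : ℤ → OneForm} (hα : IsExtendedMaurerCartanForm α) {d : ℕ}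
    {ξ : ℂ → ℂ → Mat3} (hξ : IsAdaptedPolynomialKillingField α d ξ) {F : ℂ → Loop}
    (hF : IsFrameOf α F) (hF0 : ∀ ζ : ℂ, ζ ≠ 0 → F 0 (ζ : OnePoint ℂ) = 1) :
    ∃ b : ℂ → ℂ → Mat3, (∀ z ζ, AnalyticAt ℂ (b z) ζ) ∧ (ContDiff ℝ ∞ fun z => b z 0) ∧
      ∀ z ζ : ℂ, ζ ≠ 0 → NormedSpace.exp (z • ζ ^ (4 * d) • ξ 0 ζ) = F z (ζ : OnePoint ℂ) * b z ζ := by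
  obtain ⟨c, hc, hexp, hc2, hc1⟩ := hξ.expansion
  let I1 : Finset ℤ := Finset.Icc 0 2
  let I2 : Finset ℤ := Finset.Icc (-(4 * (d : ℤ))) (4 * (d : ℤ) + 2)
  -- The exponents left after the two leading terms cancel are nonnegative, so `toNat` loses nothing
  -- and every $f_i$ is entire.
  let f : I1 ⊕ I2 → ℂ → ℂ := Sum.elim (fun j ζ => ζ ^ (j : ℤ).toNat)
    (fun n ζ => ζ ^ ((n : ℤ) + 4 * d).toNat)
  let θ : I1 ⊕ I2 → OneForm := Sum.elim (fun j => α j) (fun n => fun z => -dzForm (c n) z)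
  have hf : ∀ i, Differentiable ℂ (f i) := by
    rintro (j | n) <;> simp only [f, Sum.elim_inl, Sum.elim_inr] <;> fun_prop
  have hθ : ∀ i, ContDiff ℝ ∞ (θ i) := by
    rintro (j | n)
    · refine hα.smooth j (Finset.mem_Icc.2 ?_)
      have := Finset.mem_Icc.1 j.2
      omega
    · exact (dzForm_contDiff (hc n)).neg
  let X : ℂ → ℂ → Mat3 := fun ζ z => ζ ^ (4 * d) • ξ z ζ
  have hp : ∀ ζ : ℂ, ζ ≠ 0 → pencil f θ ζ = fun z => extForm α ζ z - dzForm (X ζ) z := by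
    intro ζ hζ
    funext z
    ext1 v
    have h := ext_sub_killing hα.toIsExtendedForm hc2 hc1 hζ z v
    rw [← hexp z ζ hζ] at h
    change _ = extForm α ζ z v - v • ζ ^ (4 * d) • ξ z ζ
    rw [h, pencil, sum_apply, Fintype.sum_sum_type, sub_eq_add_neg, ← Finset.sum_neg_distrib,
      ← Finset.sum_coe_sort I1, ← Finset.sum_coe_sort I2]
    congr 1
    refine Finset.sum_congr rfl fun n _ => ?_
    change ζ ^ ((n : ℤ) + 4 * d).toNat • -((v : ℂ) • c n z) =
      -(ζ ^ ((n : ℤ) + 4 * d).toNat • v • c n z)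
    exact smul_neg _ _
  have hXd : ∀ ζ : ℂ, ζ ≠ 0 → Differentiable ℝ (fun z => ξ z ζ) := by
    intro ζ hζ
    rw [funext fun z => hexp z ζ hζ]
    refine Differentiable.fun_sum fun n _ => ?_
    exact ((hc n).differentiable (by simp)).fun_const_smul _
  have hX : ∀ ζ : ℂ, ζ ≠ 0 → Differentiable ℝ (X ζ) := fun ζ hζ => (hXd ζ hζ).fun_const_smul _
  have hlax : ∀ ζ : ℂ, ζ ≠ 0 → ∀ z v, fderiv ℝ (X ζ) z v = ⁅X ζ z, extForm α ζ z v⁆ := by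
    intro ζ hζ z v
    have h : fderiv ℝ (X ζ) z = ζ ^ (4 * d) • fderiv ℝ (fun z => ξ z ζ) z :=
      (((hXd ζ hζ) z).hasFDerivAt.const_smul (ζ ^ (4 * d))).fderiv
    rw [h]
    change ζ ^ (4 * d) • fderiv ℝ (fun z => ξ z ζ) z v = ⁅ζ ^ (4 * d) • ξ z ζ, extForm α ζ z v⁆
    rw [hξ.lax ζ hζ, Ring.lie_def, Ring.lie_def, smul_sub, Matrix.smul_mul, Matrix.mul_smul]
  have hαd : ∀ ζ, Differentiable ℝ (extForm α ζ) := fun ζ =>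
    (extForm_contDiff hα.toIsExtendedForm ζ).differentiable (by simp)
  have hfl : ∀ ζ : ℂ, ζ ≠ 0 → ∀ z u v, fderiv ℝ (pencil f θ ζ) z u v -
      fderiv ℝ (pencil f θ ζ) z v u + ⁅pencil f θ ζ z u, pencil f θ ζ z v⁆ = 0 := by
    intro ζ hζ z u v
    rw [hp ζ hζ]
    exact lax_flat (hαd ζ) (hα.flat ζ hζ) (hX ζ hζ) (hlax ζ hζ) z u v
  have hfd : ∀ ζ z u v, fderiv ℝ (pencil f θ ζ) z u v = ∑ i, f i ζ • fderiv ℝ (θ i) z u v := by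
    intro ζ z u v
    have h : HasFDerivAt (pencil f θ ζ) (∑ i, f i ζ • fderiv ℝ (θ i) z) z :=
      HasFDerivAt.fun_sum fun i _ =>
        (((hθ i).differentiable (by simp)) z).hasFDerivAt.const_smul (f i ζ)
    rw [h.fderiv, sum_apply, sum_apply]
    rfl
  have hfc : ∀ i, Continuous (f i) := fun i => (hf i).continuous
  -- At $\zeta=0$ neither $\alpha_\zeta$ nor the Lax equation is available. Flatness there follows
  -- by continuity from $\zeta\ne0$.
  have hflat : ∀ ζ ∈ (Set.univ : Set ℂ), ∀ z u v, fderiv ℝ (pencil f θ ζ) z u v -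
      fderiv ℝ (pencil f θ ζ) z v u + ⁅pencil f θ ζ z u, pencil f θ ζ z v⁆ = 0 := by
    intro ζ _ z u v
    refine congrFun (Continuous.ext_on (dense_compl_singleton (0 : ℂ)) (g := fun _ => (0 : Mat3))
      (f := fun ζ => fderiv ℝ (pencil f θ ζ) z u v -
      fderiv ℝ (pencil f θ ζ) z v u + ⁅pencil f θ ζ z u, pencil f θ ζ z v⁆) ?_ continuous_const
      fun ζ hζ => hfl ζ hζ z u v) ζ
    have hpc : ∀ w, Continuous fun ζ => pencil f θ ζ z w := fun w => by
      have : (fun ζ => pencil f θ ζ z w) = fun ζ => ∑ i, f i ζ • θ i z w := by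
        funext ζ; rw [pencil, sum_apply]; rfl
      rw [this]
      exact continuous_finsetSum _ fun i _ => (hfc i).smul continuous_const
    simp only [hfd, Ring.lie_def]
    exact ((continuous_finsetSum _ fun i _ => (hfc i).smul continuous_const).sub
      (continuous_finsetSum _ fun i _ => (hfc i).smul continuous_const)).add
      (((hpc u).mul (hpc v)).sub ((hpc v).mul (hpc u)))
  obtain ⟨C, hC0, hC, hCan⟩ := exists_holomorphic_frame isOpen_univ
    (fun i => (hf i).differentiableOn) hθ hflat
  refine ⟨fun z ζ => (C z ζ).adjugate, fun z ζ => analyticAt_adjugate (hCan z ζ trivial),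
    contDiff_adjugate (frame_contDiff (pencil_contDiff f hθ 0) (hC 0 trivial)), fun z ζ hζ => ?_⟩
  have hCF : C z ζ = NormedSpace.exp (z • (-X ζ 0)) * F z (ζ : OnePoint ℂ) := by
    refine frame_unique (pencil_contDiff f hθ ζ).continuous (hC ζ trivial)
      (H := fun z => NormedSpace.exp (z • (-X ζ 0)) * F z (ζ : OnePoint ℂ)) (fun w => ?_) ?_ z
    · rw [hp ζ hζ]
      exact lax_frame (extForm_contDiff hα.toIsExtendedForm ζ).continuous (hF.hasFDerivAt hζ)
        (hF0 ζ hζ) (hX ζ hζ) (hlax ζ hζ) w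
    · rw [hC0 ζ trivial, hF0 ζ hζ]; simp
  have hdet : (C z ζ).det = 1 := by
    rw [hCF, Matrix.det_mul, (hF.mem z).det_eq_one _ (mem_setCstar hζ), mul_one]
    refine det_exp_of_trace_eq_zero ?_
    simp [X, hξ.trace_eq_zero 0 ζ hζ]
  have hinv : C z ζ * (C z ζ).adjugate = 1 := by rw [Matrix.mul_adjugate, hdet, one_smul]
  have hexp' : NormedSpace.exp (z • ζ ^ (4 * d) • ξ 0 ζ) * NormedSpace.exp (z • (-X ζ 0)) = 1 := by
    have : z • (-X ζ 0) = -(z • ζ ^ (4 * d) • ξ 0 ζ) := smul_neg _ _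
    rw [this, Matrix.exp_neg]
    exact Matrix.mul_nonsing_inv _ ((Matrix.isUnit_iff_isUnit_det _).1 (Matrix.isUnit_exp _))
  have hFC : F z (ζ : OnePoint ℂ) = NormedSpace.exp (z • ζ ^ (4 * d) • ξ 0 ζ) * C z ζ := by
    rw [hCF, ← mul_assoc, hexp', one_mul]
  rw [hFC, mul_assoc, hinv, mul_one]

/-! ### Block diagonalisation near `ζ = 0` -/

/-- The projection to the part of a matrix which is off-diagonal with respect to `2 + 1` blocks. -/
def offL : Mat3 →L[ℂ] Mat3 :=
  LinearMap.toContinuousLinearMap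
    { toFun := fun X => !![0, 0, X 0 2; 0, 0, X 1 2; X 2 0, X 2 1, 0]
      map_add' := fun X Y => by ext i j; fin_cases i <;> fin_cases j <;> simp
      map_smul' := fun c X => by ext i j; fin_cases i <;> fin_cases j <;> simp }

/-- The projection to the block diagonal part of a matrix. -/
def blkL : Mat3 →L[ℂ] Mat3 :=
  LinearMap.toContinuousLinearMap
    { toFun := fun X => !![X 0 0, X 0 1, 0; X 1 0, X 1 1, 0; 0, 0, X 2 2]
      map_add' := fun X Y => by ext i j; fin_cases i <;> fin_cases j <;> simp
      map_smul' := fun c X => by ext i j; fin_cases i <;> fin_cases j <;> simp }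

theorem offL_apply (X : Mat3) : offL X = !![0, 0, X 0 2; 0, 0, X 1 2; X 2 0, X 2 1, 0] := rfl

theorem blkL_apply (X : Mat3) :
    blkL X = !![X 0 0, X 0 1, 0; X 1 0, X 1 1, 0; 0, 0, X 2 2] := rfl

theorem offL_eq_zero {X : Mat3} (h : offL X = 0) :
    X 0 2 = 0 ∧ X 1 2 = 0 ∧ X 2 0 = 0 ∧ X 2 1 = 0 :=
  ⟨congrFun (congrFun h 0) 2, congrFun (congrFun h 1) 2, congrFun (congrFun h 2) 0,
    congrFun (congrFun h 2) 1⟩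

theorem blkL_eq_zero {X : Mat3} (h : blkL X = 0) :
    X 0 0 = 0 ∧ X 0 1 = 0 ∧ X 1 0 = 0 ∧ X 1 1 = 0 ∧ X 2 2 = 0 :=
  ⟨congrFun (congrFun h 0) 0, congrFun (congrFun h 0) 1, congrFun (congrFun h 1) 0,
    congrFun (congrFun h 1) 1, congrFun (congrFun h 2) 2⟩

theorem offL_add_blkL_eq_zero {X Y : Mat3} (h : offL X + blkL Y = 0) :
    offL X = 0 ∧ blkL Y = 0 := by
  have e := fun i j => congrFun (congrFun h i) j
  simp only [offL_apply, blkL_apply, Matrix.add_apply] at e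
  have e00 := e 0 0; have e01 := e 0 1; have e02 := e 0 2
  have e10 := e 1 0; have e11 := e 1 1; have e12 := e 1 2
  have e20 := e 2 0; have e21 := e 2 1; have e22 := e 2 2
  simp at e00 e01 e02 e10 e11 e12 e20 e21 e22
  constructor <;> ext i j <;> fin_cases i <;> fin_cases j <;> simp [offL_apply, blkL_apply, *]

theorem antiTau_offL (X : Mat3) : antiTau (offL X) = offL (antiTau X) := by
  rw [antiTau_entries, antiTau_entries]
  ext i j; fin_cases i <;> fin_cases j <;> simp [offL_apply]

theorem antiTau_blkL (X : Mat3) : antiTau (blkL X) = blkL (antiTau X) := by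
  rw [antiTau_entries, antiTau_entries]
  ext i j; fin_cases i <;> fin_cases j <;> simp [blkL_apply]

theorem commute_matD_iff {X : Mat3} : Commute matD X ↔ offL X = 0 := by
  constructor
  · intro h
    have e := fun i j => congrFun (congrFun h.eq i) j
    simp only [Matrix.mul_apply, Fin.sum_univ_three] at e
    have e02 := e 0 2; have e12 := e 1 2; have e20 := e 2 0; have e21 := e 2 1
    simp [matD] at e02 e12 e20 e21
    have h02 : X 0 2 = 0 := by linear_combination (1 / 3 : ℂ) * e02
    have h12 : X 1 2 = 0 := by linear_combination (1 / 3 : ℂ) * e12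
    have h20 : X 2 0 = 0 := by linear_combination (-1 / 3 : ℂ) * e20
    have h21 : X 2 1 = 0 := by linear_combination (-1 / 3 : ℂ) * e21
    ext i j; fin_cases i <;> fin_cases j <;> simp [offL_apply, h02, h12, h20, h21]
  · intro h
    obtain ⟨h02, h12, h20, h21⟩ := offL_eq_zero h
    ext i j
    simp only [Matrix.mul_apply, Fin.sum_univ_three]
    fin_cases i <;> fin_cases j <;> simp [matD, h02, h12, h20, h21, mul_comm]

/-- The square of $X\mapsto SX^tS^{-1}$ is conjugation by $S^2=\mathrm{diag}(-1,-1,1)$, which is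
trivial on block diagonal matrices. -/
theorem antiTau_antiTau {X : Mat3} (h : offL X = 0) : antiTau (antiTau X) = X := by
  obtain ⟨h02, h12, h20, h21⟩ := offL_eq_zero h
  rw [antiTau_entries, antiTau_entries]
  ext i j; fin_cases i <;> fin_cases j <;> simp [h02, h12, h20, h21]

/-- The map whose zeros `Z` give the block diagonalising Cayley transforms. -/
def cayleyMap (N : ℂ → Mat3) (p : ℂ × Mat3) : ℂ × Mat3 :=
  (p.1, offL ((1 - p.2) * (1 - p.2) * N p.1 * ((1 + p.2) * (1 + p.2))) + blkL p.2)

theorem cayleyMap_analyticAt {N : ℂ → Mat3} (hN : Differentiable ℂ N) (p : ℂ × Mat3) :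
    AnalyticAt ℂ (cayleyMap N) p := by
  have h1 : AnalyticAt ℂ (fun p : ℂ × Mat3 => p.1) p := analyticAt_fst
  have h2 : AnalyticAt ℂ (fun p : ℂ × Mat3 => p.2) p := analyticAt_snd
  have hN' : AnalyticAt ℂ (fun p : ℂ × Mat3 => N p.1) p :=
    (hN.analyticAt p.1).comp (f := fun p : ℂ × Mat3 => p.1) h1
  have hm := (analyticAt_const (v := (1 : Mat3))).sub h2
  have hp := (analyticAt_const (v := (1 : Mat3))).add h2
  exact h1.prod (((offL.analyticAt _).comp (((hm.mul hm).mul hN').mul (hp.mul hp))).add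
    ((blkL.analyticAt _).comp h2))

theorem cayleyMap_hasFDerivAt {N : ℂ → Mat3} (hN : Differentiable ℂ N) :
    ∃ L : ℂ × Mat3 →L[ℂ] ℂ × Mat3, HasFDerivAt (cayleyMap N) L (0, 0) ∧
      (∀ p, (L p).1 = p.1) ∧ ∀ W, (L (0, W)).2 = offL ((2 : ℂ) • (N 0 * W - W * N 0)) + blkL W := by
  have h1 : HasFDerivAt (fun p : ℂ × Mat3 => p.1) (ContinuousLinearMap.fst ℂ ℂ Mat3) (0, 0) :=
    hasFDerivAt_fst
  have h2 : HasFDerivAt (fun p : ℂ × Mat3 => p.2) (ContinuousLinearMap.snd ℂ ℂ Mat3) (0, 0) :=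
    hasFDerivAt_snd
  have hN' : HasFDerivAt (fun p : ℂ × Mat3 => N p.1)
      ((fderiv ℂ N 0).comp (ContinuousLinearMap.fst ℂ ℂ Mat3)) (0, 0) :=
    HasFDerivAt.comp (g := N) (f := fun p : ℂ × Mat3 => p.1) (0, 0) (hN 0).hasFDerivAt h1
  have hm : HasFDerivAt (fun p : ℂ × Mat3 => 1 - p.2) (-ContinuousLinearMap.snd ℂ ℂ Mat3) (0, 0) :=
    h2.const_sub 1
  have hp : HasFDerivAt (fun p : ℂ × Mat3 => 1 + p.2) (ContinuousLinearMap.snd ℂ ℂ Mat3) (0, 0) :=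
    h2.const_add 1
  have hP := ((hm.fun_mul' hm).fun_mul' hN').fun_mul' (hp.fun_mul' hp)
  refine ⟨_, h1.prodMk ((offL.hasFDerivAt.comp (0, 0) hP).add
    (blkL.hasFDerivAt.comp (0, 0) h2)), fun p => rfl, fun W => ?_⟩
  simp [two_smul]
  abel

/-- The bracket with $aD$ acts on the two off-diagonal blocks as $\pm3a\ne0$. The block diagonal
part of $W$ is detected by the added term `blkL W`. -/
theorem cayleyMap_deriv_injective {N : ℂ → Mat3} {a : ℂ} (ha : a ≠ 0) (hN0 : N 0 = a • matD)
    {L : ℂ × Mat3 →L[ℂ] ℂ × Mat3} (hL1 : ∀ p, (L p).1 = p.1)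
    (hL2 : ∀ W, (L (0, W)).2 = offL ((2 : ℂ) • (N 0 * W - W * N 0)) + blkL W) :
    Function.Injective L := by
  refine (injective_iff_map_eq_zero L).2 ?_
  rintro ⟨h, W⟩ h0
  have hh : h = 0 := (hL1 (h, W)).symm.trans (congrArg Prod.fst h0)
  subst hh
  have h2 := hL2 W
  rw [h0] at h2
  obtain ⟨ho, hb⟩ := offL_add_blkL_eq_zero h2.symm
  obtain ⟨e02, e12, e20, e21⟩ := offL_eq_zero ho
  obtain ⟨b00, b01, b10, b11, b22⟩ := blkL_eq_zero hb
  rw [hN0] at e02 e12 e20 e21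
  simp only [Matrix.smul_apply, Matrix.sub_apply, Matrix.mul_apply, Fin.sum_univ_three] at e02 e12 e20 e21
  simp [matD] at e02 e12 e20 e21
  have h3 : (3 * a : ℂ) ≠ 0 := mul_ne_zero three_ne_zero ha
  have w02 : W 0 2 = 0 := mul_left_cancel₀ h3 (by linear_combination e02)
  have w12 : W 1 2 = 0 := mul_left_cancel₀ h3 (by linear_combination e12)
  have w20 : W 2 0 = 0 := mul_left_cancel₀ h3 (by linear_combination -e20)
  have w21 : W 2 1 = 0 := mul_left_cancel₀ h3 (by linear_combination -e21)
  refine Prod.ext rfl ?_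
  ext i j
  fin_cases i <;> fin_cases j <;> simp [*]

/-- For off-diagonal $Z$ the Cayley transform $g=(1+Z)(1-Z)^{-1}$ block diagonalises $N$ exactly
when $(1-Z)^2N(1+Z)^2$ is block diagonal, since $1-Z^2$ is itself block diagonal. This removes
inverses from the equation. Keeping $\zeta$ as a first coordinate lets the analytic inverse function
theorem solve it. -/
theorem exists_cayley_parameter {N : ℂ → Mat3} (hN : Differentiable ℂ N) {a : ℂ} (ha : a ≠ 0)
    (hN0 : N 0 = a • matD) (hτ : ∀ ζ, antiTau (N ζ) = N (Complex.I * ζ)) :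
    ∃ Z : ℂ → Mat3, AnalyticAt ℂ Z 0 ∧ Z 0 = 0 ∧ ∀ᶠ ζ in nhds (0 : ℂ), blkL (Z ζ) = 0 ∧
      offL ((1 - Z ζ) * (1 - Z ζ) * N ζ * ((1 + Z ζ) * (1 + Z ζ))) = 0 ∧
      antiTau (Z ζ) = -Z (Complex.I * ζ) := by
  obtain ⟨L, hL, hL1, hL2⟩ := cayleyMap_hasFDerivAt hN
  have hinj := cayleyMap_deriv_injective ha hN0 hL1 hL2
  let e : (ℂ × Mat3) ≃L[ℂ] ℂ × Mat3 :=
    (LinearEquiv.ofInjectiveEndo (L : ℂ × Mat3 →ₗ[ℂ] ℂ × Mat3) hinj).toContinuousLinearEquiv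
  have he : (e : ℂ × Mat3 →L[ℂ] ℂ × Mat3) = L := ContinuousLinearMap.ext fun p => rfl
  have han := cayleyMap_analyticAt hN (0, 0)
  have hs : HasStrictFDerivAt (cayleyMap N) (e : ℂ × Mat3 →L[ℂ] ℂ × Mat3) (0, 0) := by
    rw [he, ← hL.fderiv]
    exact han.hasStrictFDerivAt
  let ψ := hs.toOpenPartialHomeomorph (cayleyMap N)
  have hψ : ∀ p, ψ p = cayleyMap N p := fun p => rfl
  have hsrc : ((0, 0) : ℂ × Mat3) ∈ ψ.source := hs.mem_toOpenPartialHomeomorph_source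
  have hval : cayleyMap N (0, 0) = (0, 0) := by
    have h : offL (a • matD) = 0 := by
      ext i j; fin_cases i <;> fin_cases j <;> simp [offL_apply, matD]
    simp [cayleyMap, hN0, h]
  have htgt : ((0, 0) : ℂ × Mat3) ∈ ψ.target := by
    have := ψ.map_source hsrc
    rwa [hψ, hval] at this
  have hsymm0 : ψ.symm (0, 0) = (0, 0) := by
    have := ψ.left_inv hsrc
    rwa [hψ, hval] at this
  have hsan : AnalyticAt ℂ ψ.symm (0, 0) := by
    have := ψ.analyticAt_symm' (i := e) hsrc han (by rw [he]; exact hL.fderiv)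
    rwa [hψ, hval] at this
  let Z : ℂ → Mat3 := fun ζ => (ψ.symm (ζ, 0)).2
  have hline : AnalyticAt ℂ (fun ζ : ℂ => ψ.symm (ζ, (0 : Mat3))) 0 :=
    AnalyticAt.comp (f := fun ζ : ℂ => (ζ, (0 : Mat3))) hsan
      (analyticAt_id.prod analyticAt_const)
  have hZ : AnalyticAt ℂ Z 0 := analyticAt_snd.comp hline
  have hZ0 : Z 0 = 0 := by simp [Z, hsymm0]
  have hrot : Filter.Tendsto (fun ζ : ℂ => Complex.I * ζ) (nhds 0) (nhds 0) := by
    have : Continuous fun ζ : ℂ => Complex.I * ζ := by fun_prop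
    simpa using this.tendsto 0
  have ev1 : ∀ᶠ ζ in nhds (0 : ℂ), (ζ, (0 : Mat3)) ∈ ψ.target := by
    have : Continuous fun ζ : ℂ => (ζ, (0 : Mat3)) := by fun_prop
    exact this.continuousAt.eventually_mem (ψ.open_target.mem_nhds htgt)
  have ev2 : ∀ᶠ ζ in nhds (0 : ℂ), (Complex.I * ζ, -antiTau (Z ζ)) ∈ ψ.source := by
    have : ContinuousAt (fun ζ : ℂ => (Complex.I * ζ, -antiTau (Z ζ))) 0 :=
      ContinuousAt.prodMk (by fun_prop)
        ((antiTau.continuous.continuousAt.comp hZ.continuousAt).neg)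
    exact this.eventually_mem (ψ.open_source.mem_nhds (by simpa [hZ0] using hsrc))
  have hsol : ∀ ζ : ℂ, (ζ, (0 : Mat3)) ∈ ψ.target → ψ.symm (ζ, 0) = (ζ, Z ζ) ∧
      offL ((1 - Z ζ) * (1 - Z ζ) * N ζ * ((1 + Z ζ) * (1 + Z ζ))) = 0 ∧ blkL (Z ζ) = 0 := by
    intro ζ h
    have h1 := ψ.right_inv h
    rw [hψ] at h1
    have h2 : (ψ.symm (ζ, 0)).1 = ζ := congrArg Prod.fst h1
    have h3 : ψ.symm (ζ, 0) = (ζ, Z ζ) := Prod.ext h2 rfl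
    rw [h3] at h1
    exact ⟨h3, offL_add_blkL_eq_zero (congrArg Prod.snd h1)⟩
  refine ⟨Z, hZ, hZ0, ?_⟩
  filter_upwards [ev1, ev2, hrot.eventually ev1] with ζ h1 h2 h3
  obtain ⟨-, ho, hb⟩ := hsol ζ h1
  obtain ⟨hs', ho', hb'⟩ := hsol _ h3
  refine ⟨hb, ho, ?_⟩
  have hs3 : (Complex.I * ζ, Z (Complex.I * ζ)) ∈ ψ.source := by
    rw [← hs']; exact ψ.map_target h3
  have hval1 : cayleyMap N (Complex.I * ζ, Z (Complex.I * ζ)) = (Complex.I * ζ, 0) := by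
    rw [← hs']; exact ψ.right_inv h3
  -- Applying $X\mapsto SX^tS^{-1}$ to the equation at $\zeta$ shows that $-SZ_\zeta^tS^{-1}$ solves
  -- the equation at $i\zeta$. Local injectivity identifies it with $Z_{i\zeta}$.
  have hval2 : cayleyMap N (Complex.I * ζ, -antiTau (Z ζ)) = (Complex.I * ζ, 0) := by
    refine Prod.ext rfl ?_
    have e1 : (1 - -antiTau (Z ζ)) * (1 - -antiTau (Z ζ)) * N (Complex.I * ζ) *
        ((1 + -antiTau (Z ζ)) * (1 + -antiTau (Z ζ))) =
        antiTau ((1 - Z ζ) * (1 - Z ζ) * N ζ * ((1 + Z ζ) * (1 + Z ζ))) := by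
      simp only [antiTau_mul, map_add, map_sub, antiTau_one, ← hτ, mul_assoc, sub_neg_eq_add,
        ← sub_eq_add_neg]
    change offL _ + blkL _ = 0
    rw [e1, ← antiTau_offL, ho, map_zero, map_neg, ← antiTau_blkL, hb, map_zero, neg_zero, add_zero]
  have := ψ.injOn hs3 h2 (by rw [hψ, hψ, hval1, hval2])
  have h4 : Z (Complex.I * ζ) = -antiTau (Z ζ) := congrArg Prod.snd this
  rw [h4, neg_neg]

theorem det_one_sub_of_blkL {Z : Mat3} (h : blkL Z = 0) : (1 - Z).det = (1 + Z).det := by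
  obtain ⟨b00, b01, b10, b11, b22⟩ := blkL_eq_zero h
  simp only [Matrix.det_fin_three, Matrix.sub_apply, Matrix.add_apply, b00, b01, b10, b11, b22]
  simp

theorem offL_mul_self_of_blkL {Z : Mat3} (h : blkL Z = 0) : offL (Z * Z) = 0 := by
  obtain ⟨b00, b01, b10, b11, b22⟩ := blkL_eq_zero h
  ext i j
  simp only [offL_apply, Matrix.mul_apply, Fin.sum_univ_three]
  fin_cases i <;> fin_cases j <;> simp [b00, b01, b10, b11, b22]

theorem commute_of_mul_eq_one {R : Type*} [Monoid R] {D w w' : R} (h : Commute D w)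
    (h1 : w * w' = 1) (h2 : w' * w = 1) : Commute D w' := by
  change D * w' = w' * D
  calc D * w' = w' * w * D * w' := by rw [h2, one_mul]
    _ = w' * (D * w) * w' := by rw [h.eq]; simp only [mul_assoc]
    _ = w' * D * (w * w') := by simp only [mul_assoc]
    _ = w' * D := by rw [h1, mul_one]

/-- The Cayley transform conjugates `N` to a block diagonal matrix. -/
theorem cayley_commute {N Z u v : Mat3} (hb : blkL Z = 0)
    (ho : offL ((1 - Z) * (1 - Z) * N * ((1 + Z) * (1 + Z))) = 0)
    (hu : (1 - Z) * u = 1) (hv : (1 + Z) * v = 1) :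
    Commute matD ((1 - Z) * v * N * ((1 + Z) * u)) := by
  have hu' : u * (1 - Z) = 1 := mul_eq_one_comm.1 hu
  have hv' : v * (1 + Z) = 1 := mul_eq_one_comm.1 hv
  have hc : (1 - Z) * (1 + Z) = (1 + Z) * (1 - Z) := by noncomm_ring
  have hcv : v * (1 - Z) = (1 - Z) * v := by
    calc v * (1 - Z) = v * ((1 - Z) * (1 + Z)) * v := by
          rw [mul_assoc, mul_assoc, hv, mul_one]
      _ = (1 - Z) * v := by rw [hc, ← mul_assoc v, hv', one_mul]
  have hw : Commute matD ((1 - Z) * (1 + Z)) := by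
    have : (1 - Z) * (1 + Z) = 1 - Z * Z := by noncomm_ring
    rw [this]
    exact (Commute.one_right _).sub_right (commute_matD_iff.2 (offL_mul_self_of_blkL hb))
  have hw1 : (1 - Z) * (1 + Z) * (v * u) = 1 := by
    rw [mul_assoc, ← mul_assoc (1 + Z), hv, one_mul, hu]
  have hw' : Commute matD (v * u) := commute_of_mul_eq_one hw hw1 (mul_eq_one_comm.1 hw1)
  -- Up to the block diagonal factors $(1-Z^2)^{-1}=vu$ on either side, the conjugate of $N$ is the
  -- matrix assumed to be block diagonal.
  have key : (1 - Z) * v * N * ((1 + Z) * u) =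
      v * u * ((1 - Z) * (1 - Z) * N * ((1 + Z) * (1 + Z))) * (v * u) := by
    have e1 : v * u * ((1 - Z) * (1 - Z)) = (1 - Z) * v := by
      rw [← mul_assoc, mul_assoc v, hu', mul_one, hcv]
    have e2 : (1 + Z) * (1 + Z) * (v * u) = (1 + Z) * u := by
      rw [mul_assoc, ← mul_assoc (1 + Z) v, hv, one_mul]
    calc _ = v * u * ((1 - Z) * (1 - Z)) * N * ((1 + Z) * (1 + Z) * (v * u)) := by rw [e1, e2]
      _ = _ := by simp only [mul_assoc]
  rw [key]
  exact (hw'.mul_right (commute_matD_iff.2 ho)).mul_right hw'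

theorem analyticAt_inv_matrix {f : ℂ → Mat3} {c : ℂ} (hf : AnalyticAt ℂ f c)
    (h : (f c).det ≠ 0) : AnalyticAt ℂ (fun ζ => (f ζ)⁻¹) c := by
  have : (fun ζ => (f ζ)⁻¹) = fun ζ => ((f ζ).det)⁻¹ • (f ζ).adjugate := by
    funext ζ
    rw [Matrix.inv_def, Ring.inverse_eq_inv']
  rw [this]
  exact ((analyticAt_det hf).inv h).smul (analyticAt_adjugate hf)

/-- An even holomorphic function is constant up to second order at `0`. -/
theorem exists_even_quotient {h : ℂ → Mat3} {r : ℝ} (hr : 0 < r)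
    (hd : DifferentiableOn ℂ h (Metric.ball 0 r))
    (heven : ∀ ζ ∈ Metric.ball (0 : ℂ) r, h (-ζ) = h ζ) :
    ∃ m : ℂ → Mat3, DifferentiableOn ℂ m (Metric.ball 0 r) ∧ ∀ ζ, h ζ = h 0 + ζ ^ 2 • m ζ := by
  have hnhds : Metric.ball (0 : ℂ) r ∈ nhds (0 : ℂ) := Metric.ball_mem_nhds 0 hr
  have h3 : deriv h 0 = 0 := by
    have h1 : deriv (fun ζ => h (-ζ)) 0 = -deriv h 0 := by
      rw [deriv_comp_neg, neg_zero]
    have h2 : deriv (fun ζ => h (-ζ)) 0 = deriv h 0 := by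
      refine Filter.EventuallyEq.deriv_eq ?_
      filter_upwards [hnhds] with ζ hζ using heven ζ hζ
    have h4 : (2 : ℂ) • deriv h 0 = 0 := by
      rw [two_smul]
      nth_rewrite 1 [← h2]
      rw [h1, neg_add_cancel]
    exact (smul_eq_zero.1 h4).resolve_left two_ne_zero
  have hd1 : DifferentiableOn ℂ (dslope h 0) (Metric.ball 0 r) :=
    (Complex.differentiableOn_dslope hnhds).2 hd
  -- Since $h'(0)=0$, the difference quotient vanishes at $0$ and can be divided by $\zeta$ once
  -- more.
  refine ⟨dslope (dslope h 0) 0, (Complex.differentiableOn_dslope hnhds).2 hd1, fun ζ => ?_⟩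
  have e1 := sub_smul_dslope h 0 ζ
  have e2 := sub_smul_dslope (dslope h 0) 0 ζ
  rw [dslope_same, h3, sub_zero, sub_zero] at e2
  rw [sub_zero, ← e2, smul_smul, ← sq] at e1
  rw [e1]
  abel

/-- The Cayley form is chosen because $g$ then has determinant one, as $\det(1-Z)=\det(1+Z)$ for
off-diagonal $Z$, and the symmetry of $Z$ becomes the twisting of $g$. Evenness of $g^{-1}Ng$
removes its linear term, which would otherwise leave a pole $\zeta^{-1}$ in $g^{-1}\eta g$. -/
theorem exists_diagonalizer {N : ℂ → Mat3} (hN : Differentiable ℂ N) {a : ℂ} (ha : a ≠ 0)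
    (hN0 : N 0 = a • matD) (hτ : ∀ ζ, antiTau (N ζ) = N (Complex.I * ζ)) :
    ∃ r : ℝ, 0 < r ∧ ∃ g m : ℂ → Mat3, g 0 = 1 ∧ ∀ ζ : ℂ, ‖ζ‖ < r →
      AnalyticAt ℂ g ζ ∧ AnalyticAt ℂ m ζ ∧ (g ζ).det = 1 ∧
      antiTau (g ζ) * g (Complex.I * ζ) = 1 ∧
      N ζ * g ζ = g ζ * (a • matD + ζ ^ 2 • m ζ) ∧ (ζ ≠ 0 → Commute matD (m ζ)) := by
  obtain ⟨Z, hZ, hZ0, hev⟩ := exists_cayley_parameter hN ha hN0 hτ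
  have hdet1 : AnalyticAt ℂ (fun ζ => (1 - Z ζ).det) 0 :=
    analyticAt_det (analyticAt_const.sub hZ)
  have hev2 : ∀ᶠ ζ in nhds (0 : ℂ), (1 - Z ζ).det ≠ 0 :=
    hdet1.continuousAt.eventually_ne (by simp [hZ0])
  obtain ⟨r, hr, hball⟩ := Metric.eventually_nhds_iff.1
    (hev.and (hev2.and hZ.eventually_analyticAt))
  have hall : ∀ ζ : ℂ, ‖ζ‖ < r → blkL (Z ζ) = 0 ∧
      offL ((1 - Z ζ) * (1 - Z ζ) * N ζ * ((1 + Z ζ) * (1 + Z ζ))) = 0 ∧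
      antiTau (Z ζ) = -Z (Complex.I * ζ) ∧ (1 - Z ζ).det ≠ 0 ∧ (1 + Z ζ).det ≠ 0 ∧
      AnalyticAt ℂ Z ζ := by
    intro ζ h
    obtain ⟨⟨h1, h2, h3⟩, h4, h5⟩ := hball (y := ζ) (by simpa using h)
    exact ⟨h1, h2, h3, h4, by rwa [← det_one_sub_of_blkL h1], h5⟩
  have hI : ∀ ζ : ℂ, ‖ζ‖ < r → ‖Complex.I * ζ‖ < r := fun ζ h => by simpa using h
  let g : ℂ → Mat3 := fun ζ => (1 + Z ζ) * (1 - Z ζ)⁻¹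
  let k : ℂ → Mat3 := fun ζ => (1 - Z ζ) * (1 + Z ζ)⁻¹
  let h : ℂ → Mat3 := fun ζ => k ζ * N ζ * g ζ
  have hu : ∀ ζ : ℂ, ‖ζ‖ < r → (1 - Z ζ) * (1 - Z ζ)⁻¹ = 1 := fun ζ hζ =>
    Matrix.mul_nonsing_inv _ (isUnit_iff_ne_zero.2 (hall ζ hζ).2.2.2.1)
  have hv : ∀ ζ : ℂ, ‖ζ‖ < r → (1 + Z ζ) * (1 + Z ζ)⁻¹ = 1 := fun ζ hζ =>
    Matrix.mul_nonsing_inv _ (isUnit_iff_ne_zero.2 (hall ζ hζ).2.2.2.2.1)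
  have hgk : ∀ ζ : ℂ, ‖ζ‖ < r → g ζ * k ζ = 1 := fun ζ hζ => by
    simp only [g, k]
    rw [mul_assoc, ← mul_assoc (1 - Z ζ)⁻¹, mul_eq_one_comm.1 (hu ζ hζ), one_mul, hv ζ hζ]
  have hkg : ∀ ζ : ℂ, ‖ζ‖ < r → k ζ * g ζ = 1 := fun ζ hζ => mul_eq_one_comm.1 (hgk ζ hζ)
  have hga : ∀ ζ : ℂ, ‖ζ‖ < r → AnalyticAt ℂ g ζ := fun ζ hζ =>
    (analyticAt_const.add (hall ζ hζ).2.2.2.2.2).mul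
      (analyticAt_inv_matrix (analyticAt_const.sub (hall ζ hζ).2.2.2.2.2) (hall ζ hζ).2.2.2.1)
  have hka : ∀ ζ : ℂ, ‖ζ‖ < r → AnalyticAt ℂ k ζ := fun ζ hζ =>
    (analyticAt_const.sub (hall ζ hζ).2.2.2.2.2).mul
      (analyticAt_inv_matrix (analyticAt_const.add (hall ζ hζ).2.2.2.2.2) (hall ζ hζ).2.2.2.2.1)
  have hcomm : ∀ ζ : ℂ, ‖ζ‖ < r → Commute matD (h ζ) := fun ζ hζ =>
    cayley_commute (hall ζ hζ).1 (hall ζ hζ).2.1 (hu ζ hζ) (hv ζ hζ)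
  have hgτ : ∀ ζ : ℂ, ‖ζ‖ < r → antiTau (g ζ) * g (Complex.I * ζ) = 1 := by
    intro ζ hζ
    have hz := (hall ζ hζ).2.2.1
    have e1 : antiTau (1 + Z ζ) = 1 - Z (Complex.I * ζ) := by
      rw [map_add, antiTau_one, hz, sub_eq_add_neg]
    have e2 : antiTau (1 - Z ζ)⁻¹ = (1 + Z (Complex.I * ζ))⁻¹ := by
      refine (Matrix.inv_eq_left_inv ?_).symm
      have := congrArg antiTau (hu ζ hζ)
      rwa [antiTau_mul, antiTau_one, map_sub, antiTau_one, hz, sub_neg_eq_add] at this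
    simp only [g]
    rw [antiTau_mul, e1, e2]
    have hc : (1 - Z (Complex.I * ζ)) * (1 + Z (Complex.I * ζ)) =
        (1 + Z (Complex.I * ζ)) * (1 - Z (Complex.I * ζ)) := by noncomm_ring
    calc _ = (1 + Z (Complex.I * ζ))⁻¹ * ((1 - Z (Complex.I * ζ)) * (1 + Z (Complex.I * ζ))) *
          (1 - Z (Complex.I * ζ))⁻¹ := by simp only [mul_assoc]
      _ = (1 + Z (Complex.I * ζ))⁻¹ * (1 + Z (Complex.I * ζ)) *
          ((1 - Z (Complex.I * ζ)) * (1 - Z (Complex.I * ζ))⁻¹) := by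
            rw [hc]; simp only [mul_assoc]
      _ = 1 := by rw [hu _ (hI ζ hζ), mul_eq_one_comm.1 (hv _ (hI ζ hζ)), one_mul]
  have hhτ : ∀ ζ : ℂ, ‖ζ‖ < r → antiTau (h ζ) = h (Complex.I * ζ) := by
    intro ζ hζ
    have e1 : antiTau (g ζ) = k (Complex.I * ζ) := by
      calc antiTau (g ζ) = antiTau (g ζ) * (g (Complex.I * ζ) * k (Complex.I * ζ)) := by
            rw [hgk _ (hI ζ hζ), mul_one]
        _ = k (Complex.I * ζ) := by rw [← mul_assoc, hgτ ζ hζ, one_mul]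
    have e2 : antiTau (k ζ) = g (Complex.I * ζ) := by
      have h1 := congrArg antiTau (hkg ζ hζ)
      rw [antiTau_mul, antiTau_one] at h1
      calc antiTau (k ζ) = g (Complex.I * ζ) * antiTau (g ζ) * antiTau (k ζ) := by
            rw [mul_eq_one_comm.1 (hgτ ζ hζ), one_mul]
        _ = g (Complex.I * ζ) := by rw [mul_assoc, h1, mul_one]
    change antiTau (k ζ * N ζ * g ζ) =
      k (Complex.I * ζ) * N (Complex.I * ζ) * g (Complex.I * ζ)
    rw [antiTau_mul (k ζ * N ζ) (g ζ), antiTau_mul (k ζ) (N ζ), e1, e2, hτ, ← mul_assoc]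
  -- The twisting relation used twice replaces $\zeta$ by $i^2\zeta=-\zeta$, while on block diagonal
  -- matrices the antiautomorphism squares to the identity.
  have heven : ∀ ζ ∈ Metric.ball (0 : ℂ) r, h (-ζ) = h ζ := by
    intro ζ hζ
    have hζ' : ‖ζ‖ < r := by simpa using hζ
    have h1 := hhτ _ (hI ζ hζ')
    rw [← hhτ ζ hζ', antiTau_antiTau (commute_matD_iff.1 (hcomm ζ hζ')), ← mul_assoc,
      Complex.I_mul_I, neg_one_mul] at h1
    exact h1.symm
  have hha : ∀ ζ : ℂ, ‖ζ‖ < r → AnalyticAt ℂ h ζ := fun ζ hζ =>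
    ((hka ζ hζ).mul (hN.analyticAt ζ)).mul (hga ζ hζ)
  obtain ⟨m, hm, hmh⟩ := exists_even_quotient hr
    (fun ζ hζ => (hha ζ (by simpa using hζ)).differentiableAt.differentiableWithinAt) heven
  have hg0 : g 0 = 1 := by simp [g, hZ0]
  have hh0 : h 0 = a • matD := by simp [h, k, g, hZ0, hN0]
  refine ⟨r, hr, g, m, hg0, fun ζ hζ => ⟨hga ζ hζ, ?_, ?_, hgτ ζ hζ, ?_, fun hne => ?_⟩⟩
  · exact hm.analyticAt (Metric.isOpen_ball.mem_nhds (by simpa using hζ))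
  · have h1 := congrArg Matrix.det (hu ζ hζ)
    rw [Matrix.det_mul, Matrix.det_one, det_one_sub_of_blkL (hall ζ hζ).1] at h1
    simp only [g]
    rw [Matrix.det_mul, h1]
  · rw [← hh0, ← hmh]
    change N ζ * g ζ = g ζ * (k ζ * N ζ * g ζ)
    calc N ζ * g ζ = g ζ * k ζ * (N ζ * g ζ) := by rw [hgk ζ hζ, one_mul]
      _ = g ζ * (k ζ * N ζ * g ζ) := by rw [mul_assoc (g ζ), mul_assoc (k ζ)]
  · have h1 : ζ ^ 2 • m ζ = h ζ - a • matD := by rw [hmh ζ, hh0]; abel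
    have h2 : m ζ = (ζ ^ 2)⁻¹ • (h ζ - a • matD) := by
      rw [← h1, smul_smul, inv_mul_cancel₀ (pow_ne_zero 2 hne), one_smul]
    rw [h2]
    exact ((hcomm ζ hζ).sub_right ((Commute.refl _).smul_right a)).smul_right _

/-! ### Dressing the vacuum and the Symes map -/

theorem exp_mul_exp_neg (X : Mat3) : NormedSpace.exp X * NormedSpace.exp (-X) = 1 := by
  rw [Matrix.exp_neg]
  exact Matrix.mul_nonsing_inv _ ((Matrix.isUnit_iff_isUnit_det _).1 (Matrix.isUnit_exp _))

theorem semiconjBy_exp {x a b : Mat3} (h : SemiconjBy x a b) :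
    SemiconjBy x (NormedSpace.exp a) (NormedSpace.exp b) := by
  let _ : NormedAlgebra ℚ Mat3 := NormedAlgebra.restrictScalars ℚ ℂ Mat3
  exact h.exp_right

theorem barGrp_exp (X : Mat3) : barGrp (NormedSpace.exp X) = NormedSpace.exp (barAlg X) := by
  rw [barGrp, barAlg, ← Matrix.exp_conjTranspose, Matrix.exp_neg]

theorem antiTau_matD : antiTau matD = matD := by
  rw [antiTau_entries]
  simp [matD]

theorem conjTranspose_matD : matDᴴ = matD := by
  ext i j
  fin_cases i <;> fin_cases j <;> simp [matD]

theorem trace_matD : matD.trace = 0 := by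
  simp only [matD, Matrix.trace_fin_three, Matrix.of_apply, Matrix.cons_val]
  norm_num

theorem barAlg_smul (c : ℂ) (X : Mat3) : barAlg (c • X) = conj c • barAlg X := by
  rw [barAlg, barAlg, Matrix.conjTranspose_smul, smul_neg]
  rfl

/-- The scalar function `e` for which `F^μ_ζ(z) = exp(e D)`. -/
def vacuumExponent (μ : ℂ →L[ℝ] ℝ) (z ζ : ℂ) : ℂ :=
  z * ζ ^ (-2 : ℤ) * vacuumScalar μ - conj z * ζ ^ (2 : ℤ) * conj (vacuumScalar μ)

theorem vacuumFrame_coe (μ : ℂ →L[ℝ] ℝ) (z ζ : ℂ) :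
    vacuumFrame μ z (ζ : OnePoint ℂ) = NormedSpace.exp (vacuumExponent μ z ζ • matD) := by
  change NormedSpace.exp ((z * ζ ^ (-2 : ℤ)) • vacuumA μ +
    (conj z * ζ ^ (2 : ℤ)) • barAlg (vacuumA μ)) = _
  rw [vacuumA_eq, barAlg_smul, barAlg, conjTranspose_matD, smul_neg, smul_neg, smul_smul, smul_smul,
    ← sub_eq_add_neg, ← sub_smul]
  rfl

theorem vacuumExponent_rot (μ : ℂ →L[ℝ] ℝ) (z ζ : ℂ) :
    vacuumExponent μ z (Complex.I * ζ) = -vacuumExponent μ z ζ := by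
  have h2 : (Complex.I * ζ) ^ (2 : ℤ) = -ζ ^ (2 : ℤ) := by
    rw [mul_zpow]
    norm_cast
    rw [Complex.I_sq, neg_one_mul]
  have h3 : (Complex.I * ζ) ^ (-2 : ℤ) = -ζ ^ (-2 : ℤ) := by
    rw [zpow_neg, zpow_neg, h2, inv_neg]
  rw [vacuumExponent, vacuumExponent, h2, h3]
  ring

theorem vacuumExponent_inv_conj (μ : ℂ →L[ℝ] ℝ) (z ζ : ℂ) :
    vacuumExponent μ z (conj ζ)⁻¹ = -conj (vacuumExponent μ z ζ) := by
  simp only [vacuumExponent, map_sub, map_mul, map_zpow₀, Complex.conj_conj, inv_zpow', neg_neg]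
  ring

theorem vacuumFrame_det (μ : ℂ →L[ℝ] ℝ) (z ζ : ℂ) : (vacuumFrame μ z (ζ : OnePoint ℂ)).det = 1 := by
  rw [vacuumFrame_coe]
  exact det_exp_of_trace_eq_zero (by rw [Matrix.trace_smul, trace_matD, smul_zero])

theorem vacuumFrame_antiTau_mul (μ : ℂ →L[ℝ] ℝ) (z ζ : ℂ) :
    antiTau (vacuumFrame μ z (ζ : OnePoint ℂ)) *
      vacuumFrame μ z ((Complex.I * ζ : ℂ) : OnePoint ℂ) = 1 := by
  rw [vacuumFrame_coe, vacuumFrame_coe, antiTau_exp, map_smul, antiTau_matD, vacuumExponent_rot,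
    neg_smul, exp_mul_exp_neg]

theorem vacuumFrame_inv_conj (μ : ℂ →L[ℝ] ℝ) (z ζ : ℂ) :
    vacuumFrame μ z (((conj ζ)⁻¹ : ℂ) : OnePoint ℂ) =
      barGrp (vacuumFrame μ z (ζ : OnePoint ℂ)) := by
  rw [vacuumFrame_coe, vacuumFrame_coe, barGrp_exp, barAlg_smul, vacuumExponent_inv_conj, barAlg,
    conjTranspose_matD, neg_smul, smul_neg]

theorem vacuumFrame_commute (μ : ℂ →L[ℝ] ℝ) (z ζ : ℂ) {X : Mat3} (hX : Commute X matD) :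
    Commute X (vacuumFrame μ z (ζ : OnePoint ℂ)) := by
  rw [vacuumFrame_coe]
  exact semiconjBy_exp (hX.smul_right _)

theorem exists_gauge_isDressing {μ : ℂ →L[ℝ] ℝ} {α : ℤ → OneForm} (hα : IsExtendedForm α)
    (hμ : HasMaslovForm α μ) {F : ℂ → Loop} (hF : IsFrameOf α F) {ε : ℝ} (hε0 : 0 < ε)
    (hε1 : ε < 1) {g : ℂ → Mat3} (hg : IsInnerLoop ε g) {B : ℂ → ℂ → Mat3}
    (hB : ∀ z ζ : ℂ, ‖ζ‖ ≤ ε → AnalyticAt ℂ (B z) ζ) (hB0 : ContDiff ℝ ∞ fun z => B z 0)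
    (hFB : ∀ z ζ : ℂ, ζ ≠ 0 → ‖ζ‖ ≤ ε →
      g ζ * vacuumFrame μ z (ζ : OnePoint ℂ) = F z (ζ : OnePoint ℂ) * B z ζ) :
    ∃ k : ℂ → Mat3, ContDiff ℝ ∞ k ∧ (∀ z, k z ∈ G0) ∧
      IsEnlargedFrame μ (fun z p => F z p * k z) ∧
      IsDressing ε (innerExtend g) (vacuumFrame μ) (fun z p => F z p * k z) := by
  refine exists_gauge_isEFactor hα hμ hF hε0 hε1
    (a := fun z p => innerExtend g p * vacuumFrame μ z p)
    (a₀ := fun z ζ => g ζ * vacuumFrame μ z (ζ : OnePoint ℂ)) hB hB0 hFB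
    (fun z ζ _ h => ?_) (fun z ζ _ h => ?_) (fun z ζ h => ?_) (fun z ζ h => ?_)
  · rw [Matrix.det_mul, hg.det_eq_one ζ h, vacuumFrame_det, one_mul]
  · rw [antiTau_mul, mul_assoc, ← mul_assoc (antiTau (g ζ)), hg.equivariant ζ h, one_mul,
      vacuumFrame_antiTau_mul]
  · rw [innerExtend_inner g (h.trans_lt hε1)]
  · have h1 : ¬ ‖(conj ζ)⁻¹‖ < 1 := by
      rw [norm_inv, RCLike.norm_conj, h, not_lt]
      exact (one_le_inv₀ hε0).2 hε1.le
    rw [innerExtend_inner g (h.trans_lt hε1), innerExtend_outer g h1, map_inv₀, Complex.conj_conj,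
      inv_inv, barGrp_mul, vacuumFrame_inv_conj, barGrp_eq_adjugate (hg.det_eq_one ζ h.le)]

theorem exists_gauge_isSymes {μ : ℂ →L[ℝ] ℝ} {α : ℤ → OneForm} (hα : IsExtendedForm α)
    (hμ : HasMaslovForm α μ) {F : ℂ → Loop} (hF : IsFrameOf α F) {d : ℕ} {ξ : ℂ → ℂ → Mat3}
    (hξ : IsAdaptedPolynomialKillingField α d ξ) {ε : ℝ} (hε0 : 0 < ε) (hε1 : ε < 1)
    {b : ℂ → ℂ → Mat3} (hb : ∀ z ζ, AnalyticAt ℂ (b z) ζ) (hb0 : ContDiff ℝ ∞ fun z => b z 0)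
    (hFb : ∀ z ζ : ℂ, ζ ≠ 0 →
      NormedSpace.exp (z • ζ ^ (4 * d) • ξ 0 ζ) = F z (ζ : OnePoint ℂ) * b z ζ) :
    ∃ k : ℂ → Mat3, ContDiff ℝ ∞ k ∧ (∀ z, k z ∈ G0) ∧
      IsEnlargedFrame μ (fun z p => F z p * k z) ∧
      IsSymes ε (innerMul (fun ζ => ζ ^ (4 * d)) (ξ 0)) (fun z p => F z p * k z) := by
  have hin : ∀ z ζ : ℂ, ‖ζ‖ = ε → innerMul (fun _ => z) (innerMul (fun ζ => ζ ^ (4 * d)) (ξ 0)) ζ =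
      z • ζ ^ (4 * d) • ξ 0 ζ := fun z ζ h => by
    rw [innerMul, if_pos (h.trans_lt hε1), innerMul, if_pos (h.trans_lt hε1)]
  refine exists_gauge_isEFactor hα hμ hF hε0 hε1
    (a := fun z => ofPlane fun ζ => NormedSpace.exp
      (innerMul (fun _ => z) (innerMul (fun ζ => ζ ^ (4 * d)) (ξ 0)) ζ))
    (a₀ := fun z ζ => NormedSpace.exp (z • ζ ^ (4 * d) • ξ 0 ζ)) (fun z ζ _ => hb z ζ) hb0
    (fun z ζ hζ _ => hFb z ζ hζ) (fun z ζ hζ _ => ?_) (fun z ζ hζ _ => ?_) (fun z ζ h => ?_)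
    (fun z ζ h => ?_)
  · exact det_exp_of_trace_eq_zero (by
      rw [Matrix.trace_smul, Matrix.trace_smul, hξ.trace_eq_zero 0 ζ hζ, smul_zero, smul_zero])
  -- The factor $\zeta^{4d}$ is invariant under $\zeta\mapsto i\zeta$, so multiplying by it keeps
  -- the twisting.
  · rw [antiTau_exp, ← hξ.equivariant 0 ζ hζ, tauAlg_eq, map_smul, map_smul, mul_pow, pow_mul
      Complex.I, Complex.I_pow_four, one_pow, one_mul, smul_neg, smul_neg, exp_mul_exp_neg]
  · exact congrArg NormedSpace.exp (hin z ζ h)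
  · have hζ : ζ ≠ 0 := norm_pos_iff.1 (h ▸ hε0)
    have h1 : ¬ ‖(conj ζ)⁻¹‖ < 1 := by
      rw [norm_inv, RCLike.norm_conj, h, not_lt]
      exact (one_le_inv₀ hε0).2 hε1.le
    change NormedSpace.exp (innerMul (fun _ => z) (innerMul (fun ζ => ζ ^ (4 * d)) (ξ 0)) (conj ζ)⁻¹) =
      barGrp (NormedSpace.exp (innerMul (fun _ => z) (innerMul (fun ζ => ζ ^ (4 * d)) (ξ 0)) ζ))
    rw [hin z ζ h, innerMul, if_neg h1, innerMul, if_neg h1, ← hξ.real 0 ζ hζ, barGrp_exp, barAlg_smul,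
      barAlg_smul, map_inv₀, Complex.conj_conj, inv_inv]

/-! ### The polynomial part of an adapted Killing field -/

theorem IsAdaptedPolynomialKillingField.exists_polynomial {α : ℤ → OneForm} {d : ℕ}
    {ξ : ℂ → ℂ → Mat3} (hξ : IsAdaptedPolynomialKillingField α d ξ) :
    ∃ N : ℂ → Mat3, Differentiable ℂ N ∧ N 0 = ddz (α (-2)) 0 ∧
      ∀ ζ : ℂ, ζ ≠ 0 → N ζ = ζ ^ 2 • ζ ^ (4 * d) • ξ 0 ζ := by
  obtain ⟨c, -, hexp, hc2, -⟩ := hξ.expansion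
  refine ⟨fun ζ => ∑ n ∈ Finset.Icc (-(4 * (d : ℤ) + 2)) (4 * (d : ℤ) + 2),
    ζ ^ (n + (4 * d + 2)).toNat • c n 0, by fun_prop, ?_, fun ζ hζ => ?_⟩
  · beta_reduce
    rw [Finset.sum_eq_single_of_mem (-(4 * (d : ℤ) + 2)) (Finset.mem_Icc.2 ⟨le_rfl, by linarith⟩)]
    · rw [hc2]
      simp
    · intro n hn hne
      have := Finset.mem_Icc.1 hn
      rw [zero_pow (by lia), zero_smul]
  · rw [hexp 0 ζ hζ, Finset.smul_sum, Finset.smul_sum]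
    refine Finset.sum_congr rfl fun n hn => ?_
    have := Finset.mem_Icc.1 hn
    rw [smul_smul, smul_smul, ← zpow_natCast, ← zpow_natCast, ← zpow_natCast, Int.toNat_of_nonneg
      (by lia), ← zpow_add₀ hζ, ← zpow_add₀ hζ]
    congr 2
    push_cast
    ring

/-- The intertwining relation gives $g\exp(P+M)=\exp(X)g$. Used with $X=z\eta$, $P=z\zeta^{-2}A$,
$M=zm$ and $Q=\bar z\zeta^2\bar A$, it absorbs the singular factor $\exp P$ into $\exp(z\eta)$ and
leaves factors holomorphic at $\zeta=0$. -/
theorem mul_exp_eq_of_mul_eq {X g P Q M : Mat3} (h : X * g = g * (P + M)) (hPM : Commute P M)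
    (hPQ : Commute P Q) : g * NormedSpace.exp (P + Q) =
      NormedSpace.exp X * (g * NormedSpace.exp (-M) * NormedSpace.exp Q) := by
  have h1 : g * NormedSpace.exp (P + M) = NormedSpace.exp X * g :=
    semiconjBy_exp h.symm
  rw [Matrix.exp_add_of_commute _ _ hPQ, ← mul_assoc, ← mul_assoc, ← mul_assoc, ← h1,
    Matrix.exp_add_of_commute _ _ hPM, mul_assoc g (_ * _), mul_assoc (NormedSpace.exp P),
    exp_mul_exp_neg, mul_one, mul_assoc]

/-- The dressing of the vacuum which produces the solution of an adapted polynomial Killing field. -/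
theorem exists_vacuum_dressing {α : ℤ → OneForm} (hα : IsExtendedForm α) {μ : ℂ →L[ℝ] ℝ}
    (hμ : μ ≠ 0) (hαμ : HasMaslovForm α μ) {d : ℕ} {ξ : ℂ → ℂ → Mat3}
    (hξ : IsAdaptedPolynomialKillingField α d ξ) :
    ∃ ε : ℝ, 0 < ε ∧ ε < 1 ∧ ∃ g : ℂ → Mat3, IsInnerLoop ε g ∧ g 0 = 1 ∧
      ∃ p : ℂ → ℂ → Mat3, (∀ z ζ : ℂ, ‖ζ‖ ≤ ε → AnalyticAt ℂ (p z) ζ) ∧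
        (ContDiff ℝ ∞ fun z => p z 0) ∧ ∀ z ζ : ℂ, ζ ≠ 0 → ‖ζ‖ ≤ ε →
        g ζ * vacuumFrame μ z (ζ : OnePoint ℂ) =
          NormedSpace.exp (z • ζ ^ (4 * d) • ξ 0 ζ) * p z ζ := by
  obtain ⟨N, hN, hN0, hNξ⟩ := hξ.exists_polynomial
  rw [ddz_neg_two_eq hα hαμ, vacuumA_eq] at hN0
  -- The extra factor $\zeta^2$ changes sign under $\zeta\mapsto i\zeta$; this turns
  -- $\tau(\xi_\zeta)=\xi_{i\zeta}$ into a relation for $N$ without a sign.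
  have hNτ : ∀ ζ, antiTau (N ζ) = N (Complex.I * ζ) := by
    intro ζ
    rcases eq_or_ne ζ 0 with rfl | hζ
    · rw [mul_zero, hN0, map_smul, antiTau_matD]
    · rw [hNξ ζ hζ, hNξ _ (mul_ne_zero Complex.I_ne_zero hζ), ← hξ.equivariant 0 ζ hζ, tauAlg_eq,
        map_smul, map_smul, mul_pow, mul_pow, pow_mul Complex.I, Complex.I_pow_four,
        one_pow, one_mul, Complex.I_sq, smul_neg, smul_neg, neg_one_mul, neg_smul, neg_neg]
  obtain ⟨r, hr, g, m, hg0, h⟩ := exists_diagonalizer hN (vacuumScalar_ne_zero hμ) hN0 hNτ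
  have hlt : ∀ ζ : ℂ, ‖ζ‖ ≤ min (r / 2) (1 / 2) → ‖ζ‖ < r := fun ζ hζ => by
    have := hζ.trans (min_le_left _ _)
    linarith
  -- The bound $r/2$ keeps the closed disc inside the domain of the diagonaliser, and $1/2$ ensures
  -- $\epsilon<1$.
  refine ⟨min (r / 2) (1 / 2), by positivity, (min_le_right _ _).trans_lt (by norm_num), g,
    ⟨fun ζ hζ => (h ζ (hlt ζ hζ)).1, fun ζ hζ => (h ζ (hlt ζ hζ)).2.2.1,
      fun ζ hζ => (h ζ (hlt ζ hζ)).2.2.2.1⟩, hg0,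
    fun z ζ => g ζ * NormedSpace.exp (-(z • m ζ)) *
      NormedSpace.exp ((conj z * ζ ^ (2 : ℤ)) • barAlg (vacuumA μ)), fun z ζ hζ => ?_, ?_,
    fun z ζ hne hζ => ?_⟩
  · obtain ⟨hga, hma, -⟩ := h ζ (hlt ζ hζ)
    have hq : AnalyticAt ℂ (fun ζ : ℂ => (conj z * ζ ^ (2 : ℤ)) • barAlg (vacuumA μ)) ζ := by
      norm_cast
      fun_prop
    exact (hga.mul ((NormedSpace.exp_analytic (𝕂 := ℂ) _).comp (hma.const_smul (c := z)).neg)).mul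
      ((NormedSpace.exp_analytic (𝕂 := ℂ) _).comp hq)
  · have he : ContDiff ℝ ∞ (NormedSpace.exp : Mat3 → Mat3) :=
      contDiff_iff_contDiffAt.2 fun x => (NormedSpace.exp_analytic (𝕂 := ℝ) x).contDiffAt
    refine (contDiff_const.mul (he.comp (contDiff_id.smul contDiff_const).neg)).mul ?_
    simpa using contDiff_const
  · obtain ⟨-, -, -, -, hd, hc⟩ := h ζ (hlt ζ hζ)
    refine mul_exp_eq_of_mul_eq (P := (z * ζ ^ (-2 : ℤ)) • vacuumA μ) ?_ ?_ ?_
    · have h2 : ζ ^ (4 * d) • ξ 0 ζ = ζ ^ (-2 : ℤ) • N ζ := by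
        rw [hNξ ζ hne, smul_smul, zpow_neg]
        norm_cast
        rw [inv_mul_cancel₀ (pow_ne_zero 2 hne), one_smul]
      rw [h2, Matrix.smul_mul, Matrix.smul_mul, hd, vacuumA_eq, ← Matrix.mul_smul, ← Matrix.mul_smul,
        smul_add, smul_add, smul_smul (ζ ^ (-2 : ℤ)) (ζ ^ 2), zpow_neg, mul_smul z]
      norm_cast
      rw [inv_mul_cancel₀ (pow_ne_zero 2 hne), one_smul]
    · rw [vacuumA_eq]
      exact (((hc hne).smul_left _).smul_left _).smul_right _
    · rw [vacuumA_eq, barAlg_smul, barAlg, conjTranspose_matD]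
      exact ((((Commute.refl matD).neg_right.smul_right _).smul_right _).smul_left _).smul_left _

theorem IsInnerLoop.conj_const {ε : ℝ} {g : ℂ → Mat3} (hg : IsInnerLoop ε g) {c : Mat3}
    (hc : c ∈ G0) : IsInnerLoop ε fun ζ => c * g ζ * cᴴ where
  analytic ζ h := (analyticAt_const.mul (hg.analytic ζ h)).mul analyticAt_const
  det_eq_one ζ h := by
    rw [Matrix.det_mul, Matrix.det_mul, G0_det hc, hg.det_eq_one ζ h, G0_det (G0_conjTranspose hc),
      one_mul, one_mul]
  equivariant ζ h := by
    rw [antiTau_mul, antiTau_mul, G0_antiTau_star hc, G0_antiTau hc]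
    calc c * (antiTau (g ζ) * cᴴ) * (c * g (Complex.I * ζ) * cᴴ) =
        c * (antiTau (g ζ) * (cᴴ * c) * g (Complex.I * ζ)) * cᴴ := by simp only [mul_assoc]
      _ = 1 := by rw [G0_star_mul hc, mul_one, hg.equivariant ζ h, mul_one, G0_mul_star hc]

theorem gaugeEquivalent_of_gauge {F : ℂ → Loop} {k l : ℂ → Mat3} (hk : ContDiff ℝ ∞ k)
    (hl : ContDiff ℝ ∞ l) (hkG : ∀ z, k z ∈ G0) (hlG : ∀ z, l z ∈ G0) :
    GaugeEquivalent (fun z p => F z p * k z) (fun z p => F z p * l z) := by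
  refine ⟨fun z => (k z)ᴴ * l z, (conjTransposeL.contDiff.comp hk).mul hl,
    fun z => G0_mul (G0_conjTranspose (hkG z)) (hlG z), fun z ζ _ => ?_⟩
  beta_reduce
  rw [mul_assoc, ← mul_assoc (k z), G0_mul_star (hkG z), one_mul]

end HSL

end

/-! ### The solution of an adapted Killing field as a dressed vacuum -/

theorem mainTheorem10
    (μ : ℂ →L[ℝ] ℝ) (hμ : μ ≠ 0)
    (α : ℤ → HSL.OneForm) (hα : HSL.IsExtendedMaurerCartanForm α)
    (hαμ : HSL.HasMaslovForm α μ)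
    (d : ℕ) (ξ : ℂ → ℂ → HSL.Mat3)
    (hξ : HSL.IsAdaptedPolynomialKillingField α d ξ) :
    ∃ ε : ℝ, 0 < ε ∧ ε < 1 ∧ ∃ g : HSL.Loop, HSL.MemLoopGroupB ε g ∧
      ∃ H K F : ℂ → HSL.Loop,
        -- `H = g ♯ F^μ`, `K = Φ(η)` with `η = ζ^{4d} ξ(0)`, and `[H] = [K]`
        HSL.IsEnlargedFrame μ H ∧ HSL.IsDressing ε g (HSL.vacuumFrame μ) H ∧
        HSL.IsEnlargedFrame μ K ∧ HSL.IsSymes ε (HSL.innerMul (fun ζ => ζ ^ (4 * d)) (ξ 0)) K ∧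
        HSL.GaugeEquivalent H K ∧
        -- `F` is the extended frame of `α` with `F(0) = 1`, and `[F] = [K]`
        HSL.IsFrameOf α F ∧ (∀ ζ : ℂ, ζ ≠ 0 → F 0 (ζ : OnePoint ℂ) = 1) ∧
        HSL.GaugeEquivalent F K ∧
        -- every based extended frame of `α` lies in the dressing orbit of the vacuum
        ∀ F' : ℂ → HSL.Loop, HSL.IsFrameOf α F' → HSL.IsBased F' →
          ∃ (g' : HSL.Loop) (H' : ℂ → HSL.Loop), HSL.MemLoopGroupB ε g' ∧
            HSL.IsEnlargedFrame μ H' ∧ HSL.IsDressing ε g' (HSL.vacuumFrame μ) H' ∧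
            HSL.GaugeEquivalent H' F' := by
  have hα' := hα.toIsExtendedForm
  obtain ⟨ε, hε0, hε1, g, hg, hg0, p, hp, hp0, hgp⟩ :=
    HSL.exists_vacuum_dressing hα' hμ hαμ hξ
  obtain ⟨F, hF, hF0⟩ := HSL.exists_extended_frame hα
  obtain ⟨b, hb, hb0, hFb⟩ := HSL.exists_holomorphic_factor hα hξ hF hF0
  obtain ⟨k, hk, hkG, hkE, hkS⟩ := HSL.exists_gauge_isSymes hα' hαμ hF hξ hε0 hε1 hb hb0 hFb
  -- The two factorisations combine to $gF^\mu=\exp(z\eta)p=F\,(bp)$ with $bp$ holomorphic at $0$,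
  -- so dressing and Symes map yield gauge transforms of the same $F$.
  have hgF : ∀ z ζ : ℂ, ζ ≠ 0 → ‖ζ‖ ≤ ε → g ζ * HSL.vacuumFrame μ z (ζ : OnePoint ℂ) =
      F z (ζ : OnePoint ℂ) * (b z ζ * p z ζ) := fun z ζ hne hζ => by
    rw [hgp z ζ hne hζ, hFb z ζ hne, mul_assoc]
  obtain ⟨l, hl, hlG, hlE, hlD⟩ := HSL.exists_gauge_isDressing hα' hαμ hF hε0 hε1 hg
    (B := fun z ζ => b z ζ * p z ζ) (fun z ζ hζ => (hb z ζ).mul (hp z ζ hζ)) (hb0.mul hp0) hgF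
  refine ⟨ε, hε0, hε1, HSL.innerExtend g,
    hg.memLoopGroupB hε0 hε1 (hg0 ▸ HSL.one_mem_groupB), _, _, F, hlE, hlD, hkE, hkS,
    HSL.gaugeEquivalent_of_gauge hl hk hlG hkG, hF, hF0, ⟨k, hk, hkG, fun _ _ _ => rfl⟩, ?_⟩
  rintro F' hF' ⟨c, hc, hc0⟩
  have hFF' : ∀ z ζ : ℂ, ζ ≠ 0 → F' z (ζ : OnePoint ℂ) = c * F z (ζ : OnePoint ℂ) :=
    fun z ζ hζ => by rw [hF.eq_const_mul hα' hF' hζ (hF0 ζ hζ), hc0 ζ hζ]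
  -- Since $c^\dagger=c^{-1}$ commutes with the vacuum, $(cgc^{-1})F^\mu=c\,gF^\mu
  -- c^{-1}=F'\,(bp\,c^{-1})$. The dressing loop still has value $1$ at $\zeta=0$, so it satisfies
  -- the normalisation.
  obtain ⟨l', hl', hlG', hlE', hlD'⟩ := HSL.exists_gauge_isDressing hα' hαμ hF' hε0 hε1
    (hg.conj_const hc) (B := fun z ζ => b z ζ * p z ζ * cᴴ)
    (fun z ζ hζ => ((hb z ζ).mul (hp z ζ hζ)).mul analyticAt_const)
    ((hb0.mul hp0).mul contDiff_const) (fun z ζ hne hζ => by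
      have hcomm := HSL.vacuumFrame_commute μ z ζ
        (HSL.G0C_commute_matD (HSL.G0_conjTranspose hc).1)
      rw [mul_assoc, hcomm.eq, hFF' z ζ hne, mul_assoc c, mul_assoc c, ← mul_assoc (g ζ),
        hgF z ζ hne hζ, mul_assoc (F z _)])
  refine ⟨_, _, (hg.conj_const hc).memLoopGroupB hε0 hε1 ?_, hlE', hlD', fun z => (l' z)ᴴ,
    HSL.conjTransposeL.contDiff.comp hl', fun z => HSL.G0_conjTranspose (hlG' z), fun z ζ _ => ?_⟩
  · rw [hg0, mul_one, HSL.G0_mul_star hc]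
    exact HSL.one_mem_groupB
  · beta_reduce
    rw [mul_assoc, HSL.G0_mul_star (hlG' z), mul_one]
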